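/- **The calculus SFPC.** Types are generated by $\tau ::= \alpha \mid \mathbb R \mid 1 \mid \tau*\tau \mid \tau\to\tau \mid \{\ell_1\,\tau_1 \mid\dots\mid \ell_n\,\tau_n\} \mid \mu\alpha.\tau$ (type variables, reals, unit, products, functions, variants over a finite set of labels, iso-recursive types). Terms in a context $\Gamma$ of variables of closed type are given by the usual simply typed rules for: variables; primitives $\underline f(t_1,\dots,t_n):\mathbb R$ for every measurable partial function $f:\mathbb R^n\rightharpoonup\mathbb R$ and $t_i:\mathbb R$ (in particular constants $\underline r$, $r\in\mathbb R$); $\mathtt{ifz}(t;s;u)$, testing whether $t:\mathbb R$ is $0$; $\mathtt{sample}:\mathbb R$; $\mathtt{score}(t):1$ for $t:\mathbb R$; the constructors $()$, $(t,s)$, $\ell_i\,t$, $\mathtt{roll}(t):\mu\alpha.\sigma$ for $t:\sigma[\mu\alpha.\sigma/\alpha]$; $\lambda x{:}\sigma.t$ and application $t\,s$; and pattern matching on unit, product, variant and recursive types. Closed values are $v ::= \underline r\mid ()\mid (v,w)\mid \ell_i\,v\mid \mathtt{roll}(v)\mid \lambda x.t$. The set $\mathrm{Val}_\tau$ of closed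 values of type $\tau$ carries the $\sigma$-algebra of the coproduct of the Borel spaces $\mathbb R^n$ over all value templates with $n$ holes (each used once, in order) that stand for the real constants. **Operational semantics.** For closed $t:\tau$ define measures $t\Downarrow_n$ on $\mathrm{Val}_\tau$ by $t\Downarrow_0 := 0$ and, for $n>0$, by the call-by-value big-step rules read as compositions of kernels (with arguments evaluated from left to right): $\mathtt{sample}\Downarrow_n$ is the image of the uniform distribution on $[0,1]$ under $r\mapsto\underline r$; $\mathtt{score}(t)\Downarrow_n$ is $t\Downarrow_n$ followed by $\underline r\mapsto |r|\cdot\delta_{()}$; constants, $()$ and abstractions evaluate to their Dirac measures; primitives apply $f$ to the values of their arguments and give $0$ where $f$ is undefined; $\mathtt{ifz}$, constructors and matching on unit evaluate their immediate subterms at the same index $n$; and application and matching on products, variants and recursive types evaluate their immediate subterms at index $n$ and then the body, with the resulting values substituted, at index $n-1$. Put $t\Downarrow := \sup_n t\Downarrow_n$. For closed $t,s:\tau$, write $t\precsim s$ (contextual preorder) if $C[t]\Downarrow\ \le\ C[s]\Downarrow$ as measures on $\mathrm{Val}_{\mathbb R}$ for every program context $C$ of type $\mathbb R$, i.e. every term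 $C:\mathbb R$ whose only free variable is a hole of type $\tau$ (which may occur any number of times); and $t\approx s$ (contextual equivalence) if $t\precsim s$ and $s\precsim t$. **The model.** An $\omega$-quasi-Borel space (ωqbs) is an ωcpo $X$ with a set $M_X\subseteq X^{\mathbb R}$ of random elements that contains the constants and is closed under precomposition with Borel maps $\mathbb R\to\mathbb R$, under countable Borel case splitting, and under pointwise suprema of $\omega$-chains. Morphisms are the Scott-continuous functions that preserve random elements by composition. Here $\mathbb R$ has the discrete order and $[0,\infty]$ its linear order, both with the measurable functions as random elements; products, exponentials $Y^X$, coproducts and the lifting $X_\bot$ are the standard ones, and partial maps $X\rightharpoonup Y$ are morphisms $X\to Y_\bot$. For an ωqbs $X$ let $JX=[0,\infty]^{[0,\infty]^X}$, and for a partial map $\alpha:\mathbb R\rightharpoonup X$ let $E_\alpha\in JX$, $E_\alpha(w)=\int_{\mathrm{dom}\,\alpha} w(\alpha(r))\,dr$ (Lebesgue measure). Then $TX\subseteq JX$ is the closure of $\{E_\alpha\}$ under suprema of $\omega$-chains, with the induced order; its random elements are the closure, under suprema of $\omega$-chains in $(JX)^{\mathbb R}$, of the set of all $r\mapsto E_{\alpha(r)}$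 with $\alpha$ a random element of $(X_\bot)^{\mathbb R}$. $T$ is a monad, with the unit and bind of the continuation monad. A type with free type variables denotes a locally continuous mixed-variance functor on ωqbses and partial maps: $[\![\sigma\to\tau]\!]=(T[\![\tau]\!])^{[\![\sigma]\!]}$; products and variants denote products and coproducts; and $[\![\mu\alpha.\tau]\!]$ is the bilimit of the chain of embedding-projection pairs obtained by iterating $[\![\tau]\!]$ on the empty space, with its canonical isomorphism to $[\![\tau[\mu\alpha.\tau/\alpha]]\!]$. A term $\Gamma\vdash t:\tau$ denotes a morphism $[\![t]\!]:[\![\Gamma]\!]\to T[\![\tau]\!]$ by the standard call-by-value monadic interpretation, where $[\![\mathtt{sample}]\!](w)=\int_0^1 w(r)\,dr$, $\mathtt{score}$ is interpreted by $r\mapsto(w\mapsto|r|\cdot w(()))$, and an undefined primitive denotes $0$. Morphisms are ordered pointwise. **Theorem (Adequacy).** For every closed SFPC type $\tau$ and all closed terms $t,s$ of type $\tau$: if $[\![t]\!]\le[\![s]\!]$, then $t\precsim s$. In particular, if $[\![t]\!]=[\![s]\!]$, then $t\approx s$. -/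

import Mathlib

open MeasureTheory OmegaCompletePartialOrder

namespace SFPC

/-! ## ω-quasi-Borel spaces -/

/-- An ω-quasi-Borel space: an ωcpo with a set `rand` of random elements `ℝ → X` that contains the
constants, is closed under measurable reparametrisation, countable measurable case splitting
(`i` is the index function of a countable Borel partition of `ℝ`), and pointwise sups of chains. -/
class WQbs (X : Type) extends OmegaCompletePartialOrder X where
  rand : Set (ℝ → X)
  rand_const : ∀ x : X, (fun _ => x) ∈ rand
  rand_comp : ∀ α ∈ rand, ∀ h : ℝ → ℝ, Measurable h → (fun r => α (h r)) ∈ rand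
  rand_split : ∀ i : ℝ → ℕ, Measurable i → ∀ α : ℕ → ℝ → X, (∀ n, α n ∈ rand) →
    (fun r => α (i r) r) ∈ rand
  rand_sup : ∀ c : Chain (ℝ → X), (∀ n, c n ∈ rand) →
    OmegaCompletePartialOrder.ωSup (α := ℝ → X) c ∈ rand

open WQbs (rand)

/-- Morphisms: Scott-continuous functions that preserve random elements. -/
def IsMor {X Y : Type} [WQbs X] [WQbs Y] (f : X → Y) : Prop :=
  ωScottContinuous f ∧ ∀ α ∈ rand (X := X), (fun r => f (α r)) ∈ rand (X := Y)

/-- Bundled morphisms. -/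
structure Hom (X Y : Type) [WQbs X] [WQbs Y] where
  toFun : X → Y
  isMor : IsMor toFun

infixr:25 " ⟶ω " => Hom

instance {X Y : Type} [WQbs X] [WQbs Y] : CoeFun (X ⟶ω Y) (fun _ => X → Y) := ⟨Hom.toFun⟩

/-! ### Suprema of chains -/

/-- `c` is an ω-chain with least upper bound `x`. -/
def IsSup {X : Type} [PartialOrder X] (c : ℕ → X) (x : X) : Prop :=
  Monotone c ∧ IsLUB (Set.range c) x

section IsSup
variable {X Y Z : Type}

theorem IsSup.le [PartialOrder X] {c : ℕ → X} {x : X} (h : IsSup c x) (n : ℕ) : c n ≤ x :=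
  h.2.1 ⟨n, rfl⟩

theorem IsSup.lub [PartialOrder X] {c : ℕ → X} {x y : X} (h : IsSup c x) (hy : ∀ n, c n ≤ y) :
    x ≤ y :=
  h.2.2 (by rintro _ ⟨n, rfl⟩; exact hy n)

theorem isSup_of [PartialOrder X] {c : ℕ → X} {x : X} (hm : Monotone c) (h : ∀ n, c n ≤ x)
    (h' : ∀ y, (∀ n, c n ≤ y) → x ≤ y) : IsSup c x :=
  ⟨hm, by rintro _ ⟨n, rfl⟩; exact h n, fun y hy => h' y fun n => hy ⟨n, rfl⟩⟩

theorem IsSup.unique [PartialOrder X] {c : ℕ → X} {x y : X} (h : IsSup c x) (h' : IsSup c y) :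
    x = y := h.2.unique h'.2

theorem isSup_const [PartialOrder X] (x : X) : IsSup (fun _ => x) x :=
  isSup_of monotone_const (fun _ => le_rfl) fun _ h => h 0

theorem isSup_ωSup [OmegaCompletePartialOrder X] (c : Chain X) : IsSup c (ωSup c) :=
  ⟨c.monotone, isLUB_range_ωSup c⟩

theorem exists_isSup [OmegaCompletePartialOrder X] {c : ℕ → X} (h : Monotone c) :
    ∃ x, IsSup c x := ⟨_, isSup_ωSup ⟨⟨c, h⟩⟩⟩

theorem IsSup.shift [PartialOrder X] {c : ℕ → X} {x : X} (h : IsSup c x) (k : ℕ) :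
    IsSup (fun n => c (k + n)) x :=
  isSup_of (fun _ _ hab => h.1 (by omega)) (fun n => h.le _)
    fun y hy => h.lub fun n => (h.1 (by omega : n ≤ k + n)).trans (hy n)

theorem IsSup.of_shift [PartialOrder X] {c : ℕ → X} {x : X} (hm : Monotone c) (k : ℕ)
    (h : IsSup (fun n => c (k + n)) x) : IsSup c x :=
  isSup_of hm (fun n => (hm (by omega : n ≤ k + n)).trans (h.le n))
    fun _ hy => h.lub fun _ => hy _

theorem IsSup.diag [PartialOrder X] {c : ℕ → ℕ → X} {d : ℕ → X} {x : X}
    (h : ∀ n, IsSup (c n) (d n)) (hd : IsSup d x) (hm : ∀ k, Monotone fun n => c n k) :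
    IsSup (fun n => c n n) x :=
  isSup_of (fun a b hab => (hm a hab).trans ((h b).1 hab)) (fun n => ((h n).le n).trans (hd.le n))
    fun _ hy => hd.lub fun n => (h n).lub fun k =>
      ((hm k (le_max_left n k)).trans ((h _).1 (le_max_right n k))).trans (hy _)

theorem isSup_pi {ι : Type} {P : ι → Type} [∀ i, PartialOrder (P i)] {c : ℕ → ∀ i, P i}
    {x : ∀ i, P i} : IsSup c x ↔ ∀ i, IsSup (fun n => c n i) (x i) := by
  constructor
  · intro h i
    refine ⟨fun a b hab => h.1 hab i, ?_⟩
    have := (isLUB_pi.1 h.2) i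
    rwa [← Set.range_comp] at this
  · intro h
    refine ⟨fun a b hab i => (h i).1 hab, isLUB_pi.2 fun i => ?_⟩
    rw [← Set.range_comp]; exact (h i).2

theorem isSup_prod [PartialOrder X] [PartialOrder Y] {c : ℕ → X × Y} {x : X × Y} :
    IsSup c x ↔ IsSup (fun n => (c n).1) x.1 ∧ IsSup (fun n => (c n).2) x.2 := by
  constructor
  · intro h
    have := isLUB_prod.1 h.2
    rw [← Set.range_comp, ← Set.range_comp] at this
    exact ⟨⟨fun a b hab => (h.1 hab).1, this.1⟩, ⟨fun a b hab => (h.1 hab).2, this.2⟩⟩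
  · rintro ⟨h, h'⟩
    refine ⟨fun a b hab => ⟨h.1 hab, h'.1 hab⟩, isLUB_prod.2 ?_⟩
    rw [← Set.range_comp, ← Set.range_comp]; exact ⟨h.2, h'.2⟩

theorem scott_iff [OmegaCompletePartialOrder X] [OmegaCompletePartialOrder Y] {f : X → Y} :
    ωScottContinuous f ↔ ∀ c x, IsSup c x → IsSup (fun n => f (c n)) (f x) := by
  constructor
  · intro h c x hc
    have e : x = ωSup ⟨⟨c, hc.1⟩⟩ := hc.unique (isSup_ωSup ⟨⟨c, hc.1⟩⟩)
    rw [e, h.map_ωSup]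
    exact isSup_ωSup (Chain.map ⟨⟨c, hc.1⟩⟩ ⟨f, h.monotone⟩)
  · intro h
    have hm : Monotone f := by
      intro a b hab
      have := h (fun n => if n = 0 then a else b) b (isSup_of
        (by intro m n hmn; dsimp only; split_ifs <;> first | exact le_rfl | exact hab | omega)
        (by intro n; split_ifs <;> first | exact hab | exact le_rfl)
        (fun y hy => by simpa using hy 1))
      simpa using this.le 0
    refine ωScottContinuous.of_monotone_map_ωSup ⟨hm, fun c => ?_⟩
    exact (h c _ (isSup_ωSup c)).unique (isSup_ωSup (c.map ⟨f, hm⟩))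

/-- An ωcpo structure from the existence of sups of chains. -/
noncomputable abbrev ocpoOf (X : Type) [PartialOrder X]
    (h : ∀ c : ℕ → X, Monotone c → ∃ x, IsSup c x) : OmegaCompletePartialOrder X where
  ωSup c := (h c c.monotone).choose
  le_ωSup c := (h c c.monotone).choose_spec.le
  ωSup_le c _ hx := (h c c.monotone).choose_spec.lub hx

theorem rand_isSup [WQbs X] {c : ℕ → ℝ → X} {α : ℝ → X} (hc : ∀ n, c n ∈ rand (X := X))
    (h : ∀ r, IsSup (fun n => c n r) (α r)) : α ∈ rand (X := X) := by
  have h' : IsSup c α := isSup_pi.2 h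
  have := WQbs.rand_sup ⟨⟨c, h'.1⟩⟩ hc
  rwa [← h'.unique (isSup_ωSup ⟨⟨c, h'.1⟩⟩)] at this

theorem rand_sup_of [OmegaCompletePartialOrder X] {M : Set (ℝ → X)}
    (h : ∀ (c : ℕ → ℝ → X) (α : ℝ → X), (∀ n, c n ∈ M) → (∀ r, IsSup (fun n => c n r) (α r)) →
      α ∈ M) (c : Chain (ℝ → X)) (hc : ∀ n, c n ∈ M) : ωSup c ∈ M :=
  h c _ hc (isSup_pi.1 (isSup_ωSup c))

theorem rand_ite [WQbs X] {α β : ℝ → X} (hα : α ∈ rand (X := X)) (hβ : β ∈ rand (X := X))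
    {s : Set ℝ} [DecidablePred (· ∈ s)] (hs : MeasurableSet s) :
    (fun r => if r ∈ s then α r else β r) ∈ rand (X := X) := by
  have := WQbs.rand_split (X := X) (fun r => if r ∈ s then 0 else 1)
    (Measurable.ite hs measurable_const measurable_const) (fun n => if n = 0 then α else β)
    (fun n => by split_ifs <;> assumption)
  convert this using 2 with r
  by_cases h : r ∈ s <;> simp [h]

end IsSup

/-! ### Morphisms -/

section Mor
variable {X Y Z : Type} [WQbs X] [WQbs Y] [WQbs Z]

theorem isMor_iff {f : X → Y} : IsMor f ↔ (∀ c x, IsSup c x → IsSup (fun n => f (c n)) (f x)) ∧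
    ∀ α ∈ rand (X := X), (fun r => f (α r)) ∈ rand (X := Y) := by
  rw [IsMor, scott_iff]

theorem IsMor.isSup {f : X → Y} (h : IsMor f) {c : ℕ → X} {x : X} (hc : IsSup c x) :
    IsSup (fun n => f (c n)) (f x) := scott_iff.1 h.1 c x hc

theorem IsMor.mono {f : X → Y} (h : IsMor f) : Monotone f := h.1.monotone

theorem isMor_id : IsMor (fun x : X => x) := isMor_iff.2 ⟨fun _ _ h => h, fun _ h => h⟩

theorem isMor_const (y : Y) : IsMor (fun _ : X => y) :=
  isMor_iff.2 ⟨fun _ _ _ => isSup_const y, fun _ _ => WQbs.rand_const y⟩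

theorem IsMor.comp {g : Y → Z} {f : X → Y} (hg : IsMor g) (hf : IsMor f) :
    IsMor (fun x => g (f x)) :=
  isMor_iff.2 ⟨fun _ _ h => hg.isSup (hf.isSup h), fun α h => hg.2 _ (hf.2 α h)⟩

@[ext] theorem Hom.ext {f g : X ⟶ω Y} (h : ∀ x, f x = g x) : f = g := by
  cases f; cases g; congr; exact funext h

/-- Identity morphism. -/
def Hom.id (X : Type) [WQbs X] : X ⟶ω X := ⟨fun x => x, isMor_id⟩

/-- Composition, in diagrammatic order. -/
def Hom.then (f : X ⟶ω Y) (g : Y ⟶ω Z) : X ⟶ω Z := ⟨fun x => g (f x), g.isMor.comp f.isMor⟩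

end Mor

/-! ### Reals, weights, unit, products, powers -/

/-- The space of real values: the real line with the discrete order. -/
def Rl : Type := ℝ

instance : PartialOrder Rl where
  le a b := a = b
  le_refl _ := rfl
  le_trans _ _ _ := Eq.trans
  le_antisymm _ _ h _ := h

theorem isSup_discrete {X : Type} [PartialOrder X] (hX : ∀ a b : X, a ≤ b → a = b) {c : ℕ → X}
    {x : X} (h : IsSup c x) (n : ℕ) : c n = x := hX _ _ (h.le n)

theorem ocpo_discrete {X : Type} [PartialOrder X] (hX : ∀ a b : X, a ≤ b → a = b) (c : ℕ → X)
    (hc : Monotone c) : ∃ x, IsSup c x :=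
  ⟨c 0, by
    have : c = fun _ => c 0 := funext fun n => (hX _ _ (hc (Nat.zero_le n))).symm
    rw [this]; exact isSup_const _⟩

noncomputable instance : OmegaCompletePartialOrder Rl := ocpoOf Rl (ocpo_discrete fun _ _ h => h)

theorem measurable_split {β : Type} [MeasurableSpace β] {i : ℝ → ℕ} (hi : Measurable i)
    {α : ℕ → ℝ → β} (hα : ∀ n, Measurable (α n)) : Measurable fun r => α (i r) r :=
  Measurable.comp (g := fun p : ℕ × ℝ => α p.1 p.2) (measurable_from_prod_countable_right hα)
    (hi.prodMk measurable_id)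

/-- Random real values are the measurable functions. -/
noncomputable instance : WQbs Rl where
  rand := {α | Measurable (β := ℝ) α}
  rand_const _ := measurable_const (α := ℝ) (β := ℝ)
  rand_comp _ hα _ hh := Measurable.comp (β := ℝ) (γ := ℝ) hα hh
  rand_split _ hi _ hα := measurable_split (β := ℝ) hi hα
  rand_sup := rand_sup_of fun c α hc h => by
    have : α = c 0 := funext fun r => (isSup_discrete (fun _ _ h => h) (h r) 0).symm
    rw [this]; exact hc 0

/-- The space `[0, ∞]` of weights, with its linear order and the measurable functions. -/
abbrev Wt : Type := ENNReal

theorem isSup_wt {c : ℕ → Wt} {x : Wt} : IsSup c x ↔ Monotone c ∧ x = ⨆ n, c n :=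
  ⟨fun h => ⟨h.1, h.2.unique isLUB_iSup⟩, fun ⟨h, e⟩ => ⟨h, e ▸ isLUB_iSup⟩⟩

noncomputable instance : WQbs Wt where
  rand := {α | Measurable α}
  rand_const _ := measurable_const
  rand_comp _ hα _ hh := Measurable.comp hα hh
  rand_split _ hi _ hα := measurable_split hi hα
  rand_sup := rand_sup_of fun c α hc h => by
    have : α = fun r => ⨆ n, c n r := funext fun r => (isSup_wt.1 (h r)).2
    rw [this]; exact Measurable.iSup hc

instance : WQbs Unit where
  rand := Set.univ
  rand_const _ := trivial
  rand_comp _ _ _ _ := trivial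
  rand_split _ _ _ _ := trivial
  rand_sup _ _ := trivial

noncomputable instance : OmegaCompletePartialOrder Empty :=
  ocpoOf Empty (ocpo_discrete fun a => a.elim)

/-- The empty space. -/
noncomputable instance : WQbs Empty where
  rand := Set.univ
  rand_const _ := trivial
  rand_comp _ _ _ _ := trivial
  rand_split _ _ _ _ := trivial
  rand_sup _ _ := trivial

section Prod
variable {X Y Z : Type} [WQbs X] [WQbs Y] [WQbs Z]

/-- Products. -/
instance : WQbs (X × Y) where
  rand := {α | (fun r => (α r).1) ∈ rand (X := X) ∧ (fun r => (α r).2) ∈ rand (X := Y)}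
  rand_const _ := ⟨WQbs.rand_const _, WQbs.rand_const _⟩
  rand_comp _ hα h hh := ⟨WQbs.rand_comp _ hα.1 h hh, WQbs.rand_comp _ hα.2 h hh⟩
  rand_split _ hi _ hα := ⟨WQbs.rand_split _ hi _ fun n => (hα n).1,
    WQbs.rand_split _ hi _ fun n => (hα n).2⟩
  rand_sup := rand_sup_of fun _ _ hc h => ⟨rand_isSup (fun n => (hc n).1) fun r =>
    (isSup_prod.1 (h r)).1, rand_isSup (fun n => (hc n).2) fun r => (isSup_prod.1 (h r)).2⟩

theorem isMor_fst : IsMor (fun p : X × Y => p.1) :=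
  isMor_iff.2 ⟨fun _ _ h => (isSup_prod.1 h).1, fun _ h => h.1⟩

theorem isMor_snd : IsMor (fun p : X × Y => p.2) :=
  isMor_iff.2 ⟨fun _ _ h => (isSup_prod.1 h).2, fun _ h => h.2⟩

theorem IsMor.pair {f : Z → X} {g : Z → Y} (hf : IsMor f) (hg : IsMor g) :
    IsMor (fun z => (f z, g z)) :=
  isMor_iff.2 ⟨fun _ _ h => isSup_prod.2 ⟨hf.isSup h, hg.isSup h⟩,
    fun α h => ⟨hf.2 α h, hg.2 α h⟩⟩

/-- Powers. -/
instance {ι : Type} : WQbs (ι → X) where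
  rand := {α | ∀ i, (fun r => α r i) ∈ rand (X := X)}
  rand_const _ _ := WQbs.rand_const _
  rand_comp _ hα h hh i := WQbs.rand_comp _ (hα i) h hh
  rand_split _ hi _ hα j := WQbs.rand_split _ hi _ fun n => hα n j
  rand_sup := rand_sup_of fun _ _ hc h i => rand_isSup (fun n => hc n i) fun r => isSup_pi.1 (h r) i

theorem IsMor.pi {ι : Type} {f : Z → ι → X} (hf : ∀ i, IsMor fun z => f z i) : IsMor f :=
  isMor_iff.2 ⟨fun _ _ h => isSup_pi.2 fun i => (hf i).isSup h, fun α h i => (hf i).2 α h⟩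

/-- A random element of `X` is the same thing as a morphism from the space of reals to `X`. -/
theorem isMor_of_rand {α : ℝ → X} (h : α ∈ rand (X := X)) : IsMor (X := Rl) α := by
  refine isMor_iff.2 ⟨fun c x hc => ?_, fun β hβ => WQbs.rand_comp α h β hβ⟩
  have : c = fun _ => x := funext fun n => isSup_discrete (fun _ _ h => h) hc n
  rw [this]; exact isSup_const _

theorem rand_id : (fun r : ℝ => (r : Rl)) ∈ rand (X := Rl) := measurable_id (α := ℝ)

theorem IsMor.rand {f : Rl → X} (h : IsMor f) : (fun r : ℝ => f r) ∈ rand (X := X) := h.2 _ rand_id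

end Prod

/-! ### Function spaces -/

section Exp
variable {X Y Z : Type} [WQbs X] [WQbs Y] [WQbs Z]

instance : PartialOrder (X ⟶ω Y) where
  le f g := ∀ x, f x ≤ g x
  le_refl _ _ := le_rfl
  le_trans _ _ _ h h' x := (h x).trans (h' x)
  le_antisymm _ _ h h' := Hom.ext fun x => (h x).antisymm (h' x)

theorem isMor_isSup {f : ℕ → X → Y} {g : X → Y} (hf : ∀ n, IsMor (f n))
    (h : ∀ x, IsSup (fun n => f n x) (g x)) : IsMor g := by
  refine isMor_iff.2 ⟨fun c x hc => ?_, fun α hα => rand_isSup (fun n => (hf n).2 α hα)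
    fun r => h (α r)⟩
  have hm : Monotone g := fun a b hab => (h a).lub fun n => ((hf n).mono hab).trans ((h b).le n)
  exact isSup_of (fun a b hab => hm (hc.1 hab)) (fun n => hm (hc.le n)) fun y hy =>
    (h x).lub fun n => ((hf n).isSup hc).lub fun k => ((h (c k)).le n).trans (hy k)

theorem Hom.isSup_of {f : ℕ → (X ⟶ω Y)} {g : X ⟶ω Y} (h : ∀ x, IsSup (fun n => f n x) (g x)) :
    IsSup f g :=
  SFPC.isSup_of (fun _ _ hab x => (h x).1 hab) (fun n x => (h x).le n) fun _ hk x =>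
    (h x).lub fun n => hk n x

theorem Hom.exists_isSup (f : ℕ → (X ⟶ω Y)) (hf : Monotone f) :
    ∃ g : X ⟶ω Y, ∀ x, IsSup (fun n => f n x) (g x) := by
  choose g hg using fun x => SFPC.exists_isSup (c := fun n => f n x) fun a b hab => hf hab x
  exact ⟨⟨g, isMor_isSup (fun n => (f n).isMor) hg⟩, hg⟩

noncomputable instance : OmegaCompletePartialOrder (X ⟶ω Y) :=
  ocpoOf _ fun f hf => (Hom.exists_isSup f hf).imp fun _ => Hom.isSup_of

theorem Hom.isSup_iff {f : ℕ → (X ⟶ω Y)} {g : X ⟶ω Y} :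
    IsSup f g ↔ ∀ x, IsSup (fun n => f n x) (g x) := by
  refine ⟨fun h => ?_, Hom.isSup_of⟩
  obtain ⟨g', hg'⟩ := Hom.exists_isSup f h.1
  rw [h.unique (Hom.isSup_of hg')]; exact hg'

/-- Exponentials: the random elements are the curried morphisms out of `Rl × X`. -/
noncomputable instance : WQbs (X ⟶ω Y) where
  rand := {α | IsMor fun p : Rl × X => α p.1 p.2}
  rand_const f := f.isMor.comp isMor_snd
  rand_comp α hα h hh := IsMor.comp (g := fun p : Rl × X => α p.1 p.2) hα
    (f := fun p : Rl × X => ((h p.1 : Rl), p.2))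
    (((isMor_of_rand (X := Rl) hh).comp isMor_fst).pair isMor_snd)
  rand_split i hi α hα := by
    refine isMor_iff.2 ⟨fun c x hc => ?_, fun β hβ => ?_⟩
    · have h1 := (isSup_prod.1 hc).1
      have : ∀ n, (c n).1 = x.1 := isSup_discrete (fun _ _ h => h) h1
      simp only [this]
      exact (α _ _).isMor.isSup (isSup_prod.1 hc).2
    · exact WQbs.rand_split (fun r => i (β r).1) (hi.comp hβ.1) (fun n r => α n (β r).1 (β r).2)
        fun n => (hα n).2 β hβ
  rand_sup := rand_sup_of fun c α hc h =>
    isMor_isSup (f := fun n (p : Rl × X) => c n p.1 p.2) hc fun p => Hom.isSup_iff.1 (h p.1) p.2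

theorem IsMor.app {f : X → (Y ⟶ω Z)} {g : X → Y} (hf : IsMor f) (hg : IsMor g) :
    IsMor (fun x => f x (g x)) := by
  refine isMor_iff.2 ⟨fun c x hc => ?_, fun α hα => ?_⟩
  · have h1 := hf.isSup hc
    exact IsSup.diag (c := fun n k => f (c n) (g (c k))) (fun n => (f (c n)).isMor.isSup
      (hg.isSup hc)) (Hom.isSup_iff.1 h1 _) fun k a b hab => h1.1 hab _
  · exact (hf.2 α hα).2 (fun r => ((r : Rl), g (α r))) ⟨rand_id, hg.2 α hα⟩

theorem IsMor.at {f : X × Y → Z} (h : IsMor f) (x : X) : IsMor (fun y => f (x, y)) :=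
  h.comp ((isMor_const x).pair isMor_id)

theorem IsMor.curry {f : X → Y → Z} (h : IsMor fun p : X × Y => f p.1 p.2) :
    IsMor (fun x => (⟨f x, h.at x⟩ : Y ⟶ω Z)) := by
  refine isMor_iff.2 ⟨fun c x hc => Hom.isSup_of fun y => ?_, fun α hα => ?_⟩
  · exact h.isSup (c := fun n => (c n, y)) (x := (x, y)) (isSup_prod.2 ⟨hc, isSup_const y⟩)
  · exact h.comp (((isMor_of_rand hα).comp isMor_fst).pair isMor_snd)

theorem IsMor.lam {f : X → (Y ⟶ω Z)} (h : IsMor fun p : X × Y => f p.1 p.2) : IsMor f := h.curry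

end Exp

/-! ### Coproducts -/

section Sigma
variable {ι : Type} {P : ι → Type} [∀ i, WQbs (P i)]

theorem isSup_sigma {i : ι} {a : ℕ → P i} {x : P i} (h : IsSup a x) :
    IsSup (fun n => (⟨i, a n⟩ : Σ i, P i)) ⟨i, x⟩ := by
  refine isSup_of (fun m n hmn => Sigma.mk_le_mk_iff.2 (h.1 hmn))
    (fun n => Sigma.mk_le_mk_iff.2 (h.le n)) fun y hy => ?_
  obtain ⟨j, y⟩ := y
  obtain rfl : i = j := (Sigma.le_def.1 (hy 0)).1
  exact Sigma.mk_le_mk_iff.2 (h.lub fun n => Sigma.mk_le_mk_iff.1 (hy n))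

theorem sigma_chain {c : ℕ → Σ i, P i} (hc : Monotone c) :
    ∃ (i : ι) (a : ℕ → P i), Monotone a ∧ c = fun n => ⟨i, a n⟩ := by
  have h : ∀ n, ∃ a : P (c 0).1, c n = ⟨(c 0).1, a⟩ := fun n => by
    have h := (Sigma.le_def.1 (hc (Nat.zero_le n))).1
    generalize c n = d at *
    obtain ⟨j, d⟩ := d
    dsimp only at h
    subst h
    exact ⟨d, rfl⟩
  choose a ha using h
  refine ⟨_, a, fun m n hmn => ?_, funext ha⟩
  have := hc hmn
  rw [ha m, ha n] at this
  exact Sigma.mk_le_mk_iff.1 this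

noncomputable instance : OmegaCompletePartialOrder (Σ i, P i) :=
  ocpoOf _ fun c hc => by
    obtain ⟨i, a, ha, rfl⟩ := sigma_chain hc
    obtain ⟨x, hx⟩ := exists_isSup ha
    exact ⟨_, isSup_sigma hx⟩

theorem sigma_isSup {c : ℕ → Σ i, P i} {x : Σ i, P i} (h : IsSup c x) :
    ∃ (i : ι) (a : ℕ → P i) (y : P i), IsSup a y ∧ (∀ n, c n = ⟨i, a n⟩) ∧ x = ⟨i, y⟩ := by
  obtain ⟨i, a, ha, rfl⟩ := sigma_chain h.1
  obtain ⟨y, hy⟩ := exists_isSup ha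
  exact ⟨i, a, y, hy, fun _ => rfl, h.unique (isSup_sigma hy)⟩

theorem sigma_idx_eq {c : ℕ → Σ i, P i} {x : Σ i, P i} (h : IsSup c x) (n : ℕ) :
    (c n).1 = x.1 := by
  obtain ⟨i, a, y, -, e, rfl⟩ := sigma_isSup h
  rw [e]

/-- Coproducts: a random element is a measurable choice of the summand together with a random
element of each summand, restricted to the set where that summand is chosen. (Empty summands
have no random elements and are never chosen.) -/
noncomputable instance : WQbs (Σ i, P i) where
  rand := {f | ∀ i, MeasurableSet {r | (f r).1 = i} ∧
    (Nonempty (P i) → ∃ a ∈ rand (X := P i), ∀ r, (f r).1 = i → f r = ⟨i, a r⟩)}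
  rand_const x i := by
    refine ⟨MeasurableSet.const _, fun ⟨y⟩ => ?_⟩
    by_cases h : x.1 = i
    · obtain ⟨j, x⟩ := x
      dsimp only at h
      subst h
      exact ⟨fun _ => x, WQbs.rand_const x, fun _ _ => rfl⟩
    · exact ⟨fun _ => y, WQbs.rand_const y, fun _ h' => absurd h' h⟩
  rand_comp f hf h hh i := by
    refine ⟨hh (hf i).1, fun hne => ?_⟩
    obtain ⟨a, ha, h'⟩ := (hf i).2 hne
    exact ⟨_, WQbs.rand_comp a ha h hh, fun r hr => h' (h r) hr⟩
  rand_split k hk f hf i := by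
    constructor
    · have : {r | (f (k r) r).1 = i} = ⋃ n, k ⁻¹' {n} ∩ {r | (f n r).1 = i} := by
        ext r; simp
      rw [this]
      exact MeasurableSet.iUnion fun n => (hk (measurableSet_singleton n)).inter (hf n i).1
    · intro hne
      choose a ha h using fun n => (hf n i).2 hne
      exact ⟨_, WQbs.rand_split k hk a ha, fun r hr => h (k r) r hr⟩
  rand_sup := rand_sup_of fun c f hc h i => by
    have hidx : ∀ n r, (c n r).1 = (f r).1 := fun n r => sigma_idx_eq (h r) n
    have hms : MeasurableSet {r | (f r).1 = i} := by
      simp only [← hidx 0]; exact (hc 0 i).1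
    refine ⟨hms, fun hne => ?_⟩
    choose a ha h' using fun n => (hc n i).2 hne
    obtain ⟨x0⟩ := hne
    classical
    have key : ∀ r, ∃ y, IsSup (fun n => if r ∈ {r | (f r).1 = i} then a n r else x0) y ∧
        ((f r).1 = i → f r = ⟨i, y⟩) := fun r => by
      by_cases hr : (f r).1 = i
      · obtain ⟨j, b, y, hb, e, e'⟩ := sigma_isSup (h r)
        have hj : j = i := by rw [← hr, e']
        subst hj
        have : ∀ n, a n r = b n := fun n => by
          have := (h' n r ((hidx n r).trans hr)).symm.trans (e n)
          exact eq_of_heq (Sigma.mk.inj this).2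
        refine ⟨y, ?_, fun _ => e'⟩
        simpa [hr, this] using hb
      · exact ⟨x0, by simpa [hr] using isSup_const x0, fun h => absurd h hr⟩
    choose y hy hfy using key
    exact ⟨y, rand_isSup (fun n => rand_ite (ha n) (WQbs.rand_const x0) hms) hy, hfy⟩

theorem isMor_inj (i : ι) : IsMor (fun x : P i => (⟨i, x⟩ : Σ i, P i)) := by
  refine isMor_iff.2 ⟨fun _ _ h => isSup_sigma h, fun α hα j => ⟨MeasurableSet.const (i = j), ?_⟩⟩
  rintro ⟨y⟩
  by_cases h : i = j
  · subst h; exact ⟨α, hα, fun _ _ => rfl⟩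
  · exact ⟨fun _ => y, WQbs.rand_const y, fun _ h' => absurd h' h⟩

theorem IsMor.cotuple [Countable ι] {G Y : Type} [WQbs G] [WQbs Y] {g : ∀ i, G → P i → Y}
    (hg : ∀ i, IsMor fun p : G × P i => g i p.1 p.2) :
    IsMor (fun p : G × (Σ i, P i) => g p.2.1 p.1 p.2.2) := by
  refine isMor_iff.2 ⟨fun c x hc => ?_, fun α hα => ?_⟩
  · obtain ⟨h1, h2⟩ := isSup_prod.1 hc
    obtain ⟨i, a, y, ha, e, e'⟩ := sigma_isSup h2
    have e : (fun n => g (c n).2.1 (c n).1 (c n).2.2) = fun n => g i (c n).1 (a n) :=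
      funext fun n => by rw [e n]
    rw [e', e]
    exact (hg i).isSup (c := fun n => ((c n).1, a n)) (x := (x.1, y)) (isSup_prod.2 ⟨h1, ha⟩)
  · obtain ⟨h1, h2⟩ := hα
    obtain ⟨enc, henc⟩ := exists_injective_nat ι
    have hm : Measurable fun r => enc (α r).2.1 := by
      refine measurable_to_countable' fun n => ?_
      by_cases h : ∃ i, enc i = n
      · obtain ⟨i, rfl⟩ := h
        convert (h2 i).1 using 1
        ext r; simp [henc.eq_iff]
      · convert MeasurableSet.empty
        ext r; simp only [Set.mem_preimage, Set.mem_singleton_iff, Set.mem_empty_iff_false,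
          iff_false]
        exact fun h' => h ⟨_, h'⟩
    have key : ∀ n, ∃ β ∈ WQbs.rand (X := Y), ∀ r, enc (α r).2.1 = n →
        g (α r).2.1 (α r).1 (α r).2.2 = β r := fun n => by
      by_cases h : ∃ i, enc i = n ∧ Nonempty (P i)
      · obtain ⟨i, rfl, hne⟩ := h
        obtain ⟨a, ha, h'⟩ := (h2 i).2 hne
        refine ⟨_, (hg i).2 (fun r => ((α r).1, a r)) ⟨h1, ha⟩, fun r hr => ?_⟩
        have e : (α r).2 = ⟨i, a r⟩ := h' r (henc hr)
        rw [e]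
      · refine ⟨_, WQbs.rand_const (g (α 0).2.1 (α 0).1 (α 0).2.2), fun r hr => ?_⟩
        exact absurd ⟨_, hr, ⟨(α r).2.2⟩⟩ h
    choose β hβ hβ' using key
    convert WQbs.rand_split _ hm β hβ using 2 with r
    exact hβ' _ r rfl

end Sigma

/-! ### Lifting -/

/-- The lifting `X_⊥`: a new bottom element is added. -/
abbrev Lift (X : Type) : Type := WithBot X

/-- Case analysis on a lifting. -/
def Lift.elim {X Y : Type} (d : Y) (f : X → Y) (u : Lift X) : Y := WithBot.recBotCoe d f u

section Lift
variable {X Y Z G : Type} [WQbs X] [WQbs Y] [WQbs Z] [WQbs G]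

@[simp] theorem Lift.elim_bot {X Y : Type} (d : Y) (f : X → Y) : Lift.elim d f ⊥ = d := rfl
@[simp] theorem Lift.elim_coe {X Y : Type} (d : Y) (f : X → Y) (x : X) :
    Lift.elim d f (x : Lift X) = f x := rfl

theorem Lift.coe_of_ne {X : Type} {u : Lift X} (h : u ≠ ⊥) : ∃ x : X, u = x :=
  (WithBot.ne_bot_iff_exists.1 h).imp fun _ h => h.symm

theorem isSup_coe {a : ℕ → X} {x : X} (h : IsSup a x) :
    IsSup (fun n => (a n : Lift X)) (x : Lift X) := by
  refine isSup_of (fun m n hmn => WithBot.coe_le_coe.2 (h.1 hmn))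
    (fun n => WithBot.coe_le_coe.2 (h.le n)) fun y hy => ?_
  induction y using WithBot.recBotCoe with
  | bot => exact absurd (hy 0) (by simp)
  | coe y => exact WithBot.coe_le_coe.2 (h.lub fun n => WithBot.coe_le_coe.1 (hy n))

theorem lift_chain {c : ℕ → Lift X} (hc : Monotone c) {k : ℕ} (hk : c k ≠ ⊥) :
    ∃ a : ℕ → X, Monotone a ∧ ∀ n, c (k + n) = a n := by
  have h : ∀ n, ∃ x : X, c (k + n) = x := fun n =>
    Lift.coe_of_ne fun h => hk (le_bot_iff.1 (h ▸ hc (Nat.le_add_right k n)))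
  choose a ha using h
  refine ⟨a, fun m n hmn => ?_, ha⟩
  have := hc (Nat.add_le_add_left hmn k)
  rw [ha, ha] at this
  exact WithBot.coe_le_coe.1 this

noncomputable instance : OmegaCompletePartialOrder (Lift X) :=
  ocpoOf _ fun c hc => by
    by_cases h : ∃ k, c k ≠ ⊥
    · obtain ⟨k, hk⟩ := h
      obtain ⟨a, ha, e⟩ := lift_chain hc hk
      obtain ⟨x, hx⟩ := exists_isSup ha
      refine ⟨x, IsSup.of_shift hc k ?_⟩
      simpa only [e] using isSup_coe hx
    · push Not at h
      refine ⟨⊥, ?_⟩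
      rw [show c = fun _ => ⊥ from funext h]
      exact isSup_const _

theorem lift_isSup {c : ℕ → Lift X} {u : Lift X} (h : IsSup c u) :
    (u = ⊥ ∧ ∀ n, c n = ⊥) ∨ ∃ (k : ℕ) (a : ℕ → X) (x : X), IsSup a x ∧ u = x ∧
      ∀ n, c (k + n) = a n := by
  by_cases hc : ∃ k, c k ≠ ⊥
  · obtain ⟨k, hk⟩ := hc
    obtain ⟨a, ha, e⟩ := lift_chain h.1 hk
    obtain ⟨x, hx⟩ := exists_isSup ha
    refine Or.inr ⟨k, a, x, hx, (h.shift k).unique ?_, e⟩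
    simpa only [e] using isSup_coe hx
  · push Not at hc
    exact Or.inl ⟨le_bot_iff.1 (h.lub fun n => (hc n).le), hc⟩

theorem lift_isSup_bot {c : ℕ → Lift X} {u : Lift X} (h : IsSup c u) :
    u = ⊥ ↔ ∀ n, c n = ⊥ := by
  refine ⟨fun e n => le_bot_iff.1 (e ▸ h.le n), fun e => le_bot_iff.1 (h.lub fun n => (e n).le)⟩

/-- A random element of `X_⊥` is a random element of `X` restricted to a Borel set. (If `X` is
empty it is constantly `⊥`.) -/
noncomputable instance : WQbs (Lift X) where
  rand := {f | MeasurableSet {r | f r ≠ ⊥} ∧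
    (Nonempty X → ∃ a ∈ rand (X := X), ∀ r, f r ≠ ⊥ → f r = a r)}
  rand_const u := by
    refine ⟨MeasurableSet.const _, fun ⟨y⟩ => ?_⟩
    induction u using WithBot.recBotCoe with
    | bot => exact ⟨_, WQbs.rand_const y, fun _ h => absurd rfl h⟩
    | coe x => exact ⟨_, WQbs.rand_const x, fun _ _ => rfl⟩
  rand_comp f hf h hh := by
    refine ⟨hh hf.1, fun hne => ?_⟩
    obtain ⟨a, ha, h'⟩ := hf.2 hne
    exact ⟨_, WQbs.rand_comp a ha h hh, fun r hr => h' (h r) hr⟩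
  rand_split k hk f hf := by
    constructor
    · have : {r | f (k r) r ≠ ⊥} = ⋃ n, k ⁻¹' {n} ∩ {r | f n r ≠ ⊥} := by
        ext r; simp
      rw [this]
      exact MeasurableSet.iUnion fun n => (hk (measurableSet_singleton n)).inter (hf n).1
    · intro hne
      choose a ha h using fun n => (hf n).2 hne
      exact ⟨_, WQbs.rand_split k hk a ha, fun r hr => h (k r) r hr⟩
  rand_sup := rand_sup_of fun c f hc h => by
    classical
    have hbot : ∀ r, f r ≠ ⊥ ↔ ∃ n, c n r ≠ ⊥ := fun r => by
      rw [Ne, lift_isSup_bot (h r)]; push Not; rfl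
    have hms : MeasurableSet {r | f r ≠ ⊥} := by
      have : {r | f r ≠ ⊥} = ⋃ n, {r | c n r ≠ ⊥} := by ext r; simp [hbot]
      rw [this]; exact MeasurableSet.iUnion fun n => (hc n).1
    refine ⟨hms, fun hne => ?_⟩
    choose a ha h' using fun n => (hc n).2 hne
    obtain ⟨x0⟩ := hne
    let k : ℝ → ℕ := fun r => if hr : ∃ n, c n r ≠ ⊥ then Nat.find hr else 0
    have hk : Measurable k := by
      refine measurable_to_countable' fun n => ?_
      have hset : k ⁻¹' {n} = ({r | c n r ≠ ⊥} ∩ ⋂ m ∈ Set.Iio n, {r | c m r ≠ ⊥}ᶜ) ∪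
          (if n = 0 then {r | f r ≠ ⊥}ᶜ else ∅) := by
        ext r
        simp only [Set.mem_preimage, Set.mem_singleton_iff, k, Set.mem_union, Set.mem_inter_iff,
          Set.mem_ofPred_eq, Set.mem_iInter, Set.mem_Iio, Set.mem_compl_iff, not_not]
        split_ifs with hr h0 h0
        · rw [Nat.find_eq_iff]; simp [hbot, h0, hr]
        · rw [Nat.find_eq_iff]; simp
        · push Not at hr; simp [h0, hbot, hr]
        · push Not at hr; simp [hr]; omega
      rw [hset]
      refine MeasurableSet.union ((hc n).1.inter (MeasurableSet.biInter (Set.to_countable _)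
        fun m _ => (hc m).1.compl)) ?_
      split_ifs
      · exact hms.compl
      · exact MeasurableSet.empty
    have key : ∀ r, ∃ y, IsSup (fun n => if r ∈ {r | f r ≠ ⊥} then a (k r + n) r else x0) y ∧
        (f r ≠ ⊥ → f r = y) := fun r => by
      by_cases hr : f r ≠ ⊥
      · have hr' := (hbot r).1 hr
        have hkr : c (k r) r ≠ ⊥ := by
          simp only [k, dif_pos hr']; exact Nat.find_spec hr'
        obtain ⟨b, hb, e⟩ := lift_chain (h r).1 hkr
        obtain ⟨y, hy⟩ := exists_isSup hb
        have e2 : ∀ n, a (k r + n) r = b n := fun n => by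
          have := h' (k r + n) r (by rw [e n]; simp)
          exact WithBot.coe_injective (this.symm.trans (e n))
        refine ⟨y, by simpa [hr, e2] using hy, fun _ => ((h r).shift (k r)).unique ?_⟩
        simpa only [e] using isSup_coe hy
      · exact ⟨x0, by simpa [hr] using isSup_const x0, fun h => absurd h hr⟩
    choose y hy hfy using key
    exact ⟨y, rand_isSup (fun n => rand_ite
      (WQbs.rand_split k hk (fun j => a (j + n)) fun j => ha (j + n))
      (WQbs.rand_const x0) hms) hy, hfy⟩

theorem isMor_coe : IsMor (fun x : X => (x : Lift X)) :=
  isMor_iff.2 ⟨fun _ _ h => isSup_coe h, fun α hα => ⟨by simp, fun _ => ⟨α, hα, fun _ _ => rfl⟩⟩⟩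

theorem IsMor.elim {bot : Y} (hb : ∀ y, bot ≤ y) {g : G → X → Y} {u : G → Lift X}
    (hg : IsMor fun p : G × X => g p.1 p.2) (hu : IsMor u) :
    IsMor (fun x => Lift.elim bot (g x) (u x)) := by
  have hmono : Monotone fun p : G × Lift X => Lift.elim bot (g p.1) p.2 := by
    rintro ⟨x, u⟩ ⟨x', u'⟩ ⟨h, h'⟩
    dsimp only at h h' ⊢
    induction u using WithBot.recBotCoe with
    | bot => exact hb _
    | coe u =>
      induction u' using WithBot.recBotCoe with
      | bot => simp at h'
      | coe u' => exact hg.mono (a := (x, u)) (b := (x', u')) ⟨h, WithBot.coe_le_coe.1 h'⟩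
  suffices H : IsMor fun p : G × Lift X => Lift.elim bot (g p.1) p.2 from
    H.comp (isMor_id.pair hu)
  refine isMor_iff.2 ⟨fun c x hc => ?_, fun α hα => ?_⟩
  · obtain ⟨h1, h2⟩ := isSup_prod.1 hc
    rcases lift_isSup h2 with ⟨e, e'⟩ | ⟨k, a, y, ha, e, e'⟩
    · simp only [e, e']; exact isSup_const _
    · refine IsSup.of_shift (fun m n hmn => hmono (hc.1 hmn)) k ?_
      simp only [e, e']
      exact hg.isSup (c := fun n => ((c (k + n)).1, a n)) (x := (x.1, y))
        (isSup_prod.2 ⟨h1.shift k, ha⟩)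
  · obtain ⟨h1, h2, h3⟩ := hα
    classical
    by_cases hne : Nonempty X
    · obtain ⟨a, ha, h3⟩ := h3 hne
      convert rand_ite (hg.2 (fun r => ((α r).1, a r)) ⟨h1, ha⟩) (WQbs.rand_const bot) h2
        using 2 with r
      by_cases hr : (α r).2 = ⊥
      · simp [hr]
      · have := h3 r hr
        dsimp only at this
        simp [this]
    · convert WQbs.rand_const bot using 2 with r
      have : (α r).2 = ⊥ := by
        by_contra h
        obtain ⟨x, -⟩ := Lift.coe_of_ne h
        exact hne ⟨x⟩
      rw [this]; rfl

end Lift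

/-! ## The statistical powerdomain -/

/-! ### Measure-theoretic preliminaries -/

/-- A Borel isomorphism between the line and the plane. -/
noncomputable def plane : ℝ ≃ᵐ ℝ × ℝ :=
  PolishSpace.measurableEquivOfNotCountable (by simp) (by simp)

theorem isMor_of_measurable {h : ℝ × ℝ → ℝ} (hh : Measurable h) :
    IsMor (X := Rl × Rl) (Y := Rl) h := by
  refine isMor_iff.2 ⟨fun c x hc => ?_, fun α hα => ?_⟩
  · have : c = fun _ => x := funext fun n => Prod.ext
      (isSup_discrete (fun _ _ h => h) (isSup_prod.1 hc).1 n)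
      (isSup_discrete (fun _ _ h => h) (isSup_prod.1 hc).2 n)
    rw [this]; exact isSup_const _
  · exact hh.comp (Measurable.prodMk (β := ℝ) (γ := ℝ) hα.1 hα.2)

theorem measurable_of_isMor {f : ℝ × ℝ → Wt} (hf : IsMor (X := Rl × Rl) f) : Measurable f := by
  have h : Measurable fun r => f (plane r) :=
    hf.2 (fun r => plane r) ⟨(measurable_fst.comp plane.measurable :), (measurable_snd.comp
      plane.measurable :)⟩
  simpa [Function.comp_def] using h.comp plane.symm.measurable

/-- Lebesgue integration is a morphism. -/
theorem isMor_lintegral : IsMor (fun w : Rl ⟶ω Wt => ∫⁻ r : ℝ, w r) := by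
  refine isMor_iff.2 ⟨fun c w hc => ?_, fun α hα => ?_⟩
  · have h := Hom.isSup_iff.1 hc
    refine isSup_wt.2 ⟨fun m n hmn => lintegral_mono fun r => (h r).1 hmn, ?_⟩
    rw [← lintegral_iSup (fun n => (c n).isMor.rand) fun m n hmn r => (h r).1 hmn]
    exact lintegral_congr fun r => (isSup_wt.1 (h r)).2
  · exact (measurable_of_isMor (f := fun p => α p.1 p.2) hα).lintegral_prod_right'

/-- Unit squares with integer corners. -/
def unitSq (z : ℤ × ℤ) : Set (ℝ × ℝ) :=
  {p | ⌊p.1⌋ = z.1 ∧ ⌊p.2⌋ = z.2}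

theorem unitSq_eq (z : ℤ × ℤ) :
    unitSq z = Set.Ico (z.1 : ℝ) (z.1 + 1) ×ˢ Set.Ico (z.2 : ℝ) (z.2 + 1) := by
  ext p; simp [unitSq, Int.floor_eq_iff]

theorem measurableSet_unitSq (z : ℤ × ℤ) : MeasurableSet (unitSq z) := by
  rw [unitSq_eq]; exact measurableSet_Ico.prod measurableSet_Ico

theorem exists_map_unitSq (z : ℤ × ℤ) : ∃ f : ℝ → ℝ × ℝ, Measurable f ∧
    Measure.map f (volume.restrict (Set.Ico 0 1)) =
      (volume : Measure (ℝ × ℝ)).restrict (unitSq z) := by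
  have : IsProbabilityMeasure ((volume : Measure (ℝ × ℝ)).restrict (unitSq z)) := by
    constructor
    rw [Measure.restrict_apply_univ, unitSq_eq, Measure.volume_eq_prod, Measure.prod_prod]
    simp
  obtain ⟨f, hf, e⟩ :=
    Measure.exists_measurable_map_eq ((volume : Measure (ℝ × ℝ)).restrict (unitSq z))
  have hp : Measurable (Set.projIcc (0 : ℝ) 1 zero_le_one) := continuous_projIcc.measurable
  refine ⟨fun x => f (Set.projIcc 0 1 zero_le_one x), hf.comp hp, ?_⟩
  rw [show (fun x => f (Set.projIcc 0 1 zero_le_one x)) = f ∘ Set.projIcc 0 1 zero_le_one from rfl,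
    ← Measure.map_map hf hp, restrict_Ico_eq_restrict_Icc, ← map_comap_subtype_coe measurableSet_Icc,
    Measure.map_map hp measurable_subtype_coe,
    show (Set.projIcc (0 : ℝ) 1 zero_le_one ∘ Subtype.val) = id from
      funext fun x => Set.projIcc_val _ x, Measure.map_id]
  exact e

/-- There is a measurable map from the line to the plane that transports Lebesgue measure. -/
theorem exists_transfer : ∃ φ : ℝ → ℝ × ℝ, Measurable φ ∧
    Measure.map φ volume = (volume : Measure (ℝ × ℝ)) := by
  choose f hf he using exists_map_unitSq
  obtain ⟨enc⟩ : Nonempty (ℤ ≃ ℤ × ℤ) := nonempty_equiv_of_countable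
  have hφ : Measurable fun x : ℝ => f (enc ⌊x⌋) (x - ⌊x⌋) :=
    Measurable.comp (g := fun p : ℤ × ℝ => f (enc p.1) (p.2 - p.1))
      (measurable_from_prod_countable_right fun n => (hf (enc n)).comp (by fun_prop))
      (Int.measurable_floor.prodMk measurable_id)
  have hdec : (volume : Measure ℝ) = Measure.sum fun n : ℤ =>
      volume.restrict (Set.Ico (n : ℝ) (n + 1)) := by
    rw [← Measure.restrict_iUnion (Set.pairwise_disjoint_Ico_intCast ℝ) fun n => measurableSet_Ico,
      iUnion_Ico_intCast, Measure.restrict_univ]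
  have h1 : ∀ n : ℤ, Measure.map (fun x : ℝ => f (enc ⌊x⌋) (x - ⌊x⌋))
      (volume.restrict (Set.Ico (n : ℝ) (n + 1))) =
      (volume : Measure (ℝ × ℝ)).restrict (unitSq (enc n)) := fun n => by
    have hp := (measurePreserving_sub_right (volume : Measure ℝ) (n : ℝ)).restrict_preimage
      (measurableSet_Ico (a := (0 : ℝ)) (b := 1))
    have hpre : (fun x : ℝ => x - n) ⁻¹' Set.Ico 0 1 = Set.Ico (n : ℝ) (n + 1) := by
      ext x; simp [add_comm]
    rw [hpre] at hp
    rw [← he (enc n), ← hp.map_eq, Measure.map_map (hf _) hp.measurable]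
    refine Measure.map_congr ((ae_restrict_iff' measurableSet_Ico).2 (.of_forall fun x hx => ?_))
    have : ⌊x⌋ = n := Int.floor_eq_iff.2 hx
    simp [this]
  have h2 : (volume : Measure (ℝ × ℝ)) = Measure.sum fun z => volume.restrict (unitSq z) := by
    rw [← Measure.restrict_iUnion ?_ measurableSet_unitSq]
    · rw [show ⋃ z, unitSq z = Set.univ from Set.eq_univ_of_forall fun p =>
        Set.mem_iUnion.2 ⟨(⌊p.1⌋, ⌊p.2⌋), rfl, rfl⟩, Measure.restrict_univ]
    · intro a b hab
      refine Set.disjoint_left.2 fun p ha hb => hab ?_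
      exact Prod.ext (ha.1.symm.trans hb.1) (ha.2.symm.trans hb.2)
  refine ⟨_, hφ, ?_⟩
  rw [hdec, Measure.map_sum hφ.aemeasurable, h2]
  simp only [h1]
  exact Measure.ext fun s hs => by
    rw [Measure.sum_apply _ hs, Measure.sum_apply _ hs]
    exact enc.tsum_eq fun z => (volume.restrict (unitSq z)) s

/-! ### Expectation operators -/

/-- Randomisations of `X`: partial morphisms from the reals to `X`. -/
abbrev Rd (X : Type) [WQbs X] : Type := Rl ⟶ω Lift X

/-- The continuation monad `J X = [0,∞]^([0,∞]^X)`. -/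
abbrev J (X : Type) [WQbs X] : Type := (X ⟶ω Wt) ⟶ω Wt

section
variable {X Y Z G : Type} [WQbs X] [WQbs Y] [WQbs Z] [WQbs G]

theorem isMor_expect : IsMor fun p : Rd X × (X ⟶ω Wt) =>
    ∫⁻ r : ℝ, Lift.elim 0 p.2 (p.1 r) := by
  have : IsMor fun q : (Rd X × (X ⟶ω Wt)) × Rl => Lift.elim (0 : Wt) q.1.2 (q.1.1 q.2) :=
    IsMor.elim (fun _ => zero_le) ((isMor_snd.comp (isMor_fst.comp isMor_fst)).app isMor_snd)
      ((isMor_fst.comp isMor_fst).app isMor_snd)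
  exact isMor_lintegral.comp (IsMor.curry (f := fun (p : Rd X × (X ⟶ω Wt)) r =>
    Lift.elim (0 : Wt) p.2 (p.1 r)) this)

/-- The expectation operator of a randomisation: integrate over its domain of definition with
respect to Lebesgue measure. -/
noncomputable def expect (α : Rd X) : J X :=
  ⟨fun w => ∫⁻ r : ℝ, Lift.elim 0 w (α r), isMor_expect.at α⟩

theorem isMor_expect' : IsMor (expect (X := X)) := isMor_expect.curry

/-- Closure of a subset of an ωcpo under sups of ω-chains. -/
inductive LubClosure {P : Type} [OmegaCompletePartialOrder P] (S : Set P) : P → Prop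
  | base (x : P) : x ∈ S → LubClosure S x
  | sup (c : Chain P) : (∀ n, LubClosure S (c n)) → LubClosure S (ωSup c)

theorem LubClosure.isSup {P : Type} [OmegaCompletePartialOrder P] {S : Set P} {c : ℕ → P} {x : P}
    (h : IsSup c x) (hc : ∀ n, LubClosure S (c n)) : LubClosure S x := by
  rw [h.unique (isSup_ωSup ⟨⟨c, h.1⟩⟩)]; exact .sup _ hc

/-- The randomisable operators. -/
def SX (X : Type) [WQbs X] : Set (J X) := Set.range expect

/-- The randomisable random operators. -/
def SM (X : Type) [WQbs X] : Set (ℝ → J X) :=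
  {b | ∃ α ∈ rand (X := Rd X), b = fun r => expect (α r)}

theorem SM.at {b : ℝ → J X} (h : LubClosure (SM X) b) (r : ℝ) : LubClosure (SX X) (b r) := by
  induction h with
  | base b hb => obtain ⟨α, -, rfl⟩ := hb; exact .base _ ⟨_, rfl⟩
  | sup c _ ih => exact LubClosure.isSup (isSup_pi.1 (isSup_ωSup c) r) ih

theorem SM.const {μ : J X} (h : LubClosure (SX X) μ) : LubClosure (SM X) fun _ => μ := by
  induction h with
  | base b hb =>
    obtain ⟨α, rfl⟩ := hb; exact .base _ ⟨fun _ => α, WQbs.rand_const α, rfl⟩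
  | sup c _ ih => exact LubClosure.isSup (isSup_pi.2 fun _ => isSup_ωSup c) ih

theorem SM.comp {b : ℝ → J X} (h : LubClosure (SM X) b) {e : ℝ → ℝ} (he : Measurable e) :
    LubClosure (SM X) fun r => b (e r) := by
  induction h with
  | base b hb =>
    obtain ⟨α, hα, rfl⟩ := hb; exact .base _ ⟨_, WQbs.rand_comp α hα e he, rfl⟩
  | sup c _ ih =>
    exact LubClosure.isSup (isSup_pi.2 fun r => isSup_pi.1 (isSup_ωSup c) (e r)) ih

theorem SM.rand {b : ℝ → J X} (h : LubClosure (SM X) b) : b ∈ WQbs.rand (X := J X) := by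
  induction h with
  | base b hb => obtain ⟨α, hα, rfl⟩ := hb; exact isMor_expect'.2 α hα
  | sup c _ ih => exact WQbs.rand_sup c ih

open Classical in
theorem SM.ite {a b : ℝ → J X} (ha : LubClosure (SM X) a) (hb : LubClosure (SM X) b) {s : Set ℝ}
    (hs : MeasurableSet s) : LubClosure (SM X) fun r => if r ∈ s then a r else b r := by
  induction ha with
  | base a ha =>
    obtain ⟨α, hα, rfl⟩ := ha
    induction hb with
    | base b hb =>
      obtain ⟨β, hβ, rfl⟩ := hb
      refine .base _ ⟨_, rand_ite hα hβ hs, funext fun r => ?_⟩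
      split_ifs <;> rfl
    | sup c _ ih =>
      refine LubClosure.isSup (isSup_pi.2 fun r => ?_) ih
      by_cases h : r ∈ s
      · simpa [h] using isSup_const _
      · simpa [h] using isSup_pi.1 (isSup_ωSup c) r
  | sup c _ ih =>
    refine LubClosure.isSup (isSup_pi.2 fun r => ?_) ih
    by_cases h : r ∈ s
    · simpa [h] using isSup_pi.1 (isSup_ωSup c) r
    · simpa [h] using isSup_const _

/-- The zero operator. -/
def zeroJ : J X := ⟨fun _ => 0, isMor_const 0⟩

theorem zeroJ_mem : LubClosure (SX X) zeroJ :=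
  .base _ ⟨⟨fun _ => ⊥, isMor_const _⟩, Hom.ext fun w => by simp [expect, zeroJ]⟩

theorem zeroJ_le (μ : J X) : zeroJ ≤ μ := fun _ => zero_le

theorem SM.split {i : ℝ → ℕ} (hi : Measurable i) {a : ℕ → ℝ → J X}
    (ha : ∀ n, LubClosure (SM X) (a n)) : LubClosure (SM X) fun r => a (i r) r := by
  classical
  have hN : ∀ N, LubClosure (SM X) fun r => if i r < N then a (i r) r else zeroJ := fun N => by
    induction N with
    | zero => simpa using SM.const zeroJ_mem
    | succ N ih =>
      convert SM.ite (ha N) ih (hi (measurableSet_singleton N)) using 2 with r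
      rcases lt_trichotomy (i r) N with h | h | h
      · simp [h, h.ne, h.trans (Nat.lt_succ_self N)]
      · simp [h]
      · simp [h.ne', not_lt.2 h.le, show ¬ i r < N + 1 by omega]
  refine LubClosure.isSup (isSup_pi.2 fun r => isSup_of (fun m n hmn => ?_) (fun n => ?_)
    fun y hy => ?_) hN
  · split_ifs
    · exact le_rfl
    · omega
    · exact zeroJ_le _
    · exact le_rfl
  · split_ifs
    · exact le_rfl
    · exact zeroJ_le _
  · simpa using hy (i r + 1)

end

/-- The powerdomain `T X`: the closure of the randomisable operators in `J X` under sups of chains,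
with the closure of the randomisable random operators as random elements. -/
def T (X : Type) [WQbs X] : Type := {μ : J X // LubClosure (SX X) μ}

section
variable {X Y Z G : Type} [WQbs X] [WQbs Y] [WQbs Z] [WQbs G]

noncomputable instance : OmegaCompletePartialOrder (T X) :=
  OmegaCompletePartialOrder.subtype _ fun c hc => .sup c fun n => hc _ ⟨n, rfl⟩

theorem T.isSup_iff {c : ℕ → T X} {μ : T X} : IsSup c μ ↔ IsSup (fun n => (c n).1) μ.1 := by
  have h1 : ∀ {c : ℕ → T X} {μ : T X}, IsSup (fun n => (c n).1) μ.1 → IsSup c μ := fun h =>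
    isSup_of (fun m n hmn => h.1 hmn) (fun n => h.le n) fun _ hy => h.lub hy
  refine ⟨fun h => ?_, h1⟩
  obtain ⟨ν, hν⟩ := exists_isSup (c := fun n => (c n).1) fun m n hmn => h.1 hmn
  have hν' : LubClosure (SX X) ν := LubClosure.isSup hν fun n => (c n).2
  rw [h.unique (h1 (μ := ⟨ν, hν'⟩) hν)]; exact hν

noncomputable instance : WQbs (T X) where
  rand := {a | LubClosure (SM X) fun r => (a r).1}
  rand_const μ := SM.const μ.2
  rand_comp _ ha _ he := SM.comp ha he
  rand_split _ hi _ ha := SM.split hi ha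
  rand_sup := rand_sup_of fun _ _ hc h =>
    LubClosure.isSup (isSup_pi.2 fun r => T.isSup_iff.1 (h r)) hc

theorem isMor_incl : IsMor (fun μ : T X => μ.1) :=
  isMor_iff.2 ⟨fun _ _ h => T.isSup_iff.1 h, fun _ h => SM.rand h⟩

theorem T.ext {μ ν : T X} (h : ∀ w, μ.1 w = ν.1 w) : μ = ν := Subtype.ext (Hom.ext h)

/-- The zero measure. -/
def T.zero : T X := ⟨zeroJ, zeroJ_mem⟩

theorem T.zero_le (μ : T X) : T.zero ≤ μ := zeroJ_le μ.1

theorem T.isMor_of_expect {f : G → T X} {α : G → Rd X} (hα : IsMor α)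
    (h : ∀ g w, (f g).1 w = ∫⁻ r : ℝ, Lift.elim 0 w (α g r)) : IsMor f := by
  have e : ∀ g, (f g).1 = expect (α g) := fun g => Hom.ext (h g)
  refine isMor_iff.2 ⟨fun c x hc => T.isSup_iff.2 ?_, fun β hβ => ?_⟩
  · simp only [e]; exact (isMor_expect'.comp hα).isSup hc
  · exact .base _ ⟨_, hα.2 β hβ, funext fun r => e _⟩

/-- The bind of the continuation monad. -/
def bindJ (μ : J X) (f : X ⟶ω T Y) : J Y :=
  ⟨fun w => μ ⟨fun x => (f x).1 w, (isMor_incl.comp f.isMor).app (isMor_const w)⟩,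
    μ.isMor.comp (IsMor.lam ((isMor_incl.comp (f.isMor.comp isMor_snd)).app isMor_fst))⟩

theorem isMor_bindJ {μ : G → J X} {f : G → (X ⟶ω T Y)} (hμ : IsMor μ) (hf : IsMor f) :
    IsMor fun g => bindJ (μ g) (f g) := by
  refine IsMor.lam ((hμ.comp isMor_fst).app (IsMor.lam ?_))
  exact (isMor_incl.comp ((hf.comp (isMor_fst.comp isMor_fst)).app isMor_snd)).app
    (isMor_snd.comp isMor_fst)

theorem SM.integ {k : ℝ → J Y} (hk : LubClosure (SM Y) k) {e : ℝ × ℝ → ℝ} (he : Measurable e) :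
    ∃ j : ℝ → J Y, LubClosure (SM Y) j ∧ ∀ r w, j r w = ∫⁻ s : ℝ, k (e (r, s)) w := by
  induction hk with
  | base k hk =>
    obtain ⟨β, hβ, rfl⟩ := hk
    obtain ⟨φ, hφ, hφv⟩ := exists_transfer
    have hβ' : IsMor fun p : Rl × Rl => β p.1 p.2 := hβ
    have hγ : IsMor fun p : Rl × Rl => β (e (p.1, (φ p.2).1)) (φ p.2).2 :=
      hβ'.comp (X := Rl × Rl) (Y := Rl × Rl) (f := fun p => (e (p.1, (φ p.2).1), (φ p.2).2))
        ((isMor_of_measurable (h := fun p => e (p.1, (φ p.2).1)) (by fun_prop)).pair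
          (isMor_of_measurable (h := fun p => (φ p.2).2) (by fun_prop)))
    refine ⟨fun r => expect ⟨fun v : Rl => β (e (r, (φ v).1)) (φ v).2, hγ.at (X := Rl) (Y := Rl) r⟩,
      .base _ ⟨_, hγ, rfl⟩, fun r w => ?_⟩
    have hm : Measurable fun q : ℝ × ℝ => Lift.elim 0 w (β (e (r, q.1)) q.2) :=
      measurable_of_isMor (IsMor.elim (fun _ => _root_.zero_le) (w.isMor.comp isMor_snd)
        (hβ'.comp (X := Rl × Rl) (Y := Rl × Rl) (f := fun q => (e (r, q.1), q.2))
          ((isMor_of_measurable (h := fun q => e (r, q.1)) (by fun_prop)).pair isMor_snd)))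
    change ∫⁻ v : ℝ, Lift.elim 0 w (β (e (r, (φ v).1)) (φ v).2) = ∫⁻ s : ℝ, ∫⁻ t : ℝ,
      Lift.elim 0 w (β (e (r, s)) t)
    rw [← lintegral_map (f := fun q : ℝ × ℝ => Lift.elim 0 w (β (e (r, q.1)) q.2)) hm hφ, hφv,
      Measure.volume_eq_prod, lintegral_prod _ hm.aemeasurable]
  | sup c hc ih =>
    choose j hj hjw using ih
    have hsup := fun r => isSup_pi.1 (isSup_ωSup c) r
    have hmono : ∀ r, Monotone fun n => j n r := fun r m n hmn w => by
      rw [hjw, hjw]; exact lintegral_mono fun s => (hsup (e (r, s))).1 hmn w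
    choose J hJ using fun r => exists_isSup (hmono r)
    refine ⟨J, LubClosure.isSup (isSup_pi.2 hJ) hj, fun r w => ?_⟩
    rw [(isSup_wt.1 (Hom.isSup_iff.1 (hJ r) w)).2]
    simp only [hjw]
    rw [← lintegral_iSup]
    · exact lintegral_congr fun s => (isSup_wt.1 (Hom.isSup_iff.1 (hsup (e (r, s))) w)).2.symm
    · intro n
      have h1 : IsMor (X := Rl) fun s => c n s := isMor_of_rand (SM.rand (hc n))
      exact ((h1.comp (IsMor.at (X := Rl) (Y := Rl) (Z := Rl) (isMor_of_measurable he) r)).app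
        (isMor_const w)).rand
    · intro m n hmn s; exact (hsup (e (r, s))).1 hmn w

theorem SM.bind {b : ℝ → J X} (hb : LubClosure (SM X) b) {g : ℝ → (X ⟶ω T Y)}
    (hg : g ∈ WQbs.rand (X := X ⟶ω T Y)) : LubClosure (SM Y) fun r => bindJ (b r) (g r) := by
  induction hb with
  | base b hb =>
    obtain ⟨α, hα, rfl⟩ := hb
    have hp1 : IsMor (X := Rl) (Y := Rl) fun u => (plane u).1 :=
      isMor_of_rand (X := Rl) (measurable_fst.comp plane.measurable :)
    have hp2 : IsMor (X := Rl) (Y := Rl) fun u => (plane u).2 :=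
      isMor_of_rand (X := Rl) (measurable_snd.comp plane.measurable :)
    have hα' : IsMor fun p : Rl × Rl => α p.1 p.2 := hα
    have hg' : IsMor fun p : Rl × X => g p.1 p.2 := hg
    have hK : IsMor (X := Rl) fun u => Lift.elim T.zero (fun x => g (plane u).1 x)
        (α (plane u).1 (plane u).2) :=
      IsMor.elim T.zero_le (IsMor.comp (Y := Rl × X) hg' ((hp1.comp isMor_fst).pair isMor_snd))
        (IsMor.comp (Y := Rl × Rl) hα' (IsMor.pair (X := Rl) (Y := Rl) (Z := Rl) hp1 hp2))
    have hK' : LubClosure (SM Y) _ := IsMor.rand hK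
    obtain ⟨j, hj, hjw⟩ := SM.integ hK' plane.symm.measurable
    convert hj using 2 with r
    refine Hom.ext fun w => ?_
    rw [hjw]
    refine lintegral_congr fun s => ?_
    simp only [MeasurableEquiv.apply_symm_apply]
    induction α r s using WithBot.recBotCoe <;> rfl
  | sup c _ ih =>
    exact LubClosure.isSup (isSup_pi.2 fun r => (isMor_bindJ isMor_id (isMor_const (g r))).isSup
      (isSup_pi.1 (isSup_ωSup c) r)) ih

/-- Monadic bind. -/
def T.bind (μ : T X) (f : X ⟶ω T Y) : T Y :=
  ⟨bindJ μ.1 f, SM.at (SM.bind (SM.const μ.2) (WQbs.rand_const f)) 0⟩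

theorem IsMor.bind {μ : G → T X} {f : G → (X ⟶ω T Y)} (hμ : IsMor μ) (hf : IsMor f) :
    IsMor fun g => (μ g).bind (f g) := by
  refine isMor_iff.2 ⟨fun c x hc => T.isSup_iff.2 ?_, fun α hα => ?_⟩
  · exact (isMor_bindJ (isMor_incl.comp hμ) hf).isSup hc
  · exact SM.bind (hμ.2 α hα) (hf.2 α hα)

open Classical in
/-- The randomisation `[B.α, Bᶜ.⊥]`. -/
theorem isMor_restrict {s : G → Set ℝ} {f : G → Rl → X} (hf : IsMor fun p : G × Rl => f p.1 p.2)
    (hdisc : ∀ c x, IsSup c x → ∀ n, s (c n) = s x)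
    (hs : ∀ α ∈ rand (X := G), MeasurableSet {p : ℝ × ℝ | p.2 ∈ s (α p.1)}) :
    IsMor fun p : G × Rl => if p.2 ∈ s p.1 then (f p.1 p.2 : Lift X) else ⊥ := by
  refine isMor_iff.2 ⟨fun c x hc => ?_, fun α hα => ?_⟩
  · obtain ⟨h1, h2⟩ := isSup_prod.1 hc
    have e1 := hdisc _ _ h1
    have e2 : ∀ n, (c n).2 = x.2 := isSup_discrete (fun _ _ h => h) h2
    simp only [e1, e2]
    split_ifs
    · have := (isMor_coe.comp hf).isSup hc
      simpa only [e2] using this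
    · exact isSup_const _
  · have hm : MeasurableSet {r : ℝ | (α r).2 ∈ s (α r).1} :=
      (measurable_id.prodMk (hα.2 : Measurable (β := ℝ) fun r => (α r).2)) (hs _ hα.1)
    exact rand_ite ((isMor_coe.comp hf).2 α hα) (WQbs.rand_const ⊥) hm

end

/-! ### Unit, sampling, conditioning, and partiality -/

section
variable {X Y Z G : Type} [WQbs X] [WQbs Y] [WQbs Z] [WQbs G]

open Classical in
/-- The partial function `f` restricted to the set `s`. -/
noncomputable def cut {X : Type} (s : Set ℝ) (f : Rl → X) (r : Rl) : Lift X :=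
  if r ∈ s then (f r : Lift X) else ⊥

theorem isMor_cut {s : G → Set ℝ} {f : G → Rl → X} (hf : IsMor fun p : G × Rl => f p.1 p.2)
    (hdisc : ∀ c x, IsSup c x → ∀ n, s (c n) = s x)
    (hs : ∀ α ∈ rand (X := G), MeasurableSet {p : ℝ × ℝ | p.2 ∈ s (α p.1)}) :
    IsMor fun p : G × Rl => cut (s p.1) (f p.1) p.2 := isMor_restrict hf hdisc hs

theorem lintegral_cut {X : Type} (w : X → Wt) (f : Rl → X) {s : Set ℝ} (hs : MeasurableSet s) :
    ∫⁻ r : ℝ, Lift.elim 0 w (cut s f r) = ∫⁻ r in s, w (f r) := by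
  rw [← lintegral_indicator hs]
  refine lintegral_congr fun r => ?_
  by_cases h : r ∈ s
  · rw [Set.indicator_of_mem h, show cut s f r = f r from if_pos h]; rfl
  · rw [Set.indicator_of_notMem h, show cut s f r = ⊥ from if_neg h]; rfl

theorem LubClosure.of_expect {μ : J X} {α : Rd X}
    (h : ∀ w, μ w = ∫⁻ r : ℝ, Lift.elim 0 w (α r)) : LubClosure (SX X) μ :=
  .base _ ⟨α, Hom.ext fun w => (h w).symm⟩

theorem isMor_pureRd : IsMor fun p : X × Rl => cut (Set.Icc 0 1) (fun _ => p.1) p.2 :=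
  isMor_cut (s := fun _ => Set.Icc (0 : ℝ) 1) (f := fun x _ => x) isMor_fst (fun _ _ _ _ => rfl)
    fun _ _ => measurable_snd measurableSet_Icc

theorem pure_eq {X : Type} (x : X) (w : X → Wt) :
    w x = ∫⁻ r : ℝ, Lift.elim 0 w (cut (Set.Icc 0 1) (fun _ => x) r) := by
  rw [lintegral_cut w (fun _ => x) measurableSet_Icc]; simp

/-- The unit of the monad: Dirac operators. -/
def T.pure (x : X) : T X :=
  ⟨⟨fun w => w x, isMor_id.app (isMor_const x)⟩,
    LubClosure.of_expect (α := ⟨_, isMor_pureRd.at x⟩) fun w => pure_eq x w⟩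

theorem T.isMor_pure : IsMor (T.pure (X := X)) :=
  T.isMor_of_expect (IsMor.curry (f := fun x (r : Rl) => cut (Set.Icc 0 1) (fun _ => x) r)
    isMor_pureRd) fun x w => pure_eq x w

theorem isMor_sampleRd : IsMor fun r : Rl => cut (Set.Icc 0 1) (fun r : Rl => r) r :=
  (isMor_cut (G := Unit) (s := fun _ => Set.Icc (0 : ℝ) 1) (f := fun _ r => r)
    isMor_snd (fun _ _ _ _ => rfl) fun _ _ => measurable_snd measurableSet_Icc).at ()

theorem sample_eq (w : Rl → Wt) : ∫⁻ r in Set.Icc (0 : ℝ) 1, w r =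
    ∫⁻ r : ℝ, Lift.elim 0 w (cut (Set.Icc 0 1) (fun r : Rl => r) r) :=
  (lintegral_cut w (fun r => r) measurableSet_Icc).symm

theorem isMor_sample_aux : IsMor fun w : Rl ⟶ω Wt => ∫⁻ r in Set.Icc (0 : ℝ) 1, w r := by
  simp only [sample_eq]
  exact (isMor_expect (X := Rl)).at ⟨_, isMor_sampleRd⟩

/-- Uniform sampling from `[0, 1]`. -/
noncomputable def T.sample : T Rl :=
  ⟨⟨fun w => ∫⁻ r in Set.Icc (0 : ℝ) 1, w r, isMor_sample_aux⟩,
    LubClosure.of_expect (α := ⟨_, isMor_sampleRd⟩) fun w => sample_eq w⟩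

theorem isMor_scoreRd : IsMor fun p : Rl × Rl =>
    cut (Set.Icc (0 : ℝ) |(p.1 : ℝ)|) (fun _ => ()) p.2 :=
  isMor_cut (s := fun r : Rl => Set.Icc (0 : ℝ) |(r : ℝ)|) (f := fun _ _ => ())
    (isMor_const ()) (fun c x hc n => by rw [isSup_discrete (fun _ _ h => h) hc n]) fun α hα => by
      have hα : Measurable (β := ℝ) α := hα
      exact (measurableSet_le measurable_const measurable_snd).inter
        (measurableSet_le measurable_snd (hα.comp measurable_fst).abs)

theorem score_eq (r : ℝ) (w : Unit → Wt) : ENNReal.ofReal |r| * w () =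
    ∫⁻ s : ℝ, Lift.elim 0 w (cut (Set.Icc (0 : ℝ) |r|) (fun _ => ()) s) := by
  rw [lintegral_cut w (fun _ => ()) measurableSet_Icc]; simp [mul_comm]

theorem isMor_score_aux (r : ℝ) : IsMor fun w : Unit ⟶ω Wt => ENNReal.ofReal |r| * w () := by
  simp only [score_eq]
  exact (isMor_expect (X := Unit)).at ⟨_, isMor_scoreRd.at (X := Rl) (Y := Rl) r⟩

/-- Conditioning: reweighting by `|r|`. -/
noncomputable def T.score (r : Rl) : T Unit :=
  ⟨⟨fun w => ENNReal.ofReal |(r : ℝ)| * w (), isMor_score_aux r⟩,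
    LubClosure.of_expect (α := ⟨_, isMor_scoreRd.at r⟩) fun w => score_eq r w⟩

theorem T.isMor_score : IsMor T.score :=
  T.isMor_of_expect (IsMor.curry (f := fun (r : Rl) (s : Rl) =>
    cut (Set.Icc (0 : ℝ) |(r : ℝ)|) (fun _ => ()) s) isMor_scoreRd) fun r w => score_eq r w

/-- The monad morphism from lifting to `T`: `⊥` denotes the zero measure. -/
def T.ofLift (u : Lift X) : T X := Lift.elim T.zero T.pure u

theorem T.isMor_ofLift : IsMor (T.ofLift (X := X)) :=
  IsMor.elim T.zero_le (T.isMor_pure.comp isMor_snd) isMor_id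

end

/-! ## Partial maps -/

/-- Bundled ω-quasi-Borel spaces. -/
structure Sp where
  carrier : Type
  [wqbs : WQbs carrier]

attribute [instance] Sp.wqbs

instance : CoeSort Sp Type := ⟨Sp.carrier⟩

/-- Partial maps, represented as total maps into the lifting. -/
abbrev PHom (A B : Sp) : Type := A ⟶ω Lift B

/-- The identity partial map. -/
def PHom.id (A : Sp) : PHom A A := ⟨fun x => x, isMor_coe⟩

/-- Composition of partial maps, in diagrammatic order. -/
def PHom.comp {A B C : Sp} (f : PHom A B) (g : PHom B C) : PHom A C :=
  ⟨fun x => Lift.elim ⊥ g (f x),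
    IsMor.elim (fun _ => bot_le) (g.isMor.comp isMor_snd) f.isMor⟩

infixr:80 " ≫ₚ " => PHom.comp

namespace PHom
variable {A B C D : Sp}

theorem assoc (f : PHom A B) (g : PHom B C) (h : PHom C D) :
    (f ≫ₚ g) ≫ₚ h = f ≫ₚ g ≫ₚ h := by
  ext x
  change Lift.elim ⊥ h (Lift.elim ⊥ g (f x)) = Lift.elim ⊥ (g ≫ₚ h) (f x)
  induction f x using WithBot.recBotCoe <;> rfl

@[simp] theorem id_comp (f : PHom A B) : PHom.id A ≫ₚ f = f := rfl

@[simp] theorem comp_id (f : PHom A B) : f ≫ₚ PHom.id B = f := by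
  ext x
  change Lift.elim ⊥ (PHom.id B) (f x) = f x
  induction f x using WithBot.recBotCoe <;> rfl

theorem isMor_comp : IsMor fun p : PHom A B × PHom B C => p.1 ≫ₚ p.2 :=
  IsMor.lam (IsMor.elim (fun _ => bot_le) ((isMor_snd.comp (isMor_fst.comp isMor_fst)).app isMor_snd)
    ((isMor_fst.comp isMor_fst).app isMor_snd))

theorem isSup_comp {f : ℕ → PHom A B} {f' : PHom A B} {g : ℕ → PHom B C} {g' : PHom B C}
    (hf : IsSup f f') (hg : IsSup g g') : IsSup (fun n => f n ≫ₚ g n) (f' ≫ₚ g') :=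
  isMor_comp.isSup (c := fun n => (f n, g n)) (x := (f', g')) (isSup_prod.2 ⟨hf, hg⟩)

theorem comp_mono {f f' : PHom A B} {g g' : PHom B C} (hf : f ≤ f') (hg : g ≤ g') :
    f ≫ₚ g ≤ f' ≫ₚ g' :=
  isMor_comp.mono (a := (f, g)) (b := (f', g')) ⟨hf, hg⟩

end PHom

/-- A pair of partial maps in opposite directions: a morphism from `(A, A)` to `(B, B)` in the
product of the opposite of the category of partial maps with that category. -/
@[ext] structure Sym (A B : Sp) where
  bwd : PHom B A
  fwd : PHom A B

namespace Sym
variable {A B C : Sp}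

/-- The identity pair. -/
def id (A : Sp) : Sym A A := ⟨PHom.id A, PHom.id A⟩

/-- Composition of pairs. -/
def comp (f : Sym A B) (g : Sym B C) : Sym A C := ⟨g.bwd ≫ₚ f.bwd, f.fwd ≫ₚ g.fwd⟩

/-- Exchanging the two directions. -/
def flip (f : Sym A B) : Sym B A := ⟨f.fwd, f.bwd⟩

/-- Embedding-projection pairs. -/
def IsEP (f : Sym A B) : Prop := f.fwd ≫ₚ f.bwd = PHom.id A ∧ f.bwd ≫ₚ f.fwd ≤ PHom.id B

/-- Suprema of chains of pairs. -/
def IsLub (f : ℕ → Sym A B) (g : Sym A B) : Prop :=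
  IsSup (fun n => (f n).bwd) g.bwd ∧ IsSup (fun n => (f n).fwd) g.fwd

theorem IsLub.flip {f : ℕ → Sym A B} {g : Sym A B} (h : IsLub f g) :
    IsLub (fun n => (f n).flip) g.flip := ⟨h.2, h.1⟩

theorem isLub_const (f : Sym A B) : IsLub (fun _ => f) f := ⟨isSup_const _, isSup_const _⟩

end Sym

/-- A locally continuous mixed-variance functor of `n` variables on the category of partial maps.
Its objects are only recorded on the diagonal, where each contravariant argument equals the
corresponding covariant one; the action on morphisms takes a partial map in each direction. -/
structure MFun (n : ℕ) where
  obj : (Fin n → Sp) → Sp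
  map : {A B : Fin n → Sp} → (∀ i, Sym (A i) (B i)) → PHom (obj A) (obj B)
  map_id : ∀ A : Fin n → Sp, map (fun i => Sym.id (A i)) = PHom.id (obj A)
  map_comp : ∀ {A B C : Fin n → Sp} (f : ∀ i, Sym (A i) (B i)) (g : ∀ i, Sym (B i) (C i)),
    map (fun i => (f i).comp (g i)) = map f ≫ₚ map g
  cont : ∀ {A B : Fin n → Sp} (f : ℕ → ∀ i, Sym (A i) (B i)) (g : ∀ i, Sym (A i) (B i)),
    (∀ i, Sym.IsLub (fun k => f k i) (g i)) → IsSup (fun k => map (f k)) (map g)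

/-- The action of a functor on pairs of maps. -/
def MFun.smap {n : ℕ} (F : MFun n) {A B : Fin n → Sp} (f : ∀ i, Sym (A i) (B i)) :
    Sym (F.obj A) (F.obj B) := ⟨F.map fun i => (f i).flip, F.map f⟩

/-! ### The basic type constructors as functors -/

/-- Projection functors. -/
def MFun.var {n : ℕ} (i : Fin n) : MFun n where
  obj A := A i
  map f := (f i).fwd
  map_id _ := rfl
  map_comp _ _ := rfl
  cont _ _ h := (h i).2

/-- Constant functors. -/
def MFun.const {n : ℕ} (X : Sp) : MFun n where
  obj _ := X
  map _ := PHom.id X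
  map_id _ := rfl
  map_comp _ _ := (PHom.id_comp _).symm
  cont _ _ _ := isSup_const _

/-- The product of two partial maps is defined where both are. -/
noncomputable def PHom.prod {A B C D : Sp} (u : PHom A B) (v : PHom C D) : PHom ⟨A × C⟩ ⟨B × D⟩ :=
  ⟨fun p => Lift.elim ⊥ (fun b => Lift.elim ⊥ (fun d => ((b, d) : Lift (B × D))) (v p.2)) (u p.1),
    IsMor.elim (fun _ => bot_le)
      (IsMor.elim (fun _ => bot_le) (isMor_coe.comp ((isMor_snd.comp isMor_fst).pair isMor_snd))
        (v.isMor.comp (isMor_snd.comp isMor_fst)))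
      (u.isMor.comp isMor_fst)⟩

theorem PHom.isMor_prod {A B C D : Sp} :
    IsMor fun p : PHom A B × PHom C D => PHom.prod p.1 p.2 := by
  refine IsMor.lam (IsMor.elim (fun _ => bot_le) (IsMor.elim (fun _ => bot_le)
    (isMor_coe.comp ((isMor_snd.comp isMor_fst).pair isMor_snd)) ?_) ?_)
  · exact (isMor_snd.comp (isMor_fst.comp isMor_fst)).app (isMor_snd.comp (isMor_snd.comp isMor_fst))
  · exact (isMor_fst.comp isMor_fst).app (isMor_fst.comp isMor_snd)

/-- Products of functors. -/
noncomputable def MFun.prod {n : ℕ} (F G : MFun n) : MFun n where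
  obj A := ⟨F.obj A × G.obj A⟩
  map f := (F.map f).prod (G.map f)
  map_id A := by rw [F.map_id, G.map_id]; rfl
  map_comp f g := by
    rw [F.map_comp, G.map_comp]
    ext p
    change Lift.elim ⊥ _ (Lift.elim ⊥ _ (F.map f p.1)) =
      Lift.elim ⊥ _ (Lift.elim ⊥ _ (F.map f p.1))
    induction F.map f p.1 using WithBot.recBotCoe with
    | bot => rfl
    | coe x =>
      change Lift.elim ⊥ (fun b => Lift.elim ⊥ _ (Lift.elim ⊥ _ (G.map f p.2))) (F.map g x) =
        Lift.elim ⊥ _ (Lift.elim ⊥ _ (G.map f p.2))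
      induction G.map f p.2 using WithBot.recBotCoe with
      | bot => induction F.map g x using WithBot.recBotCoe <;> rfl
      | coe y => rfl
  cont f g h := PHom.isMor_prod.isSup (c := fun k => (F.map (f k), G.map (f k)))
    (x := (F.map g, G.map g)) (isSup_prod.2 ⟨F.cont f g h, G.cont f g h⟩)

theorem isMor_lift_inj {ι : Type} {P : ι → Type} [∀ i, WQbs (P i)] (i : ι) :
    IsMor fun u : Lift (P i) => Lift.elim ⊥ (fun b => ((⟨i, b⟩ : Σ i, P i) : Lift (Σ i, P i))) u :=
  IsMor.elim (g := fun _ b => ((⟨i, b⟩ : Σ i, P i) : Lift (Σ i, P i))) (fun _ => bot_le)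
    (isMor_coe.comp ((isMor_inj i).comp isMor_snd)) isMor_id

/-- The coproduct of partial maps. -/
noncomputable def PHom.sum {ι : Type} [Countable ι] {A B : ι → Sp} (u : ∀ i, PHom (A i) (B i)) :
    PHom ⟨Σ i, A i⟩ ⟨Σ i, B i⟩ :=
  ⟨fun p => Lift.elim ⊥ (fun b => ((⟨p.1, b⟩ : Σ i, B i) : Lift (Σ i, B i))) (u p.1 p.2),
    (IsMor.cotuple (G := Unit) (g := fun i _ x =>
      Lift.elim ⊥ (fun b => ((⟨i, b⟩ : Σ i, B i) : Lift (Σ i, B i))) (u i x))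
      fun i => IsMor.elim (fun _ => bot_le) (isMor_coe.comp ((isMor_inj i).comp isMor_snd))
        ((u i).isMor.comp isMor_snd)).comp ((isMor_const ()).pair isMor_id)⟩

/-- Coproducts of functors. -/
noncomputable def MFun.sum {ι : Type} [Countable ι] {n : ℕ} (F : ι → MFun n) : MFun n where
  obj A := ⟨Σ i, (F i).obj A⟩
  map f := PHom.sum fun i => (F i).map f
  map_id A := by simp only [MFun.map_id]; rfl
  map_comp f g := by
    simp only [MFun.map_comp]
    ext ⟨i, x⟩
    change Lift.elim ⊥ _ (Lift.elim ⊥ _ ((F i).map f x)) =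
      Lift.elim ⊥ _ (Lift.elim ⊥ _ ((F i).map f x))
    induction (F i).map f x using WithBot.recBotCoe <;> rfl
  cont f g h := Hom.isSup_of fun ⟨i, x⟩ =>
    (isMor_lift_inj (P := fun i => (F i).obj _) i).isSup
      (Hom.isSup_iff.1 ((F i).cont f g h) x)

/-- The action of the effectful function space `A ⇒ T C` on partial maps. -/
noncomputable def PHom.arrow {A B C D : Sp} (u : PHom B A) (v : PHom C D) : PHom ⟨A ⟶ω T C⟩ ⟨B ⟶ω T D⟩ :=
  ⟨fun h => ((⟨fun b => ((T.ofLift (u b)).bind h).bind ⟨fun c => T.ofLift (v c),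
      T.isMor_ofLift.comp v.isMor⟩,
      ((T.isMor_ofLift.comp u.isMor).bind (isMor_const h)).bind (isMor_const _)⟩ : B ⟶ω T D) :
      Lift (B ⟶ω T D)),
    isMor_coe.comp (IsMor.lam (((T.isMor_ofLift.comp (u.isMor.comp isMor_snd)).bind isMor_fst).bind
      (isMor_const _)))⟩

theorem PHom.isMor_arrow {A B C D : Sp} :
    IsMor fun p : PHom B A × PHom C D => PHom.arrow p.1 p.2 := by
  refine IsMor.lam (isMor_coe.comp (IsMor.lam (IsMor.bind (IsMor.bind (T.isMor_ofLift.comp ?_) ?_)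
    (IsMor.lam (T.isMor_ofLift.comp ?_)))))
  · exact (isMor_fst.comp (isMor_fst.comp isMor_fst)).app isMor_snd
  · exact isMor_snd.comp isMor_fst
  · exact (isMor_snd.comp (isMor_fst.comp (isMor_fst.comp isMor_fst))).app isMor_snd

/-- Effectful function spaces of functors. -/
noncomputable def MFun.arrow {n : ℕ} (F G : MFun n) : MFun n where
  obj A := ⟨F.obj A ⟶ω T (G.obj A)⟩
  map f := PHom.arrow (F.map fun i => (f i).flip) (G.map f)
  map_id A := by
    have : (F.map fun i => (Sym.id (A i)).flip) = PHom.id _ := F.map_id A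
    rw [this, G.map_id]; rfl
  map_comp f g := by
    have : (F.map fun i => ((f i).comp (g i)).flip) = _ :=
      F.map_comp (fun i => (g i).flip) fun i => (f i).flip
    rw [this, G.map_comp]
    refine Hom.ext fun h => congrArg WithBot.some (Hom.ext fun x => T.ext fun w => ?_)
    change (T.ofLift (Lift.elim ⊥ (F.map fun i => (f i).flip)
      ((F.map fun i => (g i).flip) x))).1 _ = (T.ofLift ((F.map fun i => (g i).flip) x)).1 _
    induction (F.map fun i => (g i).flip) x using WithBot.recBotCoe with
    | bot => rfl
    | coe y =>
      change (T.ofLift ((F.map fun i => (f i).flip) y)).1 _ =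
        (T.ofLift ((F.map fun i => (f i).flip) y)).1 _
      congr 1
      refine Hom.ext fun a => ?_
      change (h a).1 _ = (h a).1 _
      congr 1
      refine Hom.ext fun c => ?_
      change (T.ofLift (Lift.elim ⊥ (G.map g) (G.map f c))).1 w = (T.ofLift (G.map f c)).1 _
      induction G.map f c using WithBot.recBotCoe <;> rfl
  cont f g h := PHom.isMor_arrow.isSup (c := fun k => (F.map fun i => (f k i).flip, G.map (f k)))
    (x := (F.map fun i => (g i).flip, G.map g))
    (isSup_prod.2 ⟨F.cont _ _ fun i => (h i).flip, G.cont f g h⟩)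

/-! ## Recursive types -/

/-! ### Bilimits of chains of embedding-projection pairs -/

/-- The carrier of the bilimit: families of partially defined elements that are compatible with the
projections and defined from some index on. -/
def Bilim (X : ℕ → Sp) (a : ∀ k, Sym (X k) (X (k + 1))) : Type :=
  {x : ∀ k, Lift (X k) // (∀ k, Lift.elim ⊥ (a k).bwd (x (k + 1)) = x k) ∧ ∃ k, x k ≠ ⊥}

section Bilim
variable {X : ℕ → Sp} {a : ∀ k, Sym (X k) (X (k + 1))}

instance : PartialOrder (Bilim X a) := Subtype.partialOrder _

theorem PHom.isMor_elim {A B : Sp} (f : PHom A B) : IsMor fun u : Lift A => Lift.elim ⊥ f u :=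
  IsMor.elim (g := fun _ b => f b) (fun _ => bot_le) (f.isMor.comp isMor_snd) isMor_id

theorem Bilim.isSup_of {c : ℕ → Bilim X a} {x : Bilim X a}
    (h : ∀ k, IsSup (fun n => (c n).1 k) (x.1 k)) : IsSup c x :=
  SFPC.isSup_of (fun _ _ hmn k => (h k).1 hmn) (fun n k => (h k).le n) fun _ hy k =>
    (h k).lub fun n => hy n k

theorem Bilim.exists_isSup (c : ℕ → Bilim X a) (hc : Monotone c) :
    ∃ x : Bilim X a, ∀ k, IsSup (fun n => (c n).1 k) (x.1 k) := by
  choose x hx using fun k => SFPC.exists_isSup (c := fun n => (c n).1 k) fun m n hmn => hc hmn k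
  refine ⟨⟨x, fun k => ?_, ?_⟩, hx⟩
  · refine ((a k).bwd.isMor_elim.isSup (hx (k + 1))).unique ?_
    simpa only [(c _).2.1 k] using hx k
  · obtain ⟨k, hk⟩ := (c 0).2.2
    exact ⟨k, fun h => hk (le_bot_iff.1 (h ▸ (hx k).le 0))⟩

noncomputable instance : OmegaCompletePartialOrder (Bilim X a) :=
  ocpoOf _ fun c hc => (Bilim.exists_isSup c hc).imp fun _ => Bilim.isSup_of

theorem Bilim.isSup_iff {c : ℕ → Bilim X a} {x : Bilim X a} :
    IsSup c x ↔ ∀ k, IsSup (fun n => (c n).1 k) (x.1 k) := by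
  refine ⟨fun h => ?_, Bilim.isSup_of⟩
  obtain ⟨y, hy⟩ := Bilim.exists_isSup c h.1
  rw [h.unique (Bilim.isSup_of hy)]; exact hy

/-- Random elements of the bilimit are given componentwise. -/
noncomputable instance : WQbs (Bilim X a) where
  rand := {α | ∀ k, (fun r => (α r).1 k) ∈ rand (X := Lift (X k))}
  rand_const _ _ := WQbs.rand_const _
  rand_comp _ hα h hh k := WQbs.rand_comp _ (hα k) h hh
  rand_split _ hi _ hα k := WQbs.rand_split _ hi _ fun n => hα n k
  rand_sup := rand_sup_of fun _ _ hc h k =>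
    rand_isSup (fun n => hc n k) fun r => Bilim.isSup_iff.1 (h r) k

/-- The bilimit as a space. -/
noncomputable abbrev bilim (X : ℕ → Sp) (a : ∀ k, Sym (X k) (X (k + 1))) : Sp := ⟨Bilim X a⟩

variable (a)

/-- Composites of embeddings. -/
def up {k m : ℕ} (h : k ≤ m) : PHom (X k) (X m) :=
  Nat.leRec (motive := fun m _ => PHom (X k) (X m)) (PHom.id _) (fun m _ f => f ≫ₚ (a m).fwd) h

/-- Composites of projections. -/
def down {k m : ℕ} (h : k ≤ m) : PHom (X m) (X k) :=
  Nat.leRec (motive := fun m _ => PHom (X m) (X k)) (PHom.id _) (fun m _ f => (a m).bwd ≫ₚ f) h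

theorem up_self (k : ℕ) : up a (le_refl k) = PHom.id _ := Nat.leRec_self _ _
theorem down_self (k : ℕ) : down a (le_refl k) = PHom.id _ := Nat.leRec_self _ _

theorem up_succ {k m : ℕ} (h : k ≤ m) (h' : k ≤ m + 1) : up a h' = up a h ≫ₚ (a m).fwd :=
  Nat.leRec_succ _ _ h
theorem down_succ {k m : ℕ} (h : k ≤ m) (h' : k ≤ m + 1) : down a h' = (a m).bwd ≫ₚ down a h :=
  Nat.leRec_succ _ _ h

theorem up_left {k m : ℕ} (h : k + 1 ≤ m) (h' : k ≤ m) : (a k).fwd ≫ₚ up a h = up a h' := by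
  induction m, h using Nat.le_induction with
  | base => rw [up_self, PHom.comp_id, up_succ a le_rfl, up_self]; rfl
  | succ m hm ih => rw [up_succ a hm, up_succ a (by omega : k ≤ m), ← ih (by omega), PHom.assoc]

theorem down_right {k m : ℕ} (h : k + 1 ≤ m) (h' : k ≤ m) :
    down a h ≫ₚ (a k).bwd = down a h' := by
  induction m, h using Nat.le_induction with
  | base => rw [down_self, down_succ a le_rfl, down_self, PHom.comp_id]; rfl
  | succ m hm ih => rw [down_succ a hm, down_succ a (by omega : k ≤ m), ← ih (by omega), PHom.assoc]

/-- The canonical partial map between any two stages. -/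
def stage (k m : ℕ) : PHom (X k) (X m) :=
  if h : k ≤ m then up a h else down a (Nat.le_of_not_le h)

theorem stage_self (k : ℕ) : stage a k k = PHom.id _ := by
  rw [stage, dif_pos le_rfl, up_self]

theorem stage_down {k m : ℕ} (h : m ≤ k) : stage a k m = down a h := by
  rcases h.eq_or_lt with rfl | h'
  · rw [stage_self, down_self]
  · rw [stage, dif_neg (by omega)]

theorem stage_up {k m : ℕ} (h : k ≤ m) : stage a k m = up a h := dif_pos h

variable {a}

theorem stage_bwd (ha : ∀ k, (a k).IsEP) (k m : ℕ) :
    stage a k (m + 1) ≫ₚ (a m).bwd = stage a k m := by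
  rcases le_or_gt k m with h | h
  · rw [stage_up a h, stage_up a (by omega : k ≤ m + 1), up_succ a h, PHom.assoc, (ha m).1,
      PHom.comp_id]
  · rw [stage_down a h, stage_down a h.le, down_right a h]

theorem fwd_stage (ha : ∀ k, (a k).IsEP) (k m : ℕ) :
    (a k).fwd ≫ₚ stage a (k + 1) m = stage a k m := by
  rcases le_or_gt m k with h | h
  · rw [stage_down a h, stage_down a (by omega : m ≤ k + 1), down_succ a h, ← PHom.assoc, (ha k).1,
      PHom.id_comp]
  · rw [stage_up a h, stage_up a h.le, up_left a h]

/-- The embedding of a stage into the bilimit. -/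
def coneEmb (ha : ∀ k, (a k).IsEP) (k : ℕ) (x : X k) : Bilim X a :=
  ⟨fun m => stage a k m x, fun m => congrArg (fun f => f x) (stage_bwd ha k m), k, by
    change stage a k k x ≠ ⊥; rw [stage_self]; exact WithBot.coe_ne_bot⟩

/-- The embedding-projection pairs of the bilimit. -/
noncomputable def cone (ha : ∀ k, (a k).IsEP) (k : ℕ) : Sym (X k) (bilim X a) where
  bwd := ⟨fun x => x.1 k, isMor_iff.2 ⟨fun _ _ h => Bilim.isSup_iff.1 h k, fun _ h => h k⟩⟩
  fwd := ⟨fun x => (coneEmb ha k x : Lift (Bilim X a)), isMor_coe.comp (f := coneEmb ha k)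
    (isMor_iff.2 ⟨fun _ _ h => Bilim.isSup_of fun m => (stage a k m).isMor.isSup h,
      fun α h m => (stage a k m).isMor.2 α h⟩)⟩

theorem cone_comm (ha : ∀ k, (a k).IsEP) (k : ℕ) : (a k).comp (cone ha (k + 1)) = cone ha k := by
  refine Sym.ext (Hom.ext fun x => x.2.1 k) (Hom.ext fun x => ?_)
  change Lift.elim ⊥ (cone ha (k + 1)).fwd ((a k).fwd x) = _
  have h0 : ∀ m, Lift.elim ⊥ (stage a (k + 1) m) ((a k).fwd x) = stage a k m x := fun m =>
    congrArg (fun f => f x) (fwd_stage ha k m)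
  generalize (a k).fwd x = u at h0
  induction u using WithBot.recBotCoe with
  | bot =>
    have := h0 k
    rw [stage_self] at this
    exact absurd this.symm WithBot.coe_ne_bot
  | coe y => exact congrArg WithBot.some (Subtype.ext (funext h0))

theorem cone_stage_le (ha : ∀ k, (a k).IsEP) (x : Bilim X a) (k m : ℕ) :
    Lift.elim ⊥ (stage a k m) (x.1 k) ≤ x.1 m := by
  rcases le_or_gt k m with h | h
  · rw [stage_up a h]
    induction m, h using Nat.le_induction with
    | base =>
      rw [up_self]
      generalize x.1 k = u
      induction u using WithBot.recBotCoe <;> exact le_rfl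
    | succ m hm ih =>
      rw [up_succ a hm]
      have h1 : Lift.elim ⊥ (up a hm ≫ₚ (a m).fwd) (x.1 k) =
          Lift.elim ⊥ (a m).fwd (Lift.elim ⊥ (up a hm) (x.1 k)) := by
        generalize x.1 k = u
        induction u using WithBot.recBotCoe <;> rfl
      rw [h1]
      refine ((a m).fwd.isMor_elim.mono ih).trans ?_
      rw [← x.2.1 m]
      generalize x.1 (m + 1) = u
      induction u using WithBot.recBotCoe with
      | bot => exact le_rfl
      | coe y => exact (ha m).2 y
  · rw [stage_down a h.le]
    refine le_of_eq ?_
    have : ∀ k (h : m ≤ k), Lift.elim ⊥ (down a h) (x.1 k) = x.1 m := fun k h => by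
      induction k, h using Nat.le_induction with
      | base =>
        rw [down_self]
        generalize x.1 m = u
        induction u using WithBot.recBotCoe <;> rfl
      | succ k hk ih =>
        rw [down_succ a hk, ← ih, ← x.2.1 k]
        generalize x.1 (k + 1) = u
        induction u using WithBot.recBotCoe <;> rfl
    exact this k h.le

theorem cone_isEP (ha : ∀ k, (a k).IsEP) (k : ℕ) : (cone ha k).IsEP := by
  refine ⟨Hom.ext fun x => ?_, fun x => ?_⟩
  · change stage a k k x = _
    rw [stage_self]
  · have h := cone_stage_le ha x k
    change Lift.elim ⊥ (cone ha k).fwd (x.1 k) ≤ (x : Lift (bilim X a))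
    generalize x.1 k = u at h
    induction u using WithBot.recBotCoe with
    | bot => exact bot_le
    | coe y => exact WithBot.coe_le_coe.2 h

theorem cone_isSup (ha : ∀ k, (a k).IsEP) :
    IsSup (fun k => (cone ha k).bwd ≫ₚ (cone ha k).fwd) (PHom.id _) := by
  refine SFPC.isSup_of (monotone_nat_of_le_succ fun k => ?_) (fun k => (cone_isEP ha k).2)
    fun f hf x => ?_
  · rw [← cone_comm ha k]
    change ((cone ha (k + 1)).bwd ≫ₚ (a k).bwd) ≫ₚ (a k).fwd ≫ₚ (cone ha (k + 1)).fwd ≤ _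
    rw [PHom.assoc, ← PHom.assoc (a k).bwd]
    refine PHom.comp_mono le_rfl ?_
    exact (PHom.comp_mono (ha k).2 le_rfl).trans_eq (PHom.id_comp _)
  · have hf : ∀ k, Lift.elim ⊥ (cone ha k).fwd (x.1 k) ≤ f x := fun k => hf k x
    change (x : Lift (bilim X a)) ≤ f x
    generalize f x = v at hf
    induction v using WithBot.recBotCoe with
    | bot =>
      obtain ⟨k, hk⟩ := x.2.2
      obtain ⟨y, hy⟩ := Lift.coe_of_ne hk
      have := hf k
      rw [hy] at this
      exact absurd (le_bot_iff.1 this) WithBot.coe_ne_bot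
    | coe y =>
      refine WithBot.coe_le_coe.2 fun m => ?_
      have := hf m
      by_cases hm : x.1 m = ⊥
      · rw [hm]; exact bot_le
      · obtain ⟨z, hz⟩ := Lift.coe_of_ne hm
        rw [hz] at this ⊢
        have := WithBot.coe_le_coe.1 this m
        refine le_trans (le_of_eq ?_) this
        change _ = stage a m m z
        rw [stage_self]; rfl

end Bilim

/-! ### Solving recursive domain equations -/

namespace Sym
variable {A B C : Sp}

/-- The componentwise order. -/
def Le (f g : Sym A B) : Prop := f.bwd ≤ g.bwd ∧ f.fwd ≤ g.fwd

theorem IsEP.comp_flip {f : Sym A B} (h : f.IsEP) : f.comp f.flip = Sym.id A := Sym.ext h.1 h.1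

theorem IsEP.flip_comp {f : Sym A B} (h : f.IsEP) : Le (f.flip.comp f) (Sym.id B) := ⟨h.2, h.2⟩

end Sym

namespace MFun
variable {n : ℕ} (F : MFun n)

theorem map_mono {A B : Fin n → Sp} {f g : ∀ i, Sym (A i) (B i)} (h : ∀ i, Sym.Le (f i) (g i)) :
    F.map f ≤ F.map g := by
  have key : ∀ {P : Type} [PartialOrder P] {x y : P}, x ≤ y →
      IsSup (fun k : ℕ => if k = 0 then x else y) y := fun {P} _ {x y} hxy =>
    isSup_of (fun m n hmn => by split_ifs <;> first | exact le_rfl | exact hxy | omega)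
      (fun n => by split_ifs <;> first | exact hxy | exact le_rfl) fun z hz => by simpa using hz 1
  have := F.cont (fun k i => if k = 0 then f i else g i) g fun i => ⟨?_, ?_⟩
  · simpa using this.le 0
  · convert key (h i).1 using 2 with k; dsimp only; split_ifs <;> rfl
  · convert key (h i).2 using 2 with k; dsimp only; split_ifs <;> rfl

theorem smap_id (A : Fin n → Sp) : F.smap (fun i => Sym.id (A i)) = Sym.id (F.obj A) :=
  Sym.ext (F.map_id A) (F.map_id A)

theorem smap_comp {A B C : Fin n → Sp} (f : ∀ i, Sym (A i) (B i)) (g : ∀ i, Sym (B i) (C i)) :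
    F.smap (fun i => (f i).comp (g i)) = (F.smap f).comp (F.smap g) :=
  Sym.ext (F.map_comp (fun i => (g i).flip) fun i => (f i).flip) (F.map_comp f g)

theorem smap_isEP {A B : Fin n → Sp} {f : ∀ i, Sym (A i) (B i)} (h : ∀ i, (f i).IsEP) :
    (F.smap f).IsEP := by
  constructor
  · change F.map f ≫ₚ F.map (fun i => (f i).flip) = _
    rw [← F.map_comp, ← F.map_id]
    congr 1; funext i; exact (h i).comp_flip
  · change F.map (fun i => (f i).flip) ≫ₚ F.map f ≤ _
    rw [← F.map_comp, ← F.map_id]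
    exact F.map_mono fun i => (h i).flip_comp

theorem smap_isLub {A B : Fin n → Sp} {f : ℕ → ∀ i, Sym (A i) (B i)} {g : ∀ i, Sym (A i) (B i)}
    (h : ∀ i, Sym.IsLub (fun k => f k i) (g i)) : Sym.IsLub (fun k => F.smap (f k)) (F.smap g) :=
  ⟨F.cont _ _ fun i => (h i).flip, F.cont _ _ h⟩

end MFun

/-- Extending a family of spaces. -/
def scons {n : ℕ} (X : Sp) (A : Fin n → Sp) (i : Fin (n + 1)) : Sp :=
  Fin.cases (motive := fun _ => Sp) X A i

/-- Extending a family of pairs of maps. -/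
def mcons {n : ℕ} {X Y : Sp} {A B : Fin n → Sp} (f : Sym X Y) (g : ∀ i, Sym (A i) (B i)) :
    ∀ i, Sym (scons X A i) (scons Y B i) :=
  Fin.cases (motive := fun i => Sym (scons X A i) (scons Y B i)) f g

section mcons
variable {n : ℕ} {X Y Z : Sp} {A B C : Fin n → Sp}

theorem mcons_id : mcons (Sym.id X) (fun i => Sym.id (A i)) = fun i => Sym.id (scons X A i) := by
  funext i; cases i using Fin.cases <;> rfl

theorem mcons_comp (f : Sym X Y) (f' : Sym Y Z) (g : ∀ i, Sym (A i) (B i))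
    (g' : ∀ i, Sym (B i) (C i)) : mcons (f.comp f') (fun i => (g i).comp (g' i)) =
      fun i => (mcons f g i).comp (mcons f' g' i) := by
  funext i; cases i using Fin.cases <;> rfl

theorem mcons_flip (f : Sym X Y) (g : ∀ i, Sym (A i) (B i)) :
    mcons f.flip (fun i => (g i).flip) = fun i => (mcons f g i).flip := by
  funext i; cases i using Fin.cases <;> rfl

theorem mcons_isEP {f : Sym X Y} {g : ∀ i, Sym (A i) (B i)} (hf : f.IsEP) (hg : ∀ i, (g i).IsEP)
    (i : Fin (n + 1)) : (mcons f g i).IsEP := by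
  cases i using Fin.cases with
  | zero => exact hf
  | succ i => exact hg i

theorem mcons_isLub {f : ℕ → Sym X Y} {g : ℕ → ∀ i, Sym (A i) (B i)} {f' : Sym X Y}
    {g' : ∀ i, Sym (A i) (B i)} (hf : Sym.IsLub f f')
    (hg : ∀ i, Sym.IsLub (fun k => g k i) (g' i)) (i : Fin (n + 1)) :
    Sym.IsLub (fun k => mcons (f k) (g k) i) (mcons f' g' i) := by
  cases i using Fin.cases with
  | zero => exact hf
  | succ i => exact hg i

end mcons

theorem Sym.id_isEP (A : Sp) : (Sym.id A).IsEP := ⟨rfl, le_rfl⟩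

namespace MFun
variable {n : ℕ} (F : MFun (n + 1))

/-- Iterates of an operation on the empty space. -/
noncomputable def iter (Φ : Sp → Sp) : ℕ → Sp
  | 0 => ⟨Empty⟩
  | k + 1 => Φ (iter Φ k)

/-- The approximations of the recursive type. -/
noncomputable abbrev apx (A : Fin n → Sp) (k : ℕ) : Sp := iter (fun X => F.obj (scons X A)) k

/-- The connecting pairs. -/
noncomputable def link (A : Fin n → Sp) : ∀ k, Sym (F.apx A k) (F.apx A (k + 1))
  | 0 => ⟨⟨fun _ => ⊥, isMor_const ⊥⟩, ⟨fun x => Empty.elim x, isMor_iff.2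
      ⟨fun _ x => Empty.elim x, fun α => Empty.elim (α 0)⟩⟩⟩
  | k + 1 => F.smap (mcons (link A k) fun i => Sym.id (A i))

theorem link_isEP (A : Fin n → Sp) : ∀ k, (F.link A k).IsEP
  | 0 => ⟨Hom.ext fun x => Empty.elim x, fun _ => bot_le⟩
  | k + 1 => F.smap_isEP (mcons_isEP (link_isEP A k) fun i => Sym.id_isEP (A i))

/-- The recursive type. -/
noncomputable def muObj (A : Fin n → Sp) : Sp := bilim (F.apx A) (F.link A)

/-- Its embedding-projection pairs. -/
noncomputable def muCone (A : Fin n → Sp) (k : ℕ) : Sym (F.apx A k) (F.muObj A) :=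
  cone (F.link_isEP A) k

variable {A B C : Fin n → Sp}

/-- The action on the approximations. -/
noncomputable def apxMap (f : ∀ i, Sym (A i) (B i)) : ∀ k, Sym (F.apx A k) (F.apx B k)
  | 0 => Sym.id _
  | k + 1 => F.smap (mcons (apxMap f k) f)

theorem apxMap_link (f : ∀ i, Sym (A i) (B i)) : ∀ k,
    (F.link A k).comp (F.apxMap f (k + 1)) = (F.apxMap f k).comp (F.link B k)
  | 0 => by
    refine Sym.ext (Hom.ext fun x => ?_) (Hom.ext fun x => Empty.elim x)
    have : ∀ u v : Lift Empty, u = v := fun u v => by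
      cases u using WithBot.recBotCoe with
      | bot => cases v using WithBot.recBotCoe with
        | bot => rfl
        | coe v => exact v.elim
      | coe u => exact u.elim
    exact this _ _
  | k + 1 => by
    change (F.smap _).comp (F.smap _) = (F.smap _).comp (F.smap _)
    rw [← smap_comp, ← smap_comp, ← mcons_comp, ← mcons_comp, apxMap_link f k]
    congr 2
    funext i
    exact Sym.ext (PHom.comp_id _) (PHom.comp_id _).symm

theorem apxMap_id (A : Fin n → Sp) : ∀ k, F.apxMap (fun i => Sym.id (A i)) k = Sym.id _
  | 0 => rfl
  | k + 1 => by
    change F.smap _ = _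
    rw [apxMap_id A k, mcons_id, smap_id]; rfl

theorem apxMap_comp (f : ∀ i, Sym (A i) (B i)) (g : ∀ i, Sym (B i) (C i)) : ∀ k,
    F.apxMap (fun i => (f i).comp (g i)) k = (F.apxMap f k).comp (F.apxMap g k)
  | 0 => rfl
  | k + 1 => by
    change F.smap _ = (F.smap _).comp (F.smap _)
    rw [apxMap_comp f g k, mcons_comp, smap_comp]

theorem apxMap_isLub {f : ℕ → ∀ i, Sym (A i) (B i)} {g : ∀ i, Sym (A i) (B i)}
    (h : ∀ i, Sym.IsLub (fun k => f k i) (g i)) : ∀ k,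
    Sym.IsLub (fun j => F.apxMap (f j) k) (F.apxMap g k)
  | 0 => Sym.isLub_const _
  | k + 1 => F.smap_isLub (mcons_isLub (apxMap_isLub h k) h)

/-- The approximations of the action on maps. -/
noncomputable def muApx (f : ∀ i, Sym (A i) (B i)) (k : ℕ) : PHom (F.muObj A) (F.muObj B) :=
  (F.muCone A k).bwd ≫ₚ (F.apxMap f k).fwd ≫ₚ (F.muCone B k).fwd

theorem ep_mono {A B C E : Sp} {f : Sym A B} (hf : f.IsEP) {p : PHom E B} {q : PHom B C}
    {p' : PHom E A} {q' : PHom A C} (hp : p ≫ₚ f.bwd = p') (hq : f.fwd ≫ₚ q = q') :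
    p' ≫ₚ q' ≤ p ≫ₚ q := by
  rw [← hp, ← hq, PHom.assoc, ← PHom.assoc f.bwd]
  exact PHom.comp_mono le_rfl ((PHom.comp_mono hf.2 le_rfl).trans_eq (PHom.id_comp _))

theorem muCone_bwd (A : Fin n → Sp) (k : ℕ) :
    (F.muCone A (k + 1)).bwd ≫ₚ (F.link A k).bwd = (F.muCone A k).bwd :=
  congrArg Sym.bwd (cone_comm (F.link_isEP A) k)

theorem muCone_fwd (A : Fin n → Sp) (k : ℕ) :
    (F.link A k).fwd ≫ₚ (F.muCone A (k + 1)).fwd = (F.muCone A k).fwd :=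
  congrArg Sym.fwd (cone_comm (F.link_isEP A) k)

theorem muCone_isSup (A : Fin n → Sp) :
    IsSup (fun k => (F.muCone A k).bwd ≫ₚ (F.muCone A k).fwd) (PHom.id (F.muObj A)) :=
  cone_isSup (F.link_isEP A)

theorem muCone_isEP (A : Fin n → Sp) (k : ℕ) : (F.muCone A k).IsEP := cone_isEP _ k

theorem muApx_mono (f : ∀ i, Sym (A i) (B i)) : Monotone (F.muApx f) := by
  refine monotone_nat_of_le_succ fun k => ep_mono (F.link_isEP A k)
    (F.muCone_bwd A k) ?_
  have h : (F.link A k).fwd ≫ₚ (F.apxMap f (k + 1)).fwd = (F.apxMap f k).fwd ≫ₚ (F.link B k).fwd :=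
    congrArg Sym.fwd (F.apxMap_link f k)
  rw [← PHom.assoc, h, PHom.assoc, F.muCone_fwd B]

/-- The action of the recursive type on maps. -/
noncomputable def muMap (f : ∀ i, Sym (A i) (B i)) : PHom (F.muObj A) (F.muObj B) :=
  ωSup ⟨⟨F.muApx f, F.muApx_mono f⟩⟩

theorem muMap_isSup (f : ∀ i, Sym (A i) (B i)) : IsSup (F.muApx f) (F.muMap f) :=
  isSup_ωSup ⟨⟨F.muApx f, F.muApx_mono f⟩⟩

/-- The recursive type as a functor of the remaining variables. -/
noncomputable def mu : MFun n where
  obj A := F.muObj A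
  map f := F.muMap f
  map_id A := by
    refine (F.muMap_isSup _).unique ?_
    convert F.muCone_isSup A using 2 with k
    rw [muApx, apxMap_id]; rfl
  map_comp {A B C} f g := by
    refine (F.muMap_isSup _).unique ?_
    convert PHom.isSup_comp (F.muMap_isSup f) (F.muMap_isSup g) using 2 with k
    simp only [muApx, apxMap_comp, PHom.assoc]
    rw [← PHom.assoc (F.muCone B k).fwd, (F.muCone_isEP B k).1, PHom.id_comp]
    rw [← PHom.assoc (F.apxMap f k).fwd]; rfl
  cont {A B} f g h := by
    have h1 : ∀ k, IsSup (fun j => F.muApx (f j) k) (F.muApx g k) := fun k =>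
      PHom.isSup_comp (isSup_const _) (PHom.isSup_comp (F.apxMap_isLub h k).2 (isSup_const _))
    exact isSup_of (fun i j hij => (F.muMap_isSup _).lub fun k =>
        ((h1 k).1 hij).trans ((F.muMap_isSup _).le k))
      (fun j => (F.muMap_isSup _).lub fun k => ((h1 k).le j).trans ((F.muMap_isSup _).le k))
      fun y hy => (F.muMap_isSup _).lub fun k => (h1 k).lub fun j =>
        ((F.muMap_isSup _).le k).trans (hy j)

/-! ### Folding and unfolding -/

/-- The functor applied to the embedding-projection pairs of the recursive type. -/
noncomputable def foldCone (A : Fin n → Sp) (k : ℕ) :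
    Sym (F.apx A (k + 1)) (F.obj (scons (F.muObj A) A)) :=
  F.smap (mcons (F.muCone A k) fun i => Sym.id (A i))

theorem foldCone_isEP (A : Fin n → Sp) (k : ℕ) : (F.foldCone A k).IsEP :=
  F.smap_isEP (mcons_isEP (F.muCone_isEP A k) fun i => Sym.id_isEP (A i))

theorem foldCone_comm (A : Fin n → Sp) (k : ℕ) :
    (F.link A (k + 1)).comp (F.foldCone A (k + 1)) = F.foldCone A k := by
  change (F.smap _).comp (F.smap _) = F.smap _
  rw [← smap_comp, ← mcons_comp]
  congr 2
  exact cone_comm (F.link_isEP A) k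

theorem foldCone_isSup (A : Fin n → Sp) :
    IsSup (fun k => (F.foldCone A k).bwd ≫ₚ (F.foldCone A k).fwd) (PHom.id _) := by
  have := F.cont (fun k => mcons ((F.muCone A k).flip.comp (F.muCone A k))
      fun i => (Sym.id (A i)).comp (Sym.id (A i))) (mcons (Sym.id _) fun i => Sym.id (A i))
    (mcons_isLub ⟨F.muCone_isSup A, F.muCone_isSup A⟩ fun i => Sym.isLub_const _)
  rw [mcons_id, F.map_id] at this
  convert this using 2 with k
  change F.map (fun i => (mcons _ _ i).flip) ≫ₚ F.map (mcons _ _) = _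
  rw [← mcons_flip, ← F.map_comp, ← mcons_comp]; rfl

theorem exists_fold (A : Fin n → Sp) : ∃ (f : PHom (F.obj (scons (F.muObj A) A)) (F.muObj A)),
    IsSup (fun k => (F.foldCone A k).bwd ≫ₚ (F.muCone A (k + 1)).fwd) f :=
  exists_isSup (monotone_nat_of_le_succ fun k => ep_mono (F.link_isEP A (k + 1))
    (congrArg Sym.bwd (F.foldCone_comm A k)) (F.muCone_fwd A (k + 1)))

theorem exists_unfold (A : Fin n → Sp) : ∃ (f : PHom (F.muObj A) (F.obj (scons (F.muObj A) A))),
    IsSup (fun k => (F.muCone A (k + 1)).bwd ≫ₚ (F.foldCone A k).fwd) f :=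
  exists_isSup (monotone_nat_of_le_succ fun k => ep_mono (F.link_isEP A (k + 1))
    (F.muCone_bwd A (k + 1)) (congrArg Sym.fwd (F.foldCone_comm A k)))

/-- The folding map, as the supremum of its approximations. -/
noncomputable def foldP (A : Fin n → Sp) : PHom (F.obj (scons (F.muObj A) A)) (F.muObj A) :=
  (F.exists_fold A).choose

/-- The unfolding map, as the supremum of its approximations. -/
noncomputable def unfoldP (A : Fin n → Sp) : PHom (F.muObj A) (F.obj (scons (F.muObj A) A)) :=
  (F.exists_unfold A).choose

theorem fold_unfold (A : Fin n → Sp) : F.foldP A ≫ₚ F.unfoldP A = PHom.id _ := by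
  refine (PHom.isSup_comp (F.exists_fold A).choose_spec (F.exists_unfold A).choose_spec).unique ?_
  convert F.foldCone_isSup A using 2 with k
  rw [PHom.assoc, ← PHom.assoc (F.muCone A (k + 1)).fwd, (F.muCone_isEP A _).1, PHom.id_comp]

theorem unfold_fold (A : Fin n → Sp) : F.unfoldP A ≫ₚ F.foldP A = PHom.id _ := by
  refine (PHom.isSup_comp (F.exists_unfold A).choose_spec (F.exists_fold A).choose_spec).unique ?_
  convert (F.muCone_isSup A).shift 1 using 2 with k
  rw [PHom.assoc, ← PHom.assoc (F.foldCone A k).fwd, (F.foldCone_isEP A _).1, PHom.id_comp,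
    Nat.add_comm]

end MFun

/-- A partial map that is everywhere defined is a morphism. -/
def PHom.total {A B : Sp} (f : PHom A B) (h : ∀ x, f x ≠ ⊥) : A ⟶ω B :=
  ⟨fun x => (f x).unbot (h x), isMor_iff.2 ⟨fun c x hc => by
    have h1 := f.isMor.isSup hc
    refine isSup_of (fun m n hmn => ?_) (fun n => ?_) fun y hy => ?_
    · rw [← WithBot.coe_le_coe, WithBot.coe_unbot, WithBot.coe_unbot]; exact h1.1 hmn
    · rw [← WithBot.coe_le_coe, WithBot.coe_unbot, WithBot.coe_unbot]; exact h1.le n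
    · rw [← WithBot.coe_le_coe, WithBot.coe_unbot]
      refine h1.lub fun n => ?_
      rw [← WithBot.coe_unbot _ (h (c n)), WithBot.coe_le_coe]; exact hy n,
    fun α hα => by
      obtain ⟨-, h2⟩ := f.isMor.2 α hα
      obtain ⟨b, hb, e⟩ := h2 ⟨(f (α 0)).unbot (h _)⟩
      convert hb using 2 with r
      exact WithBot.coe_injective ((WithBot.coe_unbot _ _).trans (e r (h _)))⟩⟩

theorem PHom.ne_bot {A B : Sp} {f : PHom A B} {g : PHom B A} (h : f ≫ₚ g = PHom.id A) (x : A) :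
    f x ≠ ⊥ := fun hx => by
  have : (f ≫ₚ g) x = PHom.id A x := by rw [h]
  change Lift.elim ⊥ g (f x) = _ at this
  rw [hx] at this
  exact WithBot.bot_ne_coe this

namespace MFun
variable {n : ℕ} (F : MFun (n + 1))

/-- The isomorphism `F(μF) → μF`. -/
noncomputable def fold (A : Fin n → Sp) : F.obj (scons (F.mu.obj A) A) ⟶ω F.mu.obj A :=
  (F.foldP A).total (PHom.ne_bot (F.fold_unfold A))

/-- The isomorphism `μF → F(μF)`. -/
noncomputable def unfold (A : Fin n → Sp) : F.mu.obj A ⟶ω F.obj (scons (F.mu.obj A) A) :=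
  (F.unfoldP A).total (PHom.ne_bot (F.unfold_fold A))

end MFun

/-! ## Types and their interpretation -/

/-- Types with `n` free type variables (de Bruijn indices). A variant type is given by a finite set
of labels with a type for each label; labels are natural numbers. -/
inductive Ty : ℕ → Type
  | var {n : ℕ} (i : Fin n) : Ty n
  | real {n : ℕ} : Ty n
  | unit {n : ℕ} : Ty n
  | prod {n : ℕ} (σ τ : Ty n) : Ty n
  | arrow {n : ℕ} (σ τ : Ty n) : Ty n
  | variant {n : ℕ} (L : Finset ℕ) (τ : {l // l ∈ L} → Ty n) : Ty n
  | mu {n : ℕ} (τ : Ty (n + 1)) : Ty n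

/-- Lifting a renaming under a binder. -/
def liftRen {m n : ℕ} (ρ : Fin m → Fin n) (i : Fin (m + 1)) : Fin (n + 1) :=
  Fin.cases (motive := fun _ => Fin (n + 1)) 0 (fun j => (ρ j).succ) i

/-- Renaming of type variables. -/
def Ty.rename {m n : ℕ} (ρ : Fin m → Fin n) : Ty m → Ty n
  | var i => var (ρ i)
  | real => real
  | unit => unit
  | prod σ τ => prod (σ.rename ρ) (τ.rename ρ)
  | arrow σ τ => arrow (σ.rename ρ) (τ.rename ρ)
  | variant L τ => variant L fun l => (τ l).rename ρ
  | mu τ => mu (τ.rename (liftRen ρ))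

/-- Lifting a substitution under a binder. -/
def liftSub {m n : ℕ} (s : Fin m → Ty n) (i : Fin (m + 1)) : Ty (n + 1) :=
  Fin.cases (motive := fun _ => Ty (n + 1)) (.var 0) (fun j => (s j).rename Fin.succ) i

/-- Capture-avoiding substitution of types for type variables. -/
def Ty.subst {m n : ℕ} (s : Fin m → Ty n) : Ty m → Ty n
  | var i => s i
  | real => real
  | unit => unit
  | prod σ τ => prod (σ.subst s) (τ.subst s)
  | arrow σ τ => arrow (σ.subst s) (τ.subst s)
  | variant L τ => variant L fun l => (τ l).subst s
  | mu τ => mu (τ.subst (liftSub s))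

/-- The unrolling `τ[μα.τ/α]` of a closed recursive type. -/
def Ty.unroll (τ : Ty 1) : Ty 0 := τ.subst fun _ => .mu τ

/-- The interpretation of types as functors of their free variables. -/
noncomputable def Ty.sem {n : ℕ} : Ty n → MFun n
  | var i => MFun.var i
  | real => MFun.const ⟨Rl⟩
  | unit => MFun.const ⟨Unit⟩
  | prod σ τ => σ.sem.prod τ.sem
  | arrow σ τ => σ.sem.arrow τ.sem
  | variant _ τ => MFun.sum fun l => (τ l).sem
  | mu τ => τ.sem.mu

/-! ### Substitution -/

/-- Tuples of `m` functors of `n` variables. -/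
structure MTup (m n : ℕ) where
  obj : (Fin n → Sp) → Fin m → Sp
  map : {A B : Fin n → Sp} → (∀ i, Sym (A i) (B i)) → ∀ j, Sym (obj A j) (obj B j)
  map_id : ∀ A : Fin n → Sp, map (fun i => Sym.id (A i)) = fun j => Sym.id (obj A j)
  map_comp : ∀ {A B C : Fin n → Sp} (f : ∀ i, Sym (A i) (B i)) (g : ∀ i, Sym (B i) (C i)),
    map (fun i => (f i).comp (g i)) = fun j => (map f j).comp (map g j)
  map_flip : ∀ {A B : Fin n → Sp} (f : ∀ i, Sym (A i) (B i)) (j : Fin m),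
    map (fun i => (f i).flip) j = (map f j).flip
  cont : ∀ {A B : Fin n → Sp} (f : ℕ → ∀ i, Sym (A i) (B i)) (g : ∀ i, Sym (A i) (B i)),
    (∀ i, Sym.IsLub (fun k => f k i) (g i)) → ∀ j, Sym.IsLub (fun k => map (f k) j) (map g j)

/-- Composition of functors. -/
def MFun.comp {m n : ℕ} (F : MFun m) (G : MTup m n) : MFun n where
  obj A := F.obj (G.obj A)
  map f := F.map (G.map f)
  map_id A := by rw [G.map_id, F.map_id]
  map_comp f g := by rw [G.map_comp, F.map_comp]
  cont f g h := F.cont _ _ (G.cont f g h)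

/-- Adding a variable to a tuple of functors. -/
def MTup.lift {m n : ℕ} (G : MTup m n) : MTup (m + 1) (n + 1) where
  obj A := scons (A 0) (G.obj fun i => A i.succ)
  map f := mcons (f 0) (G.map fun i => f i.succ)
  map_id A := by rw [G.map_id, mcons_id]
  map_comp f g := by rw [← mcons_comp, ← G.map_comp]
  map_flip f j := by
    cases j using Fin.cases with
    | zero => rfl
    | succ j => exact G.map_flip (fun i => f i.succ) j
  cont f g h := mcons_isLub (h 0) (G.cont _ _ fun i => h i.succ)

theorem MFun.ext' {n : ℕ} {F G : MFun n}
    (h : (⟨F.obj, @F.map⟩ : Σ' obj : (Fin n → Sp) → Sp, ∀ A B : Fin n → Sp,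
      (∀ i, Sym (A i) (B i)) → PHom (obj A) (obj B)) = ⟨G.obj, @G.map⟩) : F = G := by
  cases F; cases G
  simp only [PSigma.mk.injEq] at h
  obtain ⟨rfl, h⟩ := h
  simp only [heq_eq_eq] at h
  congr

theorem mcons_eq {n : ℕ} {X Y : Sp} {A B : Fin n → Sp} {f f' : Sym X Y} {g g' : ∀ i, Sym (A i) (B i)}
    (hf : f = f') (hg : g = g') : mcons f g = mcons f' g' := by rw [hf, hg]

section
variable {m n : ℕ} (F : MFun (m + 1)) (G : MTup m n)

theorem MFun.apx_lift (A : Fin n → Sp) (k : ℕ) : (F.comp G.lift).apx A k = F.apx (G.obj A) k := rfl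

theorem MFun.smap_lift {X Y : Sp} {A B : Fin n → Sp} (f : Sym X Y) (g : ∀ i, Sym (A i) (B i)) :
    (F.comp G.lift).smap (mcons f g) = F.smap (mcons f (G.map g)) := by
  refine Sym.ext ?_ rfl
  change F.map (mcons f.flip (G.map fun i => (g i).flip)) = F.map _
  congr 1
  funext i
  cases i using Fin.cases with
  | zero => rfl
  | succ i => exact G.map_flip g i

theorem MFun.link_lift (A : Fin n → Sp) (k : ℕ) :
    (F.comp G.lift).link A k = F.link (G.obj A) k := by
  induction k with
  | zero => rfl
  | succ k ih =>
    change (F.comp G.lift).smap (mcons ((F.comp G.lift).link A k) _) = F.smap _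
    rw [F.smap_lift G, G.map_id, ih]; rfl

theorem MFun.apxMap_lift {A B : Fin n → Sp} (f : ∀ i, Sym (A i) (B i)) (k : ℕ) :
    (F.comp G.lift).apxMap f k = F.apxMap (G.map f) k := by
  induction k with
  | zero => rfl
  | succ k ih =>
    change (F.comp G.lift).smap (mcons ((F.comp G.lift).apxMap f k) _) = F.smap _
    rw [F.smap_lift G, ih]; rfl

theorem MFun.mu_lift : (F.comp G.lift).mu = F.mu.comp G := by
  have key : ∀ (X : (Fin n → Sp) → ℕ → Sp) (L L' : ∀ A k, Sym (X A k) (X A (k + 1)))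
      (φ φ' : ∀ A B : Fin n → Sp, (∀ i, Sym (A i) (B i)) → ∀ k, Sym (X A k) (X B k))
      (hL : ∀ A k, (L A k).IsEP) (hL' : ∀ A k, (L' A k).IsEP)
      (hm : ∀ A B f, Monotone fun k =>
        (cone (hL A) k).bwd ≫ₚ (φ A B f k).fwd ≫ₚ (cone (hL B) k).fwd)
      (hm' : ∀ A B f, Monotone fun k =>
        (cone (hL' A) k).bwd ≫ₚ (φ' A B f k).fwd ≫ₚ (cone (hL' B) k).fwd),
      L = L' → φ = φ' → (⟨fun A => bilim (X A) (L A), fun A B f => ωSup ⟨⟨_, hm A B f⟩⟩⟩ :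
        Σ' obj : (Fin n → Sp) → Sp, ∀ A B : Fin n → Sp,
          (∀ i, Sym (A i) (B i)) → PHom (obj A) (obj B)) =
        ⟨fun A => bilim (X A) (L' A), fun A B f => ωSup ⟨⟨_, hm' A B f⟩⟩⟩ := by
    rintro X L _ φ _ hL hL' hm hm' rfl rfl
    rfl
  exact MFun.ext' (key (fun A => F.apx (G.obj A)) (fun A => (F.comp G.lift).link A)
    (fun A => F.link (G.obj A)) (fun A B f => (F.comp G.lift).apxMap f)
    (fun A B f => F.apxMap (G.map f)) (fun A => (F.comp G.lift).link_isEP A)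
    (fun A => F.link_isEP (G.obj A)) (fun A B f => (F.comp G.lift).muApx_mono f)
    (fun A B f => F.muApx_mono (G.map f)) (funext fun A => funext fun k => F.link_lift G A k)
    (funext fun A => funext fun B => funext fun f => funext fun k => F.apxMap_lift G f k))

end

/-- Projections out of a tuple. -/
def MTup.nth {m n : ℕ} (G : MTup m n) (j : Fin m) : MFun n := (MFun.var j).comp G

/-- The tuple that forgets the first variable. -/
def MTup.shift (n : ℕ) : MTup n (n + 1) where
  obj A i := A i.succ
  map f i := f i.succ
  map_id _ := rfl
  map_comp _ _ := rfl
  map_flip _ _ := rfl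
  cont _ _ h i := h i.succ

theorem MFun.arrow_comp {m n : ℕ} (F H : MFun m) (G : MTup m n) :
    (F.comp G).arrow (H.comp G) = (F.arrow H).comp G := by
  refine MFun.ext' (congrArg (PSigma.mk _) ?_)
  funext A B f
  change PHom.arrow (F.map (G.map fun i => (f i).flip)) _ =
    PHom.arrow (F.map fun j => (G.map f j).flip) _
  rw [show (G.map fun i => (f i).flip) = fun j => (G.map f j).flip from funext (G.map_flip f)]
  rfl

theorem Ty.sem_rename {m n : ℕ} (τ : Ty m) (ρ : Fin m → Fin n) (G : MTup m n)
    (h : ∀ j, MFun.var (ρ j) = G.nth j) : (τ.rename ρ).sem = τ.sem.comp G := by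
  induction τ generalizing n with
  | var i => exact h i
  | real => rfl
  | unit => rfl
  | prod σ τ ih ih' => rw [Ty.rename, Ty.sem, ih ρ G h, ih' ρ G h]; rfl
  | arrow σ τ ih ih' =>
    rw [Ty.rename, Ty.sem, ih ρ G h, ih' ρ G h, MFun.arrow_comp]; rfl
  | variant L τ ih =>
    rw [Ty.rename, Ty.sem]
    simp only [ih _ ρ G h]; rfl
  | mu τ ih =>
    rw [Ty.rename, Ty.sem, ih (liftRen ρ) G.lift, MFun.mu_lift]; · rfl
    intro j
    cases j using Fin.cases with
    | zero => rfl
    | succ j => exact congrArg (fun F : MFun _ => F.comp (MTup.shift _)) (h j)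

theorem Ty.sem_subst {m n : ℕ} (τ : Ty m) (s : Fin m → Ty n) (G : MTup m n)
    (h : ∀ j, (s j).sem = G.nth j) : (τ.subst s).sem = τ.sem.comp G := by
  induction τ generalizing n with
  | var i => exact h i
  | real => rfl
  | unit => rfl
  | prod σ τ ih ih' => rw [Ty.subst, Ty.sem, ih s G h, ih' s G h]; rfl
  | arrow σ τ ih ih' => rw [Ty.subst, Ty.sem, ih s G h, ih' s G h, MFun.arrow_comp]; rfl
  | variant L τ ih =>
    rw [Ty.subst, Ty.sem]
    simp only [ih _ s G h]; rfl
  | mu τ ih =>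
    rw [Ty.subst, Ty.sem, ih (liftSub s) G.lift, MFun.mu_lift]; · rfl
    intro j
    cases j using Fin.cases with
    | zero => rfl
    | succ j =>
      change ((s j).rename Fin.succ).sem = _
      rw [Ty.sem_rename (s j) Fin.succ (MTup.shift _) fun _ => rfl, h j]; rfl

/-- The tuple consisting of a functor followed by all the variables. -/
def MTup.inst {n : ℕ} (F : MFun n) : MTup (n + 1) n where
  obj A := scons (F.obj A) A
  map f := mcons (F.smap f) f
  map_id A := by rw [F.smap_id, mcons_id]
  map_comp f g := by rw [F.smap_comp, mcons_comp]
  map_flip f j := by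
    cases j using Fin.cases <;> rfl
  cont f g h := mcons_isLub (F.smap_isLub h) h

/-- The space denoted by a closed type. -/
noncomputable def Ty.den (τ : Ty 0) : Sp := τ.sem.obj fun i => i.elim0

theorem Ty.den_unroll (τ : Ty 1) :
    τ.unroll.den = τ.sem.obj (scons (Ty.mu τ).den fun i => i.elim0) := by
  have : τ.unroll.sem = τ.sem.comp (MTup.inst (Ty.mu τ).sem) :=
    Ty.sem_subst τ _ _ fun j => by
      obtain rfl : j = 0 := Subsingleton.elim _ _
      rfl
  rw [Ty.den, this]; rfl

/-- Transport along an equality of spaces. -/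
def Hom.cast {A B : Sp} (h : A = B) : A ⟶ω B := h ▸ Hom.id A

/-- The isomorphism from the unrolling of a recursive type to the recursive type. -/
noncomputable def Ty.roll (τ : Ty 1) : τ.unroll.den ⟶ω (Ty.mu τ).den :=
  (Hom.cast τ.den_unroll).then (τ.sem.fold fun i => i.elim0)

/-- The isomorphism from a recursive type to its unrolling. -/
noncomputable def Ty.unrollHom (τ : Ty 1) : (Ty.mu τ).den ⟶ω τ.unroll.den :=
  (τ.sem.unfold fun i => i.elim0).then (Hom.cast τ.den_unroll.symm)

/-! ## Terms -/

/-- Measurable partial functions `ℝⁿ ⇀ ℝ`: preimages of Borel sets are Borel (in particular, the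
domain of definition is). -/
structure Prim (n : ℕ) where
  toFun : (Fin n → ℝ) → Option ℝ
  measurable : ∀ s : Set ℝ, MeasurableSet s → MeasurableSet {x | ∃ y ∈ s, toFun x = some y}

/-- Variable contexts: lists of closed types. -/
abbrev Ctx : Type := List (Ty 0)

/-- Variables of type `τ` in a context (de Bruijn indices). -/
inductive Var : Ctx → Ty 0 → Type
  | zero {Γ : Ctx} {τ : Ty 0} : Var (τ :: Γ) τ
  | succ {Γ : Ctx} {σ τ : Ty 0} (x : Var Γ τ) : Var (σ :: Γ) τ

/-- Well-typed terms, up to renaming of bound variables. The literals (constants of type `real`) are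
drawn from a set `K`: for `K = ℝ` these are the terms of SFPC, and for `K = Fin n` they are the
templates in which `n` real constants have been left open. The body of `pmatch` has the second
component as its first variable. -/
inductive Tm (K : Type) : Ctx → Ty 0 → Type
  | var {Γ : Ctx} {τ : Ty 0} (x : Var Γ τ) : Tm K Γ τ
  | lit {Γ : Ctx} (k : K) : Tm K Γ .real
  | prim {Γ : Ctx} {n : ℕ} (f : Prim n) (t : Fin n → Tm K Γ .real) : Tm K Γ .real
  | ifz {Γ : Ctx} {τ : Ty 0} (t : Tm K Γ .real) (s u : Tm K Γ τ) : Tm K Γ τ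
  | sample {Γ : Ctx} : Tm K Γ .real
  | score {Γ : Ctx} (t : Tm K Γ .real) : Tm K Γ .unit
  | unit {Γ : Ctx} : Tm K Γ .unit
  | pair {Γ : Ctx} {σ τ : Ty 0} (t : Tm K Γ σ) (s : Tm K Γ τ) : Tm K Γ (.prod σ τ)
  | inj {Γ : Ctx} {L : Finset ℕ} {τ : {l // l ∈ L} → Ty 0} (l : {l // l ∈ L})
      (t : Tm K Γ (τ l)) : Tm K Γ (.variant L τ)
  | roll {Γ : Ctx} {τ : Ty 1} (t : Tm K Γ τ.unroll) : Tm K Γ (.mu τ)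
  | lam {Γ : Ctx} {σ τ : Ty 0} (t : Tm K (σ :: Γ) τ) : Tm K Γ (.arrow σ τ)
  | app {Γ : Ctx} {σ τ : Ty 0} (t : Tm K Γ (.arrow σ τ)) (s : Tm K Γ σ) : Tm K Γ τ
  | umatch {Γ : Ctx} {τ : Ty 0} (t : Tm K Γ .unit) (s : Tm K Γ τ) : Tm K Γ τ
  | pmatch {Γ : Ctx} {σ ρ τ : Ty 0} (t : Tm K Γ (.prod σ ρ)) (s : Tm K (ρ :: σ :: Γ) τ) : Tm K Γ τ
  | vmatch {Γ : Ctx} {L : Finset ℕ} {σ : {l // l ∈ L} → Ty 0} {τ : Ty 0}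
      (t : Tm K Γ (.variant L σ)) (s : ∀ l, Tm K (σ l :: Γ) τ) : Tm K Γ τ
  | rmatch {Γ : Ctx} {σ : Ty 1} {τ : Ty 0} (t : Tm K Γ (.mu σ)) (s : Tm K (σ.unroll :: Γ) τ) :
      Tm K Γ τ

/-- Renamings. -/
abbrev Ren (Γ Δ : Ctx) : Type := ∀ τ : Ty 0, Var Γ τ → Var Δ τ

/-- Lifting a renaming under a binder. -/
def Ren.lift {Γ Δ : Ctx} (ρ : Ren Γ Δ) (σ : Ty 0) : Ren (σ :: Γ) (σ :: Δ)
  | _, .zero => .zero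
  | _, .succ x => .succ (ρ _ x)

/-- Simultaneous substitutions. -/
abbrev Sub (K : Type) (Γ Δ : Ctx) : Type := ∀ τ : Ty 0, Var Γ τ → Tm K Δ τ

namespace Tm
variable {K : Type}

/-- Renaming of variables. -/
def rename : ∀ {Γ Δ : Ctx} {τ : Ty 0}, Ren Γ Δ → Tm K Γ τ → Tm K Δ τ
  | _, _, _, ρ, var x => var (ρ _ x)
  | _, _, _, _, lit k => lit k
  | _, _, _, ρ, prim f t => prim f fun i => (t i).rename ρ
  | _, _, _, ρ, ifz t s u => ifz (t.rename ρ) (s.rename ρ) (u.rename ρ)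
  | _, _, _, _, sample => sample
  | _, _, _, ρ, score t => score (t.rename ρ)
  | _, _, _, _, unit => unit
  | _, _, _, ρ, pair t s => pair (t.rename ρ) (s.rename ρ)
  | _, _, _, ρ, inj l t => inj l (t.rename ρ)
  | _, _, _, ρ, roll t => roll (t.rename ρ)
  | _, _, _, ρ, lam t => lam (t.rename (ρ.lift _))
  | _, _, _, ρ, app t s => app (t.rename ρ) (s.rename ρ)
  | _, _, _, ρ, umatch t s => umatch (t.rename ρ) (s.rename ρ)
  | _, _, _, ρ, pmatch t s => pmatch (t.rename ρ) (s.rename ((ρ.lift _).lift _))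
  | _, _, _, ρ, vmatch t s => vmatch (t.rename ρ) fun l => (s l).rename (ρ.lift _)
  | _, _, _, ρ, rmatch t s => rmatch (t.rename ρ) (s.rename (ρ.lift _))

end Tm

/-- Lifting a substitution under a binder. -/
def Sub.lift {K : Type} {Γ Δ : Ctx} (θ : Sub K Γ Δ) (σ : Ty 0) : Sub K (σ :: Γ) (σ :: Δ)
  | _, .zero => .var .zero
  | _, .succ x => (θ _ x).rename fun _ => .succ

/-- Extending a substitution. -/
def Sub.cons {K : Type} {Γ Δ : Ctx} {σ : Ty 0} (t : Tm K Δ σ) (θ : Sub K Γ Δ) : Sub K (σ :: Γ) Δ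
  | _, .zero => t
  | _, .succ x => θ _ x

/-- The empty substitution. -/
def Sub.nil {K : Type} {Δ : Ctx} : Sub K [] Δ := fun _ x => nomatch x

namespace Tm
variable {K K' : Type}

/-- Capture-avoiding substitution. -/
def subst : ∀ {Γ Δ : Ctx} {τ : Ty 0}, Sub K Γ Δ → Tm K Γ τ → Tm K Δ τ
  | _, _, _, θ, var x => θ _ x
  | _, _, _, _, lit k => lit k
  | _, _, _, θ, prim f t => prim f fun i => (t i).subst θ
  | _, _, _, θ, ifz t s u => ifz (t.subst θ) (s.subst θ) (u.subst θ)
  | _, _, _, _, sample => sample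
  | _, _, _, θ, score t => score (t.subst θ)
  | _, _, _, _, unit => unit
  | _, _, _, θ, pair t s => pair (t.subst θ) (s.subst θ)
  | _, _, _, θ, inj l t => inj l (t.subst θ)
  | _, _, _, θ, roll t => roll (t.subst θ)
  | _, _, _, θ, lam t => lam (t.subst (θ.lift _))
  | _, _, _, θ, app t s => app (t.subst θ) (s.subst θ)
  | _, _, _, θ, umatch t s => umatch (t.subst θ) (s.subst θ)
  | _, _, _, θ, pmatch t s => pmatch (t.subst θ) (s.subst ((θ.lift _).lift _))
  | _, _, _, θ, vmatch t s => vmatch (t.subst θ) fun l => (s l).subst (θ.lift _)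
  | _, _, _, θ, rmatch t s => rmatch (t.subst θ) (s.subst (θ.lift _))

/-- Replacing the literals of a term. -/
def map (g : K → K') : ∀ {Γ : Ctx} {τ : Ty 0}, Tm K Γ τ → Tm K' Γ τ
  | _, _, var x => var x
  | _, _, lit k => lit (g k)
  | _, _, prim f t => prim f fun i => (t i).map g
  | _, _, ifz t s u => ifz (t.map g) (s.map g) (u.map g)
  | _, _, sample => sample
  | _, _, score t => score (t.map g)
  | _, _, unit => unit
  | _, _, pair t s => pair (t.map g) (s.map g)
  | _, _, inj l t => inj l (t.map g)
  | _, _, roll t => roll (t.map g)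
  | _, _, lam t => lam (t.map g)
  | _, _, app t s => app (t.map g) (s.map g)
  | _, _, umatch t s => umatch (t.map g) (s.map g)
  | _, _, pmatch t s => pmatch (t.map g) (s.map g)
  | _, _, vmatch t s => vmatch (t.map g) fun l => (s l).map g
  | _, _, rmatch t s => rmatch (t.map g) (s.map g)

end Tm

/-! ### Values -/

/-- Closed values. -/
inductive Val (K : Type) : Ty 0 → Type
  | lit (k : K) : Val K .real
  | unit : Val K .unit
  | pair {σ τ : Ty 0} (v : Val K σ) (w : Val K τ) : Val K (.prod σ τ)
  | inj {L : Finset ℕ} {τ : {l // l ∈ L} → Ty 0} (l : {l // l ∈ L}) (v : Val K (τ l)) :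
      Val K (.variant L τ)
  | roll {τ : Ty 1} (v : Val K τ.unroll) : Val K (.mu τ)
  | lam {σ τ : Ty 0} (t : Tm K [σ] τ) : Val K (.arrow σ τ)

namespace Val
variable {K K' : Type}

/-- Values are terms. -/
def toTm : ∀ {τ : Ty 0}, Val K τ → Tm K [] τ
  | _, lit k => .lit k
  | _, unit => .unit
  | _, pair v w => .pair v.toTm w.toTm
  | _, inj l v => .inj l v.toTm
  | _, roll v => .roll v.toTm
  | _, lam t => .lam t

/-- Replacing the literals of a value. -/
def map (g : K → K') : ∀ {τ : Ty 0}, Val K τ → Val K' τ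
  | _, lit k => lit (g k)
  | _, unit => unit
  | _, pair v w => pair (v.map g) (w.map g)
  | _, inj l v => inj l (v.map g)
  | _, roll v => roll (v.map g)
  | _, lam t => lam (t.map g)

/-- The literal of a value of type `real`. -/
def real : Val K .real → K
  | lit k => k

/-- The first component of a value of product type. -/
def fst {σ τ : Ty 0} : Val K (.prod σ τ) → Val K σ
  | pair v _ => v

/-- The second component of a value of product type. -/
def snd {σ τ : Ty 0} : Val K (.prod σ τ) → Val K τ
  | pair _ w => w

/-- The label of a value of variant type. -/
def label {L : Finset ℕ} {τ : {l // l ∈ L} → Ty 0} : Val K (.variant L τ) → {l // l ∈ L}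
  | inj l _ => l

/-- The content of a value of variant type. -/
def content {L : Finset ℕ} {τ : {l // l ∈ L} → Ty 0} : (v : Val K (.variant L τ)) →
    Val K (τ v.label)
  | inj _ v => v

/-- The content of a value of recursive type. -/
def unroll {τ : Ty 1} : Val K (.mu τ) → Val K τ.unroll
  | roll v => v

/-- The body of a value of function type. -/
def body {σ τ : Ty 0} : Val K (.arrow σ τ) → Tm K [σ] τ
  | lam t => t

end Val

/-- The measurable structure on values. Every value arises from a value template with `n` open
constants by filling in `n` real numbers; a set of values is measurable when its preimage in `ℝⁿ`
under every template is Borel. (Templates in which each constant is used exactly once and in order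
suffice, since any other template arises from such a template by a measurable map of tuples; hence
this is the coproduct, over these linear templates, of the Borel spaces `ℝⁿ`.) -/
instance {τ : Ty 0} : MeasurableSpace (Val ℝ τ) :=
  ⨅ (n : ℕ) (t : Val (Fin n) τ), MeasurableSpace.map (fun r : Fin n → ℝ => t.map r) inferInstance

/-! ## Operational semantics -/

/-- Evaluation of a list of real arguments from left to right. -/
noncomputable def evalArgs {Y : Type} [MeasurableSpace Y] : ∀ {n : ℕ},
    (Fin n → Measure (Val ℝ .real)) → ((Fin n → ℝ) → Measure Y) → Measure Y
  | 0, _, k => k fun i => i.elim0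
  | _ + 1, m, k => (m 0).bind fun v =>
      evalArgs (fun i => m i.succ) fun r => k (Fin.cons v.real r)

/-- One level of the evaluation kernels: the evaluation of a closed term, where `ev` is used to
evaluate the terms that arise by substitution. The term is presented with a context `Γ` that is
equal to the empty context, so that the definition is by recursion on the structure of terms. -/
noncomputable def evalStep (ev : ∀ τ : Ty 0, Tm ℝ [] τ → Measure (Val ℝ τ)) :
    ∀ {Γ : Ctx} {τ : Ty 0}, Γ = [] → Tm ℝ Γ τ → Measure (Val ℝ τ)
  | _, _, h, .var x => nomatch h ▸ x
  | _, _, _, .lit r => Measure.dirac (.lit r)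
  | _, _, h, .prim f t => evalArgs (fun i => evalStep ev h (t i)) fun r =>
      (f.toFun r).elim 0 fun y => Measure.dirac (.lit y)
  | _, _, h, .ifz t s u => (evalStep ev h t).bind fun v =>
      open Classical in if v.real = 0 then evalStep ev h s else evalStep ev h u
  | _, _, _, .sample => (volume.restrict (Set.Icc (0 : ℝ) 1)).bind fun r => Measure.dirac (.lit r)
  | _, _, h, .score t => (evalStep ev h t).bind fun v =>
      ENNReal.ofReal |v.real| • Measure.dirac .unit
  | _, _, _, .unit => Measure.dirac .unit
  | _, _, h, .pair t s => (evalStep ev h t).bind fun v => (evalStep ev h s).bind fun w =>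
      Measure.dirac (.pair v w)
  | _, _, h, .inj l t => (evalStep ev h t).bind fun v => Measure.dirac (.inj l v)
  | _, _, h, .roll t => (evalStep ev h t).bind fun v => Measure.dirac (.roll v)
  | _, _, h, .lam t => Measure.dirac (.lam (h ▸ t))
  | _, _, h, .app t s => (evalStep ev h t).bind fun f => (evalStep ev h s).bind fun v =>
      ev _ (f.body.subst (Sub.nil.cons v.toTm))
  | _, _, h, .umatch t s => (evalStep ev h t).bind fun _ => evalStep ev h s
  | _, _, h, .pmatch (σ := σ) (ρ := ρ) (τ := τ) t s => (evalStep ev h t).bind fun v =>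
      ev _ (Tm.subst (τ := τ) ((Sub.nil.cons v.fst.toTm).cons v.snd.toTm)
        (h ▸ s : Tm ℝ [ρ, σ] τ))
  | _, _, h, .vmatch (σ := σ) (τ := τ) t s => (evalStep ev h t).bind fun v =>
      ev _ (Tm.subst (τ := τ) (Sub.nil.cons v.content.toTm) (h ▸ s v.label : Tm ℝ [σ v.label] τ))
  | _, _, h, .rmatch (σ := σ) (τ := τ) t s => (evalStep ev h t).bind fun v =>
      ev _ (Tm.subst (τ := τ) (Sub.nil.cons v.unroll.toTm) (h ▸ s : Tm ℝ [σ.unroll] τ))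

/-- The indexed evaluation kernels. -/
noncomputable def evalN : ℕ → ∀ τ : Ty 0, Tm ℝ [] τ → Measure (Val ℝ τ)
  | 0, _, _ => 0
  | n + 1, _, t => evalStep (evalN n) rfl t

/-- The evaluation kernel: the supremum of the indexed kernels. -/
noncomputable def eval {τ : Ty 0} (t : Tm ℝ [] τ) : Measure (Val ℝ τ) := ⨆ n, evalN n τ t

/-- Program contexts of type `σ` with a hole for closed terms of type `τ`: terms of type `σ` with a
single free variable, the hole, of type `τ`. -/
abbrev PCtx (τ σ : Ty 0) : Type := Tm ℝ [τ] σ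

/-- Filling the hole. -/
def PCtx.fill {τ σ : Ty 0} (C : PCtx τ σ) (t : Tm ℝ [] τ) : Tm ℝ [] σ :=
  C.subst (Sub.nil.cons t)

/-- The contextual preorder on closed terms. -/
def CtxLe {τ : Ty 0} (t s : Tm ℝ [] τ) : Prop :=
  ∀ C : PCtx τ .real, eval (C.fill t) ≤ eval (C.fill s)

/-- Contextual equivalence of closed terms. -/
def CtxEquiv {τ : Ty 0} (t s : Tm ℝ [] τ) : Prop := CtxLe t s ∧ CtxLe s t

/-! ## Denotational semantics -/

section
variable {X Y Z G : Type} [WQbs X] [WQbs Y] [WQbs Z] [WQbs G]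

/-- Sequencing of effectful maps in an environment. -/
def seqH (f : G ⟶ω T X) (g : X × G ⟶ω T Y) : G ⟶ω T Y :=
  ⟨fun γ => (f γ).bind ⟨fun x => g (x, γ), g.isMor.comp (isMor_id.pair (isMor_const γ))⟩,
    f.isMor.bind (IsMor.lam (g.isMor.comp (isMor_snd.pair isMor_fst)))⟩

/-- Pure maps as effectful maps. -/
def pureH (f : G ⟶ω X) : G ⟶ω T X := ⟨fun γ => T.pure (f γ), T.isMor_pure.comp f.isMor⟩

/-- Left-to-right evaluation of a list of arguments. -/
def argsH : ∀ {n : ℕ}, (Fin n → (G ⟶ω T X)) → (G ⟶ω T (Fin n → X))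
  | 0, _ => pureH ⟨fun _ i => i.elim0, isMor_const _⟩
  | n + 1, f => seqH (f 0) (seqH
      ⟨fun p => argsH (fun i => f i.succ) p.2, (argsH fun i => f i.succ).isMor.comp isMor_snd⟩
      (pureH ⟨fun p => Fin.cons p.2.1 p.1, IsMor.pi fun i => by
        cases i using Fin.cases with
        | zero => exact isMor_fst.comp isMor_snd
        | succ i =>
          exact (isMor_iff.2 ⟨fun _ _ h => isSup_pi.1 h i, fun _ h => h i⟩ :
            IsMor fun a : Fin n → X => a i).comp isMor_fst⟩))

end

/-- Undefined results are represented by `⊥`. -/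
def liftOf : Option ℝ → Lift Rl
  | none => ⊥
  | some y => WithBot.some (α := Rl) y

theorem liftOf_ne_bot {o : Option ℝ} : liftOf o ≠ ⊥ ↔ ∃ y, o = some y := by
  cases o with
  | none => simp [liftOf]
  | some y => exact ⟨fun _ => ⟨y, rfl⟩, fun _ => WithBot.coe_ne_bot⟩

/-- A primitive as a partial function on real values. -/
def Prim.lift {n : ℕ} (f : Prim n) (r : Fin n → Rl) : Lift Rl := liftOf (f.toFun r)

theorem Prim.isMor_lift {n : ℕ} (f : Prim n) : IsMor f.lift := by
  refine isMor_iff.2 ⟨fun c x hc => ?_, fun α hα => ?_⟩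
  · have : c = fun _ => x := funext fun k => funext fun i =>
      isSup_discrete (fun _ _ h => h) (isSup_pi.1 hc i) k
    rw [this]; exact isSup_const _
  · suffices key : ∀ β : ℝ → Fin n → ℝ, Measurable β →
        (fun r => f.lift (β r)) ∈ rand (X := Lift Rl) from
      key α (measurable_pi_lambda (X := fun _ => ℝ) α hα)
    intro β hβ
    have hs : ∀ s, MeasurableSet s → MeasurableSet {r | ∃ y ∈ s, f.toFun (β r) = some y} :=
      fun s hs => hβ (f.measurable s hs)
    have hd : MeasurableSet {r | f.lift (β r) ≠ ⊥} := by
      convert hs Set.univ MeasurableSet.univ using 1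
      ext r
      refine liftOf_ne_bot.trans ?_
      simp
    refine ⟨hd, fun _ => ⟨fun r => (f.toFun (β r)).getD (0 : ℝ), ?_, fun r hr => ?_⟩⟩
    · change Measurable (β := ℝ) fun r => (f.toFun (β r)).getD (0 : ℝ)
      intro s hs'
      have h : (fun r => (f.toFun (β r)).getD (0 : ℝ)) ⁻¹' s =
          {r | ∃ y ∈ s, f.toFun (β r) = some y} ∪ ({r | f.lift (β r) ≠ ⊥}ᶜ ∩ {_r | (0 : ℝ) ∈ s}) := by
        ext r
        change (f.toFun (β r)).getD (0 : ℝ) ∈ s ↔ (∃ y ∈ s, f.toFun (β r) = some y) ∨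
          (¬ (liftOf (f.toFun (β r)) ≠ ⊥) ∧ (0 : ℝ) ∈ s)
        rw [liftOf_ne_bot]
        cases f.toFun (β r) <;> simp
      rw [h]
      exact (hs s hs').union (hd.compl.inter (MeasurableSet.const _))
    · obtain ⟨y, hy⟩ := liftOf_ne_bot.1 hr
      change liftOf (f.toFun (β r)) = WithBot.some (α := Rl) ((f.toFun (β r)).getD (0 : ℝ))
      rw [hy]; rfl

open Classical in
theorem isMor_ifz {G Y : Type} [WQbs G] [WQbs Y] (s u : G ⟶ω Y) :
    IsMor fun p : Rl × G => if p.1 = (0 : ℝ) then s p.2 else u p.2 := by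
  refine isMor_iff.2 ⟨fun c x hc => ?_, fun α hα => ?_⟩
  · have h1 : ∀ n, (c n).1 = x.1 := isSup_discrete (fun _ _ h => h) (isSup_prod.1 hc).1
    simp only [h1]
    by_cases h : x.1 = (0 : ℝ)
    · simp only [if_pos h]
      exact s.isMor.isSup (isSup_prod.1 hc).2
    · simp only [if_neg h]
      exact u.isMor.isSup (isSup_prod.1 hc).2
  · have hm : MeasurableSet ((fun r => (α r).1) ⁻¹' {(0 : ℝ)}) :=
      (hα.1 : Measurable (β := ℝ) fun r => (α r).1) (measurableSet_singleton 0)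
    exact rand_ite (s.isMor.2 _ hα.2) (u.isMor.2 _ hα.2) hm

open Classical in
/-- Branching on zero. -/
noncomputable def ifzH {G Y : Type} [WQbs G] [WQbs Y] (t : G ⟶ω T Rl) (s u : G ⟶ω T Y) :
    G ⟶ω T Y :=
  seqH t ⟨fun p => if p.1 = (0 : ℝ) then s p.2 else u p.2, isMor_ifz s u⟩

/-- Call-by-value application. -/
noncomputable def appH {G X Y : Type} [WQbs G] [WQbs X] [WQbs Y] (t : G ⟶ω T (X ⟶ω T Y)) (s : G ⟶ω T X) :
    G ⟶ω T Y :=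
  seqH t (seqH ⟨fun p => s p.2, s.isMor.comp isMor_snd⟩
    ⟨fun p => p.2.1 p.1, (isMor_fst.comp isMor_snd).app isMor_fst⟩)

/-- The space of environments. -/
noncomputable def Env : Ctx → Sp
  | [] => ⟨Unit⟩
  | τ :: Γ => ⟨τ.den × Env Γ⟩

/-- Looking up a variable. -/
noncomputable def Var.den : ∀ {Γ : Ctx} {τ : Ty 0}, Var Γ τ → (Env Γ ⟶ω τ.den)
  | τ :: Γ, _, .zero => (⟨fun γ => γ.1, isMor_fst⟩ : τ.den × Env Γ ⟶ω τ.den)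
  | σ :: Γ, τ, .succ x => (⟨fun γ => x.den γ.2, x.den.isMor.comp isMor_snd⟩ :
      σ.den × Env Γ ⟶ω τ.den)

/-- The denotation of terms. -/
noncomputable def Tm.den : ∀ {Γ : Ctx} {τ : Ty 0}, Tm ℝ Γ τ → (Env Γ ⟶ω T τ.den)
  | _, _, .var x => pureH x.den
  | Γ, _, .lit r => (pureH ⟨fun _ => (r : Rl), isMor_const _⟩ : Env Γ ⟶ω T Rl)
  | Γ, _, .prim f t => (seqH (argsH fun i => ((t i).den : Env Γ ⟶ω T Rl))
      ⟨fun p => T.ofLift (f.lift p.1), T.isMor_ofLift.comp (f.isMor_lift.comp isMor_fst)⟩ :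
      Env Γ ⟶ω T Rl)
  | Γ, _, .ifz t s u => ifzH (t.den : Env Γ ⟶ω T Rl) s.den u.den
  | Γ, _, .sample => (⟨fun _ => T.sample, isMor_const _⟩ : Env Γ ⟶ω T Rl)
  | Γ, _, .score t => (seqH (t.den : Env Γ ⟶ω T Rl)
      ⟨fun p => T.score p.1, T.isMor_score.comp isMor_fst⟩ : Env Γ ⟶ω T Unit)
  | Γ, _, .unit => (pureH ⟨fun _ => (), isMor_const _⟩ : Env Γ ⟶ω T Unit)
  | Γ, _, .pair (σ := σ) (τ := τ) t s => (seqH t.den (seqH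
      ⟨fun p => s.den p.2, s.den.isMor.comp isMor_snd⟩
      (pureH ⟨fun p => (p.2.1, p.1), (isMor_fst.comp isMor_snd).pair isMor_fst⟩)) :
      Env Γ ⟶ω T (σ.den × τ.den))
  | Γ, _, .inj (τ := τ) l t => (seqH t.den (pureH
      ⟨fun p => ⟨l, p.1⟩, (isMor_inj (P := fun l => (τ l).den) l).comp isMor_fst⟩) :
      Env Γ ⟶ω T (Σ l, (τ l).den))
  | _, _, .roll (τ := τ) t => seqH t.den (pureH
      ⟨fun p => τ.roll p.1, τ.roll.isMor.comp isMor_fst⟩)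
  | Γ, _, .lam (σ := σ) (τ := τ) t => (pureH
      ⟨fun γ => ⟨fun a => (t.den : σ.den × Env Γ ⟶ω T τ.den) (a, γ),
          t.den.isMor.comp (isMor_id.pair (isMor_const γ))⟩,
        IsMor.lam (t.den.isMor.comp (isMor_snd.pair isMor_fst))⟩ : Env Γ ⟶ω T (σ.den ⟶ω T τ.den))
  | Γ, _, .app (σ := σ) (τ := τ) t s => appH (t.den : Env Γ ⟶ω T (σ.den ⟶ω T τ.den)) s.den
  | _, _, .umatch t s => seqH t.den ⟨fun p => s.den p.2, s.den.isMor.comp isMor_snd⟩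
  | Γ, _, .pmatch (σ := σ) (ρ := ρ) (τ := τ) t s => seqH (t.den : Env Γ ⟶ω T (σ.den × ρ.den))
      ⟨fun p => (s.den : ρ.den × σ.den × Env Γ ⟶ω T τ.den) (p.1.2, p.1.1, p.2),
        s.den.isMor.comp ((isMor_snd.comp isMor_fst).pair
          ((isMor_fst.comp isMor_fst).pair isMor_snd))⟩
  | Γ, _, .vmatch (σ := σ) (τ := τ) t s => seqH (t.den : Env Γ ⟶ω T (Σ l, (σ l).den))
      ⟨fun p => ((s p.1.1).den : (σ p.1.1).den × Env Γ ⟶ω T τ.den) (p.1.2, p.2),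
        (IsMor.cotuple (P := fun l => (σ l).den) (g := fun l γ a =>
          ((s l).den : (σ l).den × Env Γ ⟶ω T τ.den) (a, γ))
          fun l => (s l).den.isMor.comp (isMor_snd.pair isMor_fst)).comp
          (isMor_snd.pair isMor_fst)⟩
  | Γ, _, .rmatch (σ := σ) (τ := τ) t s => seqH t.den
      ⟨fun p => (s.den : σ.unroll.den × Env Γ ⟶ω T τ.den) (σ.unrollHom p.1, p.2),
        s.den.isMor.comp ((σ.unrollHom.isMor.comp isMor_fst).pair isMor_snd)⟩

end SFPC

namespace SFPC

/-! ## Renaming, substitution and replacement of literals -/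

namespace Tm
variable {K K' K'' : Type}

/-! Filling a hole is monotone in the denotation of the term put into it (`PCtx.fill_den_le`), so
everything reduces to programs of type real: there, a larger denotation must give a larger
evaluation measure (`eval_le_eval`). For a measurable set U of values, its indicator is also a
weight function w on the denoted reals, and the chain is evalN n t U ≤ ⟦t⟧(w) ≤ ⟦s⟧(w) ≤ sup over k
of evalN (k+1) s U. The outer inequalities are soundness (`lintegral_evalN_le`) and computational
adequacy (`den_le_lintegral_evalN`).

Both are instances of one fundamental property, `LogRel.fundamental`. A relation between elements
and values is lifted to operators and sequences of measures by testing: whenever two weight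
functions are comparable on related pairs, their expectations are comparable (`Lifted`). A Boolean
chooses the direction of the comparison. The lifting is compatible with unit and bind, so one
induction on terms serves both directions.

For soundness a value is related to exactly the element it denotes, and the induction is on the
evaluation index (`lifted_evalN`). For adequacy the relation at function types must be a logical
one. In the presence of recursive types of mixed variance its defining clauses are circular. The
circle is cut by partial maps `proj n`, which let only finitely many nested unrollings through: at
level n the relation `rel n` is defined by recursion on n and, within a level, on the closed type
with recursive types as leaves. A value approximates an element if it is related to every defined
projection of it (`Approx`). The levels cohere by `rel_le`, and the passage from levels back to
elements, in particular for application (`approx_app`), rests on `isSup_proj`: the projections have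
the identity as supremum. This is the minimality of the bilimit solution of recursive domain
equations. It is obtained by bounding the action of every open type on maps that are themselves
bounded (`Below.subst`).

All of this needs evaluation to be genuine integration, hence measurable integrands. Since the
σ-algebra on values is a coproduct over uncountably many templates, joint measurability in two
values is not available from the product σ-algebra. What saves the argument is that terms and values
whose constants are measurable functions of a parameter evaluate to countable sums of images of
s-finite kernels (`Templated`, `templatedEval_evalN`), a class that is closed under every evaluation
rule. -/

theorem rename_rename : ∀ {Γ Δ Θ : Ctx} {τ : Ty 0} (t : Tm K Γ τ) (ρ : Ren Γ Δ) (ρ' : Ren Δ Θ),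
    (t.rename ρ).rename ρ' = t.rename fun _ x => ρ' _ (ρ _ x) := by
  have lift : ∀ {Γ Δ Θ : Ctx} (ρ : Ren Γ Δ) (ρ' : Ren Δ Θ) (σ : Ty 0),
      (fun τ x => ρ'.lift σ τ (ρ.lift σ τ x)) =
        Ren.lift (fun τ x => ρ' τ (ρ τ x)) σ := fun ρ ρ' σ => by
    funext τ x; cases x <;> rfl
  intro Γ Δ Θ τ t
  induction t generalizing Δ Θ <;> intro ρ ρ' <;> simp only [rename, *]

theorem rename_subst : ∀ {Γ Δ Θ : Ctx} {τ : Ty 0} (t : Tm K Γ τ) (ρ : Ren Γ Δ) (θ : Sub K Δ Θ),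
    (t.rename ρ).subst θ = t.subst fun _ x => θ _ (ρ _ x) := by
  have lift : ∀ {Γ Δ Θ : Ctx} (ρ : Ren Γ Δ) (θ : Sub K Δ Θ) (σ : Ty 0),
      (fun τ x => θ.lift σ τ (ρ.lift σ τ x)) =
        Sub.lift (fun τ x => θ τ (ρ τ x)) σ := fun ρ θ σ => by
    funext τ x; cases x <;> rfl
  intro Γ Δ Θ τ t
  induction t generalizing Δ Θ <;> intro ρ θ <;> simp only [rename, subst, *]

theorem subst_rename : ∀ {Γ Δ Θ : Ctx} {τ : Ty 0} (t : Tm K Γ τ) (θ : Sub K Γ Δ) (ρ : Ren Δ Θ),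
    (t.subst θ).rename ρ = t.subst fun _ x => (θ _ x).rename ρ := by
  have lift : ∀ {Γ Δ Θ : Ctx} (θ : Sub K Γ Δ) (ρ : Ren Δ Θ) (σ : Ty 0),
      (fun τ x => (θ.lift σ τ x).rename (ρ.lift σ)) =
        Sub.lift (fun τ x => (θ τ x).rename ρ) σ := fun θ ρ σ => by
    funext τ x
    cases x with
    | zero => rfl
    | succ x => simp only [Sub.lift, rename_rename]; rfl
  intro Γ Δ Θ τ t
  induction t generalizing Δ Θ <;> intro θ ρ <;> simp only [rename, subst, *]

theorem subst_subst : ∀ {Γ Δ Θ : Ctx} {τ : Ty 0} (t : Tm K Γ τ) (θ : Sub K Γ Δ) (θ' : Sub K Δ Θ),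
    (t.subst θ).subst θ' = t.subst fun _ x => (θ _ x).subst θ' := by
  have lift : ∀ {Γ Δ Θ : Ctx} (θ : Sub K Γ Δ) (θ' : Sub K Δ Θ) (σ : Ty 0),
      (fun τ x => (θ.lift σ τ x).subst (θ'.lift σ)) =
        Sub.lift (fun τ x => (θ τ x).subst θ') σ := fun θ θ' σ => by
    funext τ x
    cases x with
    | zero => rfl
    | succ x => simp only [Sub.lift, rename_subst, subst_rename]
  intro Γ Δ Θ τ t
  induction t generalizing Δ Θ <;> intro θ θ' <;> simp only [subst, *]

theorem subst_var : ∀ {Γ : Ctx} {τ : Ty 0} (t : Tm K Γ τ), t.subst (fun _ x => .var x) = t := by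
  have lift : ∀ {Γ : Ctx} (σ : Ty 0), Sub.lift (K := K) (fun τ (x : Var Γ τ) => .var x) σ =
      fun _ x => .var x := fun σ => by
    funext τ x; cases x <;> rfl
  intro Γ τ t
  induction t <;> simp only [subst, *]

theorem subst_nil {τ : Ty 0} (t : Tm K [] τ) (θ : Sub K [] []) : t.subst θ = t := by
  have : θ = fun _ x => .var x := by funext τ x; cases x
  rw [this, subst_var]

/-- Instantiating the variable of a binder after substituting under it. -/
theorem subst_lift_cons {Γ : Ctx} {σ τ : Ty 0} (t : Tm K (σ :: Γ) τ) (θ : Sub K Γ [])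
    (s : Tm K [] σ) : (t.subst (θ.lift σ)).subst (Sub.nil.cons s) = t.subst (θ.cons s) := by
  rw [subst_subst]
  congr 1
  funext τ x
  cases x with
  | zero => rfl
  | succ x => simp only [Sub.lift, rename_subst, subst_nil]; rfl

theorem subst_lift_lift_cons {Γ : Ctx} {σ ρ τ : Ty 0} (t : Tm K (ρ :: σ :: Γ) τ) (θ : Sub K Γ [])
    (s : Tm K [] σ) (s' : Tm K [] ρ) : (t.subst ((θ.lift σ).lift ρ)).subst
      ((Sub.nil.cons s).cons s') = t.subst ((θ.cons s).cons s') := by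
  rw [subst_subst]
  congr 1
  funext τ x
  cases x with
  | zero => rfl
  | succ x =>
    cases x with
    | zero => rfl
    | succ x => simp only [Sub.lift, rename_subst, subst_nil]; rfl

theorem map_map {Γ : Ctx} {τ : Ty 0} (t : Tm K Γ τ) (g : K → K') (g' : K' → K'') :
    (t.map g).map g' = t.map fun k => g' (g k) := by
  induction t <;> simp only [map, *]

theorem map_id {Γ : Ctx} {τ : Ty 0} (t : Tm K Γ τ) : (t.map fun k => k) = t := by
  induction t <;> simp only [map, *]

theorem map_rename {Γ : Ctx} {τ : Ty 0} (t : Tm K Γ τ) (g : K → K') :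
    ∀ {Δ : Ctx} (ρ : Ren Γ Δ), (t.rename ρ).map g = (t.map g).rename ρ := by
  induction t <;> intro Δ ρ <;> simp only [map, rename, *]

theorem map_subst {Γ : Ctx} {τ : Ty 0} (t : Tm K Γ τ) (g : K → K') :
    ∀ {Δ : Ctx} (θ : Sub K Γ Δ),
      (t.subst θ).map g = (t.map g).subst fun _ x => (θ _ x).map g := by
  have lift : ∀ {Γ Δ : Ctx} (θ : Sub K Γ Δ) (σ : Ty 0),
      Sub.lift (fun τ x => (θ τ x).map g) σ = fun τ x => (θ.lift σ τ x).map g := fun θ σ => by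
    funext τ x
    cases x with
    | zero => rfl
    | succ x => exact (map_rename _ g _).symm
  induction t <;> intro Δ θ <;> simp only [map, subst, *]

/-- Every term is an instance of a template with finitely many open constants. -/
theorem exists_template {Γ : Ctx} {τ : Ty 0} (t : Tm K Γ τ) :
    ∃ (I : Type) (_ : Finite I) (u : Tm I Γ τ) (g : I → K), t = u.map g := by
  induction t with
  | var x => exact ⟨Empty, inferInstance, var x, Empty.elim, rfl⟩
  | lit k => exact ⟨Unit, inferInstance, lit (), fun _ => k, rfl⟩
  | sample => exact ⟨Empty, inferInstance, sample, Empty.elim, rfl⟩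
  | unit => exact ⟨Empty, inferInstance, unit, Empty.elim, rfl⟩
  | prim f t ih =>
    choose I hI u g e using ih
    -- Subterms get disjoint sets of open constants, so that one assignment fills them all; the
    -- total stays finite because the arity is.
    refine ⟨Σ i, I i, inferInstance, prim f fun i => (u i).map (Sigma.mk i), fun p => g p.1 p.2, ?_⟩
    simp only [map, map_map, ← e]
  | score t ih =>
    obtain ⟨I, hI, u, g, e⟩ := ih
    exact ⟨I, hI, score u, g, by rw [map, e]⟩
  | inj l t ih =>
    obtain ⟨I, hI, u, g, e⟩ := ih
    exact ⟨I, hI, inj l u, g, by rw [map, e]⟩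
  | roll t ih =>
    obtain ⟨I, hI, u, g, e⟩ := ih
    exact ⟨I, hI, roll u, g, by rw [map, e]⟩
  | lam t ih =>
    obtain ⟨I, hI, u, g, e⟩ := ih
    exact ⟨I, hI, lam u, g, by rw [map, e]⟩
  | ifz t s s' ih ih' ih'' =>
    obtain ⟨I, hI, u, g, e⟩ := ih
    obtain ⟨I', hI', u', g', e'⟩ := ih'
    obtain ⟨I'', hI'', u'', g'', e''⟩ := ih''
    refine ⟨I ⊕ I' ⊕ I'', inferInstance, ifz (u.map .inl) (u'.map fun i => .inr (.inl i))
      (u''.map fun i => .inr (.inr i)), Sum.elim g (Sum.elim g' g''), ?_⟩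
    simp only [map, map_map, e, e', e'', Sum.elim_inl, Sum.elim_inr]
  | pair t s ih ih' =>
    obtain ⟨I, hI, u, g, e⟩ := ih
    obtain ⟨I', hI', u', g', e'⟩ := ih'
    refine ⟨I ⊕ I', inferInstance, pair (u.map .inl) (u'.map .inr), Sum.elim g g', ?_⟩
    simp only [map, map_map, e, e', Sum.elim_inl, Sum.elim_inr]
  | app t s ih ih' =>
    obtain ⟨I, hI, u, g, e⟩ := ih
    obtain ⟨I', hI', u', g', e'⟩ := ih'
    refine ⟨I ⊕ I', inferInstance, app (u.map .inl) (u'.map .inr), Sum.elim g g', ?_⟩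
    simp only [map, map_map, e, e', Sum.elim_inl, Sum.elim_inr]
  | umatch t s ih ih' =>
    obtain ⟨I, hI, u, g, e⟩ := ih
    obtain ⟨I', hI', u', g', e'⟩ := ih'
    refine ⟨I ⊕ I', inferInstance, umatch (u.map .inl) (u'.map .inr), Sum.elim g g', ?_⟩
    simp only [map, map_map, e, e', Sum.elim_inl, Sum.elim_inr]
  | pmatch t s ih ih' =>
    obtain ⟨I, hI, u, g, e⟩ := ih
    obtain ⟨I', hI', u', g', e'⟩ := ih'
    refine ⟨I ⊕ I', inferInstance, pmatch (u.map .inl) (u'.map .inr), Sum.elim g g', ?_⟩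
    simp only [map, map_map, e, e', Sum.elim_inl, Sum.elim_inr]
  | rmatch t s ih ih' =>
    obtain ⟨I, hI, u, g, e⟩ := ih
    obtain ⟨I', hI', u', g', e'⟩ := ih'
    refine ⟨I ⊕ I', inferInstance, rmatch (u.map .inl) (u'.map .inr), Sum.elim g g', ?_⟩
    simp only [map, map_map, e, e', Sum.elim_inl, Sum.elim_inr]
  | vmatch t s ih ih' =>
    obtain ⟨I, hI, u, g, e⟩ := ih
    choose I' hI' u' g' e' using ih'
    refine ⟨I ⊕ Σ l, I' l, inferInstance, vmatch (u.map .inl) fun l =>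
      (u' l).map fun i => .inr ⟨l, i⟩, Sum.elim g fun p => g' p.1 p.2, ?_⟩
    simp only [map, map_map, e, ← e', Sum.elim_inl, Sum.elim_inr]

end Tm

/-! ### Templates of values -/

namespace Val
variable {K K' K'' : Type}

theorem map_map {τ : Ty 0} (v : Val K τ) (g : K → K') (g' : K' → K'') :
    (v.map g).map g' = v.map fun k => g' (g k) := by
  induction v <;> simp only [map, Tm.map_map, *]

theorem map_id {τ : Ty 0} (v : Val K τ) : (v.map fun k => k) = v := by
  induction v <;> simp only [map, Tm.map_id, *]

theorem toTm_map {τ : Ty 0} (v : Val K τ) (g : K → K') : (v.map g).toTm = v.toTm.map g := by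
  induction v <;> simp only [map, toTm, Tm.map, *]

/-- Every value is an instance of a template with finitely many open constants. -/
theorem exists_template {τ : Ty 0} (v : Val K τ) :
    ∃ (n : ℕ) (u : Val (Fin n) τ) (g : Fin n → K), v = u.map g := by
  -- Arbitrary finite index types are closed under sums, which the induction uses; numbering the
  -- constants is left to the end.
  suffices h : ∃ (I : Type) (_ : Finite I) (u : Val I τ) (g : I → K), v = u.map g by
    obtain ⟨I, hI, u, g, rfl⟩ := h
    obtain ⟨n, ⟨e⟩⟩ := Finite.exists_equiv_fin I
    exact ⟨n, u.map e, fun i => g (e.symm i), by simp [map_map]⟩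
  induction v with
  | lit k => exact ⟨Unit, inferInstance, lit (), fun _ => k, rfl⟩
  | unit => exact ⟨Empty, inferInstance, unit, Empty.elim, rfl⟩
  | inj l t ih =>
    obtain ⟨I, hI, u, g, e⟩ := ih
    exact ⟨I, hI, inj l u, g, by rw [map, e]⟩
  | roll t ih =>
    obtain ⟨I, hI, u, g, e⟩ := ih
    exact ⟨I, hI, roll u, g, by rw [map, e]⟩
  | lam t =>
    obtain ⟨I, hI, u, g, e⟩ := t.exists_template
    exact ⟨I, hI, lam u, g, by rw [map, e]⟩
  | pair t s ih ih' =>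
    obtain ⟨I, hI, u, g, e⟩ := ih
    obtain ⟨I', hI', u', g', e'⟩ := ih'
    refine ⟨I ⊕ I', inferInstance, pair (u.map .inl) (u'.map .inr), Sum.elim g g', ?_⟩
    simp only [map, map_map, e, e', Sum.elim_inl, Sum.elim_inr]

end Val

open ProbabilityTheory (Kernel IsSFiniteKernel)
open scoped ProbabilityTheory

/-! ## Measurability of the operational semantics

A set that is measurable in `Val (σ * τ)` need not be measurable for the product of the
σ-algebras of `Val σ` and `Val τ`, since there are uncountably many templates. The measures that
arise from evaluation are, however, supported by countably many templates, uniformly in the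
constants of the term. -/

/-- Measurable real functions, used as literals of terms that depend on a parameter. -/
abbrev Meas (X : Type) [MeasurableSpace X] : Type := {f : X → ℝ // Measurable f}

section
variable {X Y Ω : Type} [MeasurableSpace X] [MeasurableSpace Y] [MeasurableSpace Ω]

/-- The instance of a parametrised term at a parameter. -/
def Tm.at {Γ : Ctx} {τ : Ty 0} (t : Tm (Meas X) Γ τ) (x : X) : Tm ℝ Γ τ := t.map fun f => f.1 x

/-- The instance of a parametrised value at a parameter. -/
def Val.at {τ : Ty 0} (v : Val (Meas X) τ) (x : X) : Val ℝ τ := v.map fun f => f.1 x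

/-- A term that does not depend on the parameter. -/
def Tm.const (X : Type) [MeasurableSpace X] {Γ : Ctx} {τ : Ty 0} (t : Tm ℝ Γ τ) :
    Tm (Meas X) Γ τ := t.map fun r => ⟨fun _ => r, measurable_const⟩

/-- A value that does not depend on the parameter. -/
def Val.const (X : Type) [MeasurableSpace X] {τ : Ty 0} (v : Val ℝ τ) :
    Val (Meas X) τ := v.map fun r => ⟨fun _ => r, measurable_const⟩

@[simp] theorem Tm.const_at {Γ : Ctx} {τ : Ty 0} (t : Tm ℝ Γ τ) (x : X) : (t.const X).at x = t :=
  (Tm.map_map _ _ _).trans (Tm.map_id _)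

@[simp] theorem Val.const_at {τ : Ty 0} (v : Val ℝ τ) (x : X) : (v.const X).at x = v :=
  (Val.map_map _ _ _).trans (Val.map_id _)

/-- Reparametrisation of terms. -/
def Tm.reparam {Γ : Ctx} {τ : Ty 0} (t : Tm (Meas X) Γ τ) {e : Y → X} (he : Measurable e) :
    Tm (Meas Y) Γ τ := t.map fun f => ⟨fun y => f.1 (e y), f.2.comp he⟩

/-- Reparametrisation of values. -/
def Val.reparam {τ : Ty 0} (v : Val (Meas X) τ) {e : Y → X} (he : Measurable e) :
    Val (Meas Y) τ := v.map fun f => ⟨fun y => f.1 (e y), f.2.comp he⟩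

@[simp] theorem Tm.reparam_at {Γ : Ctx} {τ : Ty 0} (t : Tm (Meas X) Γ τ) {e : Y → X}
    (he : Measurable e) (y : Y) : (t.reparam he).at y = t.at (e y) := Tm.map_map _ _ _

@[simp] theorem Val.reparam_at {τ : Ty 0} (v : Val (Meas X) τ) {e : Y → X}
    (he : Measurable e) (y : Y) : (v.reparam he).at y = v.at (e y) := Val.map_map _ _ _

theorem Val.measurableSet_iff {τ : Ty 0} {s : Set (Val ℝ τ)} : MeasurableSet s ↔
    ∀ (n : ℕ) (u : Val (Fin n) τ), MeasurableSet {r : Fin n → ℝ | u.map r ∈ s} := by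
  rw [MeasurableSpace.measurableSet_iInf]
  exact forall_congr' fun n => MeasurableSpace.measurableSet_iInf

/-- A parametrised value factors as a measurable map into some ℝⁿ followed by the filling of a
template, and the latter is measurable by definition of the σ-algebra. -/
theorem Val.measurable_at {τ : Ty 0} (v : Val (Meas X) τ) : Measurable v.at := by
  obtain ⟨n, u, g, rfl⟩ := v.exists_template
  intro s hs
  have h : Measurable fun (x : X) (i : Fin n) => (g i).1 x := measurable_pi_lambda _ fun i => (g i).2
  convert h (Val.measurableSet_iff.1 hs n u) using 1
  ext x
  simp [Val.at, Val.map_map]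

/-- The σ-algebra is final for the template fillings, and each filling is a parametrised value over
ℝⁿ whose constants are the coordinate functions. -/
theorem Val.measurable_of_at {Z : Type} [MeasurableSpace Z] {τ : Ty 0} {f : Val ℝ τ → Z}
    (h : ∀ (n : ℕ) (u : Val (Meas (Fin n → ℝ)) τ), Measurable fun x => f (u.at x)) :
    Measurable f := by
  refine fun s hs => Val.measurableSet_iff.2 fun n u => ?_
  convert h n (u.map fun i => ⟨fun x => x i, measurable_pi_apply i⟩) hs using 1
  ext x
  simp [Val.at, Val.map_map]

theorem Val.measurable_lit : Measurable (Val.lit (K := ℝ)) :=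
  Val.measurable_at (.lit ⟨fun x : ℝ => x, measurable_id⟩)

/-! ### Families of measures with countably many templates -/

/-- An s-finite kernel into a space of parameters together with a value in these parameters. -/
structure Piece (Ω : Type) [MeasurableSpace Ω] (τ : Ty 0) where
  param : Type
  [space : MeasurableSpace param]
  kernel : Kernel Ω param
  [sfinite : IsSFiniteKernel kernel]
  value : Val (Meas param) τ

attribute [instance] Piece.space Piece.sfinite

/-- The measures on values given by a piece. -/
noncomputable def Piece.measure {τ : Ty 0} (p : Piece Ω τ) (ω : Ω) : Measure (Val ℝ τ) :=
  (p.kernel ω).map p.value.at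

theorem Piece.measure_apply {τ : Ty 0} (p : Piece Ω τ) (ω : Ω) {s : Set (Val ℝ τ)}
    (hs : MeasurableSet s) : p.measure ω s = p.kernel ω (p.value.at ⁻¹' s) :=
  Measure.map_apply p.value.measurable_at hs

/-- A family of measures on values that is a countable sum of images of s-finite kernels under
parametrised values. -/
def Templated {τ : Ty 0} (κ : Ω → Measure (Val ℝ τ)) : Prop :=
  ∃ (ι : Type) (_ : Countable ι) (p : ι → Piece Ω τ), ∀ ω, κ ω = Measure.sum fun i => (p i).measure ω

/-- A parametrised function from values to measures that turns parametrised values into families of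
measures with countably many templates. -/
def TemplatedFun {σ τ : Ty 0} (K : Ω → Val ℝ σ → Measure (Val ℝ τ)) : Prop :=
  ∀ ⦃X : Type⦄ [MeasurableSpace X] (f : X → Ω), Measurable f → ∀ u : Val (Meas X) σ,
    Templated fun x => K (f x) (u.at x)

variable {σ τ ρ : Ty 0}

theorem Templated.of_kernel (η : Kernel Ω X) [IsSFiniteKernel η] (u : Val (Meas X) τ) :
    Templated fun ω => (η ω).map u.at :=
  ⟨Unit, inferInstance, fun _ => ⟨X, η, u⟩, fun ω => by ext s hs; simp [Piece.measure]⟩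

theorem Templated.zero : Templated fun _ : Ω => (0 : Measure (Val ℝ τ)) :=
  ⟨Empty, inferInstance, fun i => i.elim, fun ω => by ext s hs; simp⟩

theorem Templated.dirac (u : Val (Meas Ω) τ) : Templated fun ω => Measure.dirac (u.at ω) := by
  convert Templated.of_kernel (Kernel.id (α := Ω)) u using 2 with ω
  rw [Kernel.id_apply, Measure.map_dirac' u.measurable_at]

/-- Countability of the family of pieces is what makes the sum of their measurable masses
measurable. -/
theorem Templated.measurable {κ : Ω → Measure (Val ℝ τ)} (h : Templated κ) : Measurable κ := by
  obtain ⟨ι, _, p, e⟩ := h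
  refine Measure.measurable_of_measurable_coe _ fun s hs => ?_
  simp only [e, Measure.sum_apply _ hs, Piece.measure_apply _ _ hs]
  exact Measurable.tsum fun i => (p i).kernel.measurable_coe ((p i).value.measurable_at hs)

theorem Templated.comp {κ : Ω → Measure (Val ℝ τ)} (h : Templated κ) {f : X → Ω}
    (hf : Measurable f) : Templated fun x => κ (f x) := by
  obtain ⟨ι, _, p, e⟩ := h
  exact ⟨ι, inferInstance, fun i => ⟨(p i).param, (p i).kernel.comap f hf, (p i).value⟩,
    fun x => by simp only [e, Piece.measure, Kernel.comap_apply]⟩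

-- Each kernel is replaced by zero on the wrong side of the set, and the two families of pieces are
-- put side by side.
open Classical in
theorem Templated.ite {κ κ' : Ω → Measure (Val ℝ τ)} (h : Templated κ) (h' : Templated κ')
    {s : Set Ω} (hs : MeasurableSet s) : Templated fun ω => if ω ∈ s then κ ω else κ' ω := by
  obtain ⟨ι, _, p, e⟩ := h
  obtain ⟨ι', _, p', e'⟩ := h'
  have h1 : ∀ i, (⟨(p i).param, (p i).kernel.piecewise hs 0, (p i).value⟩ : Piece Ω τ).measure =
      fun ω => if ω ∈ s then (p i).measure ω else 0 := fun i => by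
    funext ω
    change Measure.map _ ((p i).kernel.piecewise hs 0 ω) = _
    rw [Kernel.piecewise_apply]
    split_ifs <;> simp [Piece.measure]
  have h2 : ∀ i, (⟨(p' i).param, Kernel.piecewise hs 0 (p' i).kernel, (p' i).value⟩ :
      Piece Ω τ).measure = fun ω => if ω ∈ s then 0 else (p' i).measure ω := fun i => by
    funext ω
    change Measure.map _ (Kernel.piecewise hs 0 (p' i).kernel ω) = _
    rw [Kernel.piecewise_apply]
    split_ifs <;> simp [Piece.measure]
  refine ⟨ι ⊕ ι', inferInstance, Sum.elim
    (fun i => ⟨(p i).param, (p i).kernel.piecewise hs 0, (p i).value⟩)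
    (fun i => ⟨(p' i).param, Kernel.piecewise hs 0 (p' i).kernel, (p' i).value⟩), fun ω => ?_⟩
  ext a ha
  rw [Measure.sum_apply _ ha, ENNReal.summable.tsum_sum ENNReal.summable]
  simp only [Sum.elim_inl, Sum.elim_inr, h1, h2]
  split_ifs
  · simp [e, Measure.sum_apply _ ha]
  · simp [e', Measure.sum_apply _ ha]

/-- Measurability may be tested along parametrised values, where it is that of a templated family.
This supplies the integrands for all binds below. -/
theorem TemplatedFun.measurable {K : Ω → Val ℝ σ → Measure (Val ℝ τ)} (h : TemplatedFun K)
    (ω : Ω) : Measurable (K ω) :=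
  Val.measurable_of_at fun _ u => (h (fun _ => ω) measurable_const u).measurable

/-- On a single piece of κ the value is a parametrised value over Ω and the parameters of that
piece, so the continuation again splits into countably many pieces. Composing the two kernels and
keeping the last parameter gives a doubly indexed, still countable, family; no joint measurability
in values is ever used. -/
theorem Templated.bind {κ : Ω → Measure (Val ℝ σ)} (h : Templated κ)
    {K : Ω → Val ℝ σ → Measure (Val ℝ τ)} (hK : TemplatedFun K) :
    Templated fun ω => (κ ω).bind (K ω) := by
  obtain ⟨ι, _, p, e⟩ := h
  -- The parameters of the piece join Ω, since the continuation depends on both.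
  have h' := fun i => hK (X := Ω × (p i).param) Prod.fst measurable_fst
    ((p i).value.reparam measurable_snd)
  choose ι' hι' q e' using h'
  refine ⟨Σ i, ι' i, inferInstance, fun j => ⟨(q j.1 j.2).param,
    ((p j.1).kernel ⊗ₖ (q j.1 j.2).kernel).snd, (q j.1 j.2).value⟩, fun ω => ?_⟩
  simp only [Val.reparam_at] at e'
  ext s hs
  have hm := fun i j => (q i j).value.measurable_at hs
  rw [Measure.bind_apply hs (hK.measurable ω).aemeasurable, Measure.sum_apply _ hs,
    ENNReal.tsum_sigma', e, lintegral_sum_measure]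
  refine tsum_congr fun i => ?_
  rw [Piece.measure, lintegral_map (f := fun v => K ω v s)
    ((Measure.measurable_coe hs).comp (hK.measurable ω)) (p i).value.measurable_at]
  have h1 : ∀ x, K ω ((p i).value.at x) s =
      ∑' j, (q i j).kernel (ω, x) ((q i j).value.at ⁻¹' s) := fun x => by
    have := e' i (ω, x)
    dsimp only at this
    rw [this, Measure.sum_apply _ hs]
    exact tsum_congr fun j => Piece.measure_apply _ _ hs
  simp only [h1]
  rw [lintegral_tsum (f := fun j x => (q i j).kernel (ω, x) ((q i j).value.at ⁻¹' s))
    fun j => (((q i j).kernel.measurable_coe (hm i j)).comp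
    measurable_prodMk_left).aemeasurable]
  refine tsum_congr fun j => ?_
  rw [Piece.measure_apply _ _ hs, Kernel.snd_apply' _ _ (hm i j),
    Kernel.compProd_apply (measurable_snd (hm i j))]
  rfl

/-! ### Evaluation -/

/-- Evaluators whose measures have countably many templates, uniformly in the constants. -/
def TemplatedEval (ev : ∀ τ : Ty 0, Tm ℝ [] τ → Measure (Val ℝ τ)) : Prop :=
  ∀ ⦃Ω : Type⦄ [MeasurableSpace Ω] ⦃τ : Ty 0⦄ (t : Tm (Meas Ω) [] τ),
    Templated fun ω => ev τ (t.at ω)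

/-- A parametrised value of type real can only be a literal, that is, a measurable real function of
the parameter. -/
theorem templatedFun_real {k : Ω → ℝ → Measure (Val ℝ τ)}
    (hk : ∀ ⦃X : Type⦄ [MeasurableSpace X] (f : X → Ω) (r : X → ℝ), Measurable f → Measurable r →
      Templated fun x => k (f x) (r x)) : TemplatedFun fun ω v => k ω v.real := by
  intro X _ f hf u
  cases u with
  | lit r => exact hk f r.1 hf r.2

/-- Reweighting is a density on the identity kernel; it stays s-finite because the density is
nowhere infinite. -/
theorem templated_score {r : Ω → ℝ} (hr : Measurable r) :
    Templated fun ω => ENNReal.ofReal |r ω| • Measure.dirac (Val.unit (K := ℝ)) := by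
  have hm : Measurable (Function.uncurry fun (ω : Ω) (_ : Ω) => ENNReal.ofReal |r ω|) :=
    ENNReal.measurable_ofReal.comp (hr.comp measurable_fst).abs
  have := Kernel.IsSFiniteKernel.withDensity (Kernel.id (α := Ω)) (f := fun ω _ => ENNReal.ofReal |r ω|)
    fun _ _ => ENNReal.ofReal_ne_top
  convert Templated.of_kernel (Kernel.withDensity (Kernel.id (α := Ω))
    fun ω _ => ENNReal.ofReal |r ω|) .unit using 2 with ω
  have h1 : ((.unit : Val (Meas Ω) .unit).at) = fun _ => (.unit : Val ℝ .unit) := rfl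
  ext s hs
  rw [Kernel.withDensity_apply _ hm, Kernel.id_apply, h1, Measure.map_const,
    withDensity_apply _ MeasurableSet.univ]
  simp

theorem templated_prim {n : ℕ} (f : Prim n) {r : Ω → Fin n → ℝ} (hr : Measurable r) :
    Templated fun ω => (f.toFun (r ω)).elim 0 fun y => Measure.dirac (Val.lit y) := by
  have hs : ∀ s, MeasurableSet s → MeasurableSet {ω | ∃ y ∈ s, f.toFun (r ω) = some y} :=
    fun s hs => hr (f.measurable s hs)
  have hd := hs _ MeasurableSet.univ
  -- The default 0 outside the domain is arbitrary: there the resulting Dirac measure is cut down to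
  -- zero.
  have hg : Measurable fun ω => (f.toFun (r ω)).getD 0 := by
    intro s hs'
    have h : (fun ω => (f.toFun (r ω)).getD 0) ⁻¹' s = {ω | ∃ y ∈ s, f.toFun (r ω) = some y} ∪
        ({ω | ∃ y ∈ Set.univ, f.toFun (r ω) = some y}ᶜ ∩ {_ω | (0 : ℝ) ∈ s}) := by
      ext ω
      simp only [Set.mem_preimage, Set.mem_union, Set.mem_inter_iff, Set.mem_compl_iff,
        Set.mem_ofPred_eq]
      cases f.toFun (r ω) <;> simp
    rw [h]
    exact (hs s hs').union (hd.compl.inter (MeasurableSet.const _))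
  convert (Templated.dirac (.lit ⟨_, hg⟩)).ite Templated.zero hd using 2 with ω
  cases h : f.toFun (r ω) with
  | none => simp [h]
  | some y => simp [h, Val.at, Val.map]

/-- Each evaluated argument becomes part of the parameter on which the remaining evaluation depends,
so the induction must let the parameter space vary. -/
theorem Templated.evalArgs {n : ℕ} {m : Ω → Fin n → Measure (Val ℝ .real)}
    (hm : ∀ i, Templated fun ω => m ω i) {k : Ω → (Fin n → ℝ) → Measure (Val ℝ τ)}
    (hk : ∀ ⦃X : Type⦄ [MeasurableSpace X] (f : X → Ω) (r : X → Fin n → ℝ), Measurable f →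
      Measurable r → Templated fun x => k (f x) (r x)) :
    Templated fun ω => SFPC.evalArgs (m ω) (k ω) := by
  induction n generalizing Ω with
  | zero => exact hk (fun ω => ω) (fun _ i => i.elim0) measurable_id measurable_const
  | succ n ih =>
    refine (hm 0).bind (templatedFun_real (k := fun ω v =>
      SFPC.evalArgs (fun i => m ω i.succ) fun r => k ω (Fin.cons v r)) fun X _ f r hf hr => ?_)
    refine ih (m := fun x i => m (f x) i.succ) (k := fun x r' => k (f x) (Fin.cons (r x) r'))
      (fun i => (hm i.succ).comp hf) fun Y _ g r' hg hr' => ?_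
    refine hk (fun y => f (g y)) (fun y => Fin.cons (r (g y)) (r' y)) (hf.comp hg)
      (measurable_pi_lambda _ fun i => ?_)
    cases i using Fin.cases with
    | zero => exact hr.comp hg
    | succ i => exact (measurable_pi_apply i).comp hr'

variable {ev : ∀ τ : Ty 0, Tm ℝ [] τ → Measure (Val ℝ τ)}

/-- The first component is absorbed into the parameters before the second one is drawn; this
replaces the joint measurability of pairing. -/
theorem templatedFun_pair {κ : Ω → Measure (Val ℝ τ)} (h : Templated κ) :
    TemplatedFun fun ω (v : Val ℝ σ) => (κ ω).bind fun w => Measure.dirac (.pair v w) := by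
  intro X _ f hf u
  refine (h.comp hf).bind (K := fun x w => Measure.dirac (.pair (u.at x) w)) fun Y _ g hg u' => ?_
  simp only [← Val.reparam_at _ hg]
  exact Templated.dirac (.pair (u.reparam hg) u')

theorem templatedFun_pair_right (v : Ω → Val ℝ σ) (u : Val (Meas Ω) σ) (hu : ∀ ω, v ω = u.at ω) :
    TemplatedFun fun ω (w : Val ℝ τ) => Measure.dirac (.pair (v ω) w) := fun X _ f hf u' => by
  simp only [hu, ← Val.reparam_at _ hf]
  exact Templated.dirac (.pair (u.reparam hf) u')

theorem templatedFun_inj {L : Finset ℕ} {σ : {l // l ∈ L} → Ty 0} (l : {l // l ∈ L}) :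
    TemplatedFun fun (_ : Ω) (v : Val ℝ (σ l)) => Measure.dirac (Val.inj (τ := σ) l v) :=
  fun _ _ _ _ u => Templated.dirac (.inj l u)

theorem templatedFun_roll {σ : Ty 1} :
    TemplatedFun fun (_ : Ω) (v : Val ℝ σ.unroll) => Measure.dirac (Val.roll v) :=
  fun _ _ _ _ u => Templated.dirac (.roll u)

open Classical in
theorem templatedFun_ifz {κ κ' : Ω → Measure (Val ℝ τ)} (h : Templated κ) (h' : Templated κ') :
    TemplatedFun fun ω (v : Val ℝ .real) => if v.real = 0 then κ ω else κ' ω :=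
  templatedFun_real (k := fun ω r => if r = 0 then κ ω else κ' ω) fun _ _ _ _ hf hr =>
    (h.comp hf).ite (h'.comp hf) (hr (measurableSet_singleton 0))

theorem templatedFun_score : TemplatedFun fun (_ : Ω) (v : Val ℝ .real) =>
    ENNReal.ofReal |v.real| • Measure.dirac (Val.unit (K := ℝ)) :=
  templatedFun_real (k := fun _ r => ENNReal.ofReal |r| • Measure.dirac (Val.unit (K := ℝ)))
    fun _ _ _ _ _ hr => templated_score hr

theorem templated_sample : Templated fun _ : Ω => (volume.restrict (Set.Icc (0 : ℝ) 1)).bind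
    fun r => Measure.dirac (Val.lit r) := by
  convert Templated.of_kernel (Kernel.const Ω (volume.restrict (Set.Icc (0 : ℝ) 1)))
    (.lit ⟨fun r : ℝ => r, measurable_id⟩) using 2 with ω
  rw [Kernel.const_apply]
  exact Measure.bind_dirac_eq_map _ Val.measurable_lit

/-- Substitution commutes with instantiating the parameter, so the substituted terms are again the
instances of one parametrised term. -/
theorem TemplatedEval.subst (hev : TemplatedEval ev) {Γ : Ctx} (b : Tm (Meas Ω) Γ τ)
    (θ : Sub (Meas Ω) Γ []) : Templated fun ω => ev τ ((b.at ω).subst fun _ x => (θ _ x).at ω) := by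
  simpa only [Tm.at, ← Tm.map_subst] using hev (b.subst θ)

theorem TemplatedEval.cons (hev : TemplatedEval ev) (b : Tm (Meas Ω) [σ] τ) (u : Val (Meas Ω) σ) :
    Templated fun ω => ev τ ((b.at ω).subst (Sub.nil.cons (u.at ω).toTm)) := by
  convert hev.subst b (Sub.nil.cons u.toTm) using 4 with ω
  funext τ x
  cases x with
  | zero => exact Val.toTm_map u _
  | succ x => cases x

theorem TemplatedEval.app_right (hev : TemplatedEval ev) (b : Tm (Meas Ω) [σ] τ) :
    TemplatedFun fun ω (v : Val ℝ σ) => ev τ ((b.at ω).subst (Sub.nil.cons v.toTm)) :=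
  fun X _ f hf u => by
    simpa only [Tm.reparam_at] using hev.cons (b.reparam hf) u

/-- A parametrised function value is an abstraction with a parametrised body. This is why parameters
must be allowed inside terms and not only in first-order values. -/
theorem TemplatedEval.app (hev : TemplatedEval ev) {κ : Ω → Measure (Val ℝ σ)} (h : Templated κ) :
    TemplatedFun fun ω (f : Val ℝ (.arrow σ τ)) => (κ ω).bind fun v =>
      ev τ (f.body.subst (Sub.nil.cons v.toTm)) := by
  intro X _ f hf u
  cases u with
  | lam b => exact (h.comp hf).bind (hev.app_right b)

theorem TemplatedEval.pmatch (hev : TemplatedEval ev) (b : Tm (Meas Ω) [ρ, σ] τ) :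
    TemplatedFun fun ω (v : Val ℝ (.prod σ ρ)) =>
      ev τ ((b.at ω).subst ((Sub.nil.cons v.fst.toTm).cons v.snd.toTm)) := by
  intro X _ f hf u
  cases u with
  | pair u u' =>
    convert hev.subst (b.reparam hf) ((Sub.nil.cons u.toTm).cons u'.toTm) using 3 with x
    rw [Tm.reparam_at]
    congr 1
    funext τ y
    cases y with
    | zero => exact Val.toTm_map u' _
    | succ y =>
      cases y with
      | zero => exact Val.toTm_map u _
      | succ y => cases y

theorem TemplatedEval.vmatch (hev : TemplatedEval ev) {L : Finset ℕ} {σ : {l // l ∈ L} → Ty 0}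
    (b : ∀ l, Tm (Meas Ω) [σ l] τ) : TemplatedFun fun ω (v : Val ℝ (.variant L σ)) =>
      ev τ (((b v.label).at ω).subst (Sub.nil.cons v.content.toTm)) := by
  intro X _ f hf u
  cases u with
  | inj l u => exact hev.app_right (b l) f hf u

theorem TemplatedEval.rmatch (hev : TemplatedEval ev) {σ : Ty 1} (b : Tm (Meas Ω) [σ.unroll] τ) :
    TemplatedFun fun ω (v : Val ℝ (.mu σ)) =>
      ev τ ((b.at ω).subst (Sub.nil.cons v.unroll.toTm)) := by
  intro X _ f hf u
  cases u with
  | roll u => exact hev.app_right b f hf u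

/-- Immediate subterms are handled by structural induction, bodies with substituted values by the
assumption on the given evaluator. -/
theorem TemplatedEval.evalStep (hev : TemplatedEval ev) {Γ : Ctx} (h : Γ = [])
    (t : Tm (Meas Ω) Γ τ) : Templated fun ω => SFPC.evalStep ev h (t.at ω) := by
  induction t with
  | var x => subst h; cases x
  | lit r => exact Templated.dirac (.lit r)
  | prim f t ih =>
    exact Templated.evalArgs (fun i => ih i h) fun X _ g r _ hr => templated_prim f hr
  | ifz t s u iht ihs ihu => exact (iht h).bind (templatedFun_ifz (ihs h) (ihu h))
  | sample => exact templated_sample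
  | score t ih => exact (ih h).bind templatedFun_score
  | unit => exact Templated.dirac .unit
  | pair t s iht ihs => exact (iht h).bind (templatedFun_pair (ihs h))
  | inj l t ih => exact (ih h).bind (templatedFun_inj l)
  | roll t ih => exact (ih h).bind templatedFun_roll
  | lam t ih => subst h; exact Templated.dirac (.lam t)
  | app t s iht ihs => exact (iht h).bind (hev.app (ihs h))
  | umatch t s iht ihs => exact (iht h).bind fun X _ f hf u => (ihs h).comp hf
  | pmatch t s iht ihs => subst h; exact (iht rfl).bind (hev.pmatch s)
  | vmatch t s iht ihs => subst h; exact (iht rfl).bind (hev.vmatch s)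
  | rmatch t s iht ihs => subst h; exact (iht rfl).bind (hev.rmatch s)

theorem templatedEval_evalN : ∀ n, TemplatedEval (evalN n)
  | 0 => fun _ _ _ _ => Templated.zero
  | n + 1 => fun _ _ _ t => (templatedEval_evalN n).evalStep rfl t

end

/-! ### The integrands of the evaluation rules -/

/-- A single term is a parametrised term over one point. From here on only measurability of
integrands is extracted from the templates. -/
theorem templated_const {τ : Ty 0} {ev : ∀ τ : Ty 0, Tm ℝ [] τ → Measure (Val ℝ τ)}
    (hev : TemplatedEval ev) (t : Tm ℝ [] τ) : Templated fun _ : Unit => evalStep ev rfl t := by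
  simpa only [Tm.const_at] using hev.evalStep rfl (t.const Unit)

/-- Continuations of argument lists that can be integrated. -/
def TemplatedArgs {τ : Ty 0} {n : ℕ} (k : (Fin n → ℝ) → Measure (Val ℝ τ)) : Prop :=
  ∀ ⦃X : Type⦄ [MeasurableSpace X] (r : X → Fin n → ℝ), Measurable r → Templated fun x => k (r x)

theorem TemplatedArgs.cons {τ : Ty 0} {n : ℕ} {k : (Fin (n + 1) → ℝ) → Measure (Val ℝ τ)}
    (hk : TemplatedArgs k) (v : ℝ) : TemplatedArgs fun r => k (Fin.cons v r) := fun X _ r hr =>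
  hk (fun x => Fin.cons v (r x)) (measurable_pi_lambda _ fun i => by
    cases i using Fin.cases with
    | zero => exact measurable_const
    | succ i => exact (measurable_pi_apply i).comp hr)

theorem TemplatedArgs.measurable {τ : Ty 0} {n : ℕ} {m : Fin n → Measure (Val ℝ .real)}
    (hm : ∀ i, Templated fun _ : Unit => m i) {k : (Fin (n + 1) → ℝ) → Measure (Val ℝ τ)}
    (hk : TemplatedArgs k) :
    Measurable fun v : Val ℝ .real => evalArgs m fun r => k (Fin.cons v.real r) :=
  (templatedFun_real (Ω := Unit) (k := fun _ v => evalArgs m fun r => k (Fin.cons v r))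
    fun X _ f r hf hr => Templated.evalArgs (Ω := X) (m := fun _ => m)
      (k := fun x r' => k (Fin.cons (r x) r')) (fun i => (hm i).comp (f := fun _ => ())
        measurable_const) fun Y _ g r' hg hr' =>
        hk (fun y => Fin.cons (r (g y)) (r' y)) (measurable_pi_lambda _ fun i => by
          cases i using Fin.cases with
          | zero => exact hr.comp hg
          | succ i => exact (measurable_pi_apply i).comp hr')).measurable ()

namespace TemplatedEval
variable {ev : ∀ τ : Ty 0, Tm ℝ [] τ → Measure (Val ℝ τ)} {σ τ ρ : Ty 0}

theorem measurable_pair (hev : TemplatedEval ev) (s : Tm ℝ [] τ) : Measurable fun v : Val ℝ σ =>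
    (SFPC.evalStep ev rfl s).bind fun w => Measure.dirac (Val.pair v w) :=
  (templatedFun_pair (templated_const hev s)).measurable ()

open Classical in
theorem measurable_ifz (hev : TemplatedEval ev) (s u : Tm ℝ [] τ) : Measurable fun v : Val ℝ .real =>
    if v.real = 0 then SFPC.evalStep ev rfl s else SFPC.evalStep ev rfl u :=
  (templatedFun_ifz (templated_const hev s) (templated_const hev u)).measurable ()

theorem measurable_cons (hev : TemplatedEval ev) (b : Tm ℝ [σ] τ) : Measurable fun v : Val ℝ σ =>
    ev τ (b.subst (Sub.nil.cons v.toTm)) := by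
  simpa only [Tm.const_at] using (hev.app_right (b.const Unit)).measurable ()

theorem measurable_app (hev : TemplatedEval ev) (s : Tm ℝ [] σ) : Measurable fun f : Val ℝ (.arrow σ τ) =>
    (SFPC.evalStep ev rfl s).bind fun v => ev τ (f.body.subst (Sub.nil.cons v.toTm)) :=
  (hev.app (templated_const hev s)).measurable ()

theorem measurable_pmatch (hev : TemplatedEval ev) (b : Tm ℝ [ρ, σ] τ) : Measurable fun v : Val ℝ (.prod σ ρ) =>
    ev τ (b.subst ((Sub.nil.cons v.fst.toTm).cons v.snd.toTm)) := by
  simpa only [Tm.const_at] using (hev.pmatch (b.const Unit)).measurable ()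

theorem measurable_vmatch (hev : TemplatedEval ev) {L : Finset ℕ} {σ : {l // l ∈ L} → Ty 0} (b : ∀ l, Tm ℝ [σ l] τ) :
    Measurable fun v : Val ℝ (.variant L σ) =>
      ev τ ((b v.label).subst (Sub.nil.cons v.content.toTm)) := by
  simpa only [Tm.const_at] using (hev.vmatch fun l => (b l).const Unit).measurable ()

theorem measurable_rmatch (hev : TemplatedEval ev) {σ : Ty 1} (b : Tm ℝ [σ.unroll] τ) : Measurable fun v : Val ℝ (.mu σ) =>
    ev τ (b.subst (Sub.nil.cons v.unroll.toTm)) := by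
  simpa only [Tm.const_at] using (hev.rmatch (b.const Unit)).measurable ()

end TemplatedEval

theorem measurable_dirac_pair {σ τ : Ty 0} (v : Val ℝ σ) :
    Measurable fun w : Val ℝ τ => Measure.dirac (Val.pair v w) :=
  (templatedFun_pair_right (Ω := Unit) (fun _ => v) (v.const Unit) (by simp)).measurable ()

theorem measurable_dirac_inj {L : Finset ℕ} {τ : {l // l ∈ L} → Ty 0} (l : {l // l ∈ L}) :
    Measurable fun v : Val ℝ (τ l) => Measure.dirac (Val.inj (τ := τ) l v) :=
  (templatedFun_inj (Ω := Unit) l).measurable ()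

theorem measurable_dirac_roll {τ : Ty 1} :
    Measurable fun v : Val ℝ τ.unroll => Measure.dirac (Val.roll v) :=
  (templatedFun_roll (Ω := Unit)).measurable ()

theorem measurable_smul_unit : Measurable fun v : Val ℝ .real =>
    ENNReal.ofReal |v.real| • Measure.dirac (Val.unit (K := ℝ)) :=
  (templatedFun_score (Ω := Unit)).measurable ()

theorem templatedArgs_prim {n : ℕ} (f : Prim n) :
    TemplatedArgs fun r => (f.toFun r).elim 0 fun y => Measure.dirac (Val.lit y) :=
  fun _ _ _ hr => templated_prim f hr

/-! ### Monotonicity of evaluation -/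

/-- Both integrands must be measurable, for only then is a bind computed by integrating. -/
theorem bind_mono {A B : Type} [MeasurableSpace A] [MeasurableSpace B] {ν ν' : Measure A}
    {g g' : A → Measure B} (h : ν ≤ ν') (hg : ∀ a, g a ≤ g' a) (hm : Measurable g)
    (hm' : Measurable g') : ν.bind g ≤ ν'.bind g' := by
  refine Measure.le_iff.2 fun s hs => ?_
  rw [Measure.bind_apply hs hm.aemeasurable, Measure.bind_apply hs hm'.aemeasurable]
  exact lintegral_mono' h fun a => hg a s

theorem evalArgs_mono {τ : Ty 0} {n : ℕ} {m m' : Fin n → Measure (Val ℝ .real)}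
    (h : ∀ i, m i ≤ m' i) (hm : ∀ i, Templated fun _ : Unit => m i)
    (hm' : ∀ i, Templated fun _ : Unit => m' i) {k : (Fin n → ℝ) → Measure (Val ℝ τ)}
    (hk : TemplatedArgs k) : evalArgs m k ≤ evalArgs m' k := by
  induction n with
  | zero => exact le_rfl
  | succ n ih =>
    exact bind_mono (h 0) (fun v => ih (fun i => h i.succ) (fun i => hm i.succ)
      (fun i => hm' i.succ) (hk.cons v.real)) (hk.measurable fun i => hm i.succ)
      (hk.measurable fun i => hm' i.succ)

/-- Every rule is built from binds, so this makes evaluation increase with the index. -/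
theorem evalStep_mono {ev ev' : ∀ τ : Ty 0, Tm ℝ [] τ → Measure (Val ℝ τ)}
    (hev : TemplatedEval ev) (hev' : TemplatedEval ev') (hle : ∀ τ t, ev τ t ≤ ev' τ t)
    {Γ : Ctx} {τ : Ty 0} (h : Γ = []) (t : Tm ℝ Γ τ) : evalStep ev h t ≤ evalStep ev' h t := by
  induction t with subst h
  | var x => cases x
  | lit r => exact le_rfl
  | prim f t ih =>
    exact evalArgs_mono (fun i => ih i rfl) (fun i => templated_const hev (t i))
      (fun i => templated_const hev' (t i)) (templatedArgs_prim f)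
  | ifz t s u iht ihs ihu =>
    refine bind_mono (iht rfl) (fun v => ?_) (hev.measurable_ifz s u) (hev'.measurable_ifz s u)
    split_ifs
    · exact ihs rfl
    · exact ihu rfl
  | sample => exact le_rfl
  | score t ih =>
    exact bind_mono (ih rfl) (fun _ => le_rfl) measurable_smul_unit
      measurable_smul_unit
  | unit => exact le_rfl
  | pair t s iht ihs =>
    exact bind_mono (iht rfl) (fun v => bind_mono (ihs rfl) (fun _ => le_rfl)
      (measurable_dirac_pair v) (measurable_dirac_pair v)) (hev.measurable_pair s)
      (hev'.measurable_pair s)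
  | inj l t ih =>
    exact bind_mono (ih rfl) (fun _ => le_rfl) (measurable_dirac_inj l)
      (measurable_dirac_inj l)
  | roll t ih =>
    exact bind_mono (ih rfl) (fun _ => le_rfl) measurable_dirac_roll
      measurable_dirac_roll
  | lam t ih => exact le_rfl
  | app t s iht ihs =>
    exact bind_mono (iht rfl) (fun f => bind_mono (ihs rfl) (fun _ => hle _ _)
      (hev.measurable_cons f.body) (hev'.measurable_cons f.body)) (hev.measurable_app s)
      (hev'.measurable_app s)
  | umatch t s iht ihs =>
    exact bind_mono (iht rfl) (fun _ => ihs rfl) measurable_const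
      measurable_const
  | pmatch t s iht ihs =>
    exact bind_mono (iht rfl) (fun _ => hle _ _) (hev.measurable_pmatch s)
      (hev'.measurable_pmatch s)
  | vmatch t s iht ihs =>
    exact bind_mono (iht rfl) (fun _ => hle _ _) (hev.measurable_vmatch s)
      (hev'.measurable_vmatch s)
  | rmatch t s iht ihs =>
    exact bind_mono (iht rfl) (fun _ => hle _ _) (hev.measurable_rmatch s)
      (hev'.measurable_rmatch s)

theorem evalN_le_succ : ∀ (n : ℕ) (τ : Ty 0) (t : Tm ℝ [] τ), evalN n τ t ≤ evalN (n + 1) τ t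
  | 0, _, _ => Measure.zero_le _
  | n + 1, _, t => evalStep_mono (templatedEval_evalN n) (templatedEval_evalN (n + 1))
      (evalN_le_succ n) rfl t

theorem evalN_mono (τ : Ty 0) (t : Tm ℝ [] τ) : Monotone fun n => evalN n τ t :=
  monotone_nat_of_le_succ fun n => evalN_le_succ n τ t

/-! ## Denotations of renamings and substitution instances -/

section
variable {X Y G G' : Type} [WQbs X] [WQbs Y] [WQbs G] [WQbs G']

theorem T.bind_mono {μ μ' : T X} {f f' : X ⟶ω T Y} (h : μ ≤ μ') (hf : ∀ x, f x ≤ f' x) :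
    μ.bind f ≤ μ'.bind f' := fun w =>
  (h _).trans (μ'.1.isMor.mono fun x => hf x w)

/-- The two sides have separate environment spaces, so that terms in different contexts can be
compared. -/
theorem seqH_mono {f : G ⟶ω T X} {g : X × G ⟶ω T Y} {f' : G' ⟶ω T X} {g' : X × G' ⟶ω T Y}
    {γ : G} {γ' : G'} (hf : f γ ≤ f' γ') (hg : ∀ x, g (x, γ) ≤ g' (x, γ')) :
    seqH f g γ ≤ seqH f' g' γ' := T.bind_mono hf hg

theorem seqH_congr {f : G ⟶ω T X} {g : X × G ⟶ω T Y} {f' : G' ⟶ω T X} {g' : X × G' ⟶ω T Y}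
    {γ : G} {γ' : G'} (hf : f γ = f' γ') (hg : ∀ x, g (x, γ) = g' (x, γ')) :
    seqH f g γ = seqH f' g' γ' :=
  (seqH_mono hf.le fun x => (hg x).le).antisymm (seqH_mono hf.ge fun x => (hg x).ge)

theorem argsH_mono {n : ℕ} {f : Fin n → (G ⟶ω T X)} {f' : Fin n → (G' ⟶ω T X)} {γ : G} {γ' : G'}
    (h : ∀ i, f i γ ≤ f' i γ') : argsH f γ ≤ argsH f' γ' := by
  induction n with
  | zero => exact le_rfl
  | succ n ih => exact seqH_mono (h 0) fun x => seqH_mono (ih fun i => h i.succ) fun _ => le_rfl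

theorem argsH_congr {n : ℕ} {f : Fin n → (G ⟶ω T X)} {f' : Fin n → (G' ⟶ω T X)} {γ : G} {γ' : G'}
    (h : ∀ i, f i γ = f' i γ') : argsH f γ = argsH f' γ' :=
  (argsH_mono fun i => (h i).le).antisymm (argsH_mono fun i => (h i).ge)

open Classical in
theorem ifzH_mono {t : G ⟶ω T Rl} {s u : G ⟶ω T Y} {t' : G' ⟶ω T Rl} {s' u' : G' ⟶ω T Y}
    {γ : G} {γ' : G'} (ht : t γ ≤ t' γ') (hs : s γ ≤ s' γ') (hu : u γ ≤ u' γ') :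
    ifzH t s u γ ≤ ifzH t' s' u' γ' := by
  refine seqH_mono ht fun x => ?_
  change (if x = (0 : ℝ) then s γ else u γ) ≤ if x = (0 : ℝ) then s' γ' else u' γ'
  split_ifs
  · exact hs
  · exact hu

theorem ifzH_congr {t : G ⟶ω T Rl} {s u : G ⟶ω T Y} {t' : G' ⟶ω T Rl} {s' u' : G' ⟶ω T Y}
    {γ : G} {γ' : G'} (ht : t γ = t' γ') (hs : s γ = s' γ') (hu : u γ = u' γ') :
    ifzH t s u γ = ifzH t' s' u' γ' :=
  (ifzH_mono ht.le hs.le hu.le).antisymm (ifzH_mono ht.ge hs.ge hu.ge)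

end

/-- Extending an environment. -/
noncomputable def Env.cons {Γ : Ctx} {σ : Ty 0} (a : σ.den) (γ : Env Γ) : Env (σ :: Γ) :=
  ((a, γ) : σ.den × Env Γ)

theorem Ren.lift_den {Γ Δ : Ctx} {ρ : Ren Γ Δ} {γ : Env Γ} {δ : Env Δ}
    (h : ∀ τ (x : Var Γ τ), (ρ τ x).den δ = x.den γ) {σ : Ty 0} (a : σ.den) (τ : Ty 0)
    (x : Var (σ :: Γ) τ) : (ρ.lift σ τ x).den (Env.cons a δ) = x.den (Env.cons a γ) := by
  cases x with
  | zero => rfl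
  | succ x => exact h _ x

theorem Tm.den_rename {Γ : Ctx} {τ : Ty 0} (t : Tm ℝ Γ τ) : ∀ {Δ : Ctx} {ρ : Ren Γ Δ} {γ : Env Γ}
    {δ : Env Δ}, (∀ τ (x : Var Γ τ), (ρ τ x).den δ = x.den γ) → (t.rename ρ).den δ = t.den γ := by
  induction t with intro Δ ρ γ δ h
  | var x => exact congrArg T.pure (h _ x)
  | lit r => rfl
  | prim f t ih =>
    exact seqH_congr (X := Fin _ → Rl) (Y := Rl) (argsH_congr (X := Rl) fun i => ih i h) fun _ => rfl
  | ifz t s u iht ihs ihu => exact ifzH_congr (iht h) (ihs h) (ihu h)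
  | sample => rfl
  | score t ih => exact seqH_congr (X := Rl) (Y := Unit) (ih h) fun _ => rfl
  | unit => rfl
  | pair t s iht ihs => exact seqH_congr (iht h) fun _ => seqH_congr (ihs h) fun _ => rfl
  | inj l t ih => exact seqH_congr (ih h) fun _ => rfl
  | roll t ih => exact seqH_congr (ih h) fun _ => rfl
  | lam t ih => exact congrArg T.pure (Hom.ext fun a => ih (Ren.lift_den h a))
  | app t s iht ihs => exact seqH_congr (iht h) fun _ => seqH_congr (ihs h) fun _ => rfl
  | umatch t s iht ihs => exact seqH_congr (iht h) fun _ => ihs h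
  | pmatch t s iht ihs =>
    exact seqH_congr (iht h) fun p => ihs (Ren.lift_den (Ren.lift_den h p.1) p.2)
  | vmatch t s iht ihs => exact seqH_congr (iht h) fun p => ihs p.1 (Ren.lift_den h p.2)
  | rmatch t s iht ihs => exact seqH_congr (iht h) fun p => ihs (Ren.lift_den h _)

theorem Tm.den_weaken {Γ : Ctx} {σ τ : Ty 0} (t : Tm ℝ Γ τ) (a : σ.den) (γ : Env Γ) :
    (t.rename fun _ => .succ).den (Env.cons a γ) = t.den γ := t.den_rename fun _ _ => rfl

/-- The bound variable denotes the same Dirac operator on both sides, and weakening does not change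
the other denotations. -/
theorem Sub.lift_den_le {Γ Δ Δ' : Ctx} {θ : Sub ℝ Γ Δ} {θ' : Sub ℝ Γ Δ'} {δ : Env Δ} {δ' : Env Δ'}
    (h : ∀ τ x, (θ τ x).den δ ≤ (θ' τ x).den δ') {σ : Ty 0} (a : σ.den) (τ : Ty 0)
    (x : Var (σ :: Γ) τ) :
    (θ.lift σ τ x).den (Env.cons a δ) ≤ (θ'.lift σ τ x).den (Env.cons a δ') := by
  cases x with
  | zero => exact le_rfl
  | succ x =>
    exact ((Tm.den_weaken _ a δ).le.trans (h _ x)).trans (Tm.den_weaken _ a δ').ge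

/-- The denotation of a substitution instance is monotone in the denotation of the substitution. -/
theorem Tm.den_subst_le {Γ : Ctx} {τ : Ty 0} (t : Tm ℝ Γ τ) : ∀ {Δ Δ' : Ctx} {θ : Sub ℝ Γ Δ}
    {θ' : Sub ℝ Γ Δ'} {δ : Env Δ} {δ' : Env Δ'}, (∀ τ x, (θ τ x).den δ ≤ (θ' τ x).den δ') →
    (t.subst θ).den δ ≤ (t.subst θ').den δ' := by
  induction t with intro Δ Δ' θ θ' δ δ' h
  | var x => exact h _ x
  | lit r => exact le_rfl
  | prim f t ih =>
    exact seqH_mono (X := Fin _ → Rl) (Y := Rl) (argsH_mono (X := Rl) fun i => ih i h)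
      fun _ => le_rfl
  | ifz t s u iht ihs ihu => exact ifzH_mono (iht h) (ihs h) (ihu h)
  | sample => exact le_rfl
  | score t ih => exact seqH_mono (X := Rl) (Y := Unit) (ih h) fun _ => le_rfl
  | unit => exact le_rfl
  | pair t s iht ihs => exact seqH_mono (iht h) fun _ => seqH_mono (ihs h) fun _ => le_rfl
  | inj l t ih => exact seqH_mono (ih h) fun _ => le_rfl
  | roll t ih => exact seqH_mono (ih h) fun _ => le_rfl
  | lam t ih => exact T.isMor_pure.mono fun a => ih (Sub.lift_den_le h a)
  | app t s iht ihs => exact seqH_mono (iht h) fun _ => seqH_mono (ihs h) fun _ => le_rfl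
  | umatch t s iht ihs => exact seqH_mono (iht h) fun _ => ihs h
  | pmatch t s iht ihs =>
    exact seqH_mono (iht h) fun p => ihs (Sub.lift_den_le (Sub.lift_den_le h p.1) p.2)
  | vmatch t s iht ihs => exact seqH_mono (iht h) fun p => ihs p.1 (Sub.lift_den_le h p.2)
  | rmatch t s iht ihs => exact seqH_mono (iht h) fun p => ihs (Sub.lift_den_le h _)

/-- Apply the monotonicity of substitution in both directions against the identity substitution,
whose terms denote Dirac operators at the entries of γ. -/
theorem Tm.den_subst {Γ Δ : Ctx} {τ : Ty 0} (t : Tm ℝ Γ τ) {θ : Sub ℝ Γ Δ} {γ : Env Γ} {δ : Env Δ}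
    (h : ∀ τ (x : Var Γ τ), (θ τ x).den δ = T.pure (x.den γ)) : (t.subst θ).den δ = t.den γ := by
  have h1 := t.den_subst_le (θ := θ) (θ' := fun _ x => .var x) (δ := δ) (δ' := γ)
    fun τ x => (h τ x).le
  have h2 := t.den_subst_le (θ := fun _ x => .var x) (θ' := θ) (δ := γ) (δ' := δ)
    fun τ x => (h τ x).ge
  rw [subst_var] at h1 h2
  exact h1.antisymm h2

/-- The hole is filled with arbitrary terms, for which the substitution lemma in terms of
environments is not available; the monotone comparison is. -/
theorem PCtx.fill_den_le {σ τ : Ty 0} (C : PCtx τ σ) {t s : Tm ℝ [] τ} (h : t.den ≤ s.den) :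
    (C.fill t).den ≤ (C.fill s).den := fun γ =>
  C.den_subst_le fun σ x => by
    cases x with
    | zero => exact h γ
    | succ x => cases x

/-! ### Denotations of values -/

/-- The element denoted by a closed value. -/
noncomputable def Val.den : ∀ {τ : Ty 0}, Val ℝ τ → τ.den
  | _, .lit r => (r : Rl)
  | _, .unit => ()
  | _, .pair v w => (v.den, w.den)
  | _, .inj (τ := τ) l v => (⟨l, v.den⟩ : Σ l, (τ l).den)
  | _, .roll (τ := τ) v => τ.roll v.den
  | _, .lam (σ := σ) (τ := τ) t => (⟨fun a => t.den (Env.cons a ()),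
      t.den.isMor.comp (isMor_id.pair (isMor_const ()))⟩ : σ.den ⟶ω T τ.den)

theorem Val.toTm_den {τ : Ty 0} (v : Val ℝ τ) (γ : Env []) : v.toTm.den γ = T.pure v.den := by
  induction v with
  | lit r => rfl
  | unit => rfl
  | pair v w ih ih' =>
    refine Eq.trans (congrArg (fun μ => T.bind μ _) ih) ?_
    exact congrArg (fun μ => T.bind μ _) ih'
  | inj l v ih => exact congrArg (fun μ => T.bind μ _) ih
  | roll v ih => exact congrArg (fun μ => T.bind μ _) ih
  | lam t => rfl

/-! ## Logical relations -/

/-- The order of weights or, for `b = false`, the opposite order. -/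
def SLe (b : Bool) (x y : Wt) : Prop := if b then x ≤ y else y ≤ x

theorem SLe.refl (b : Bool) (x : Wt) : SLe b x x := by cases b <;> exact le_rfl

theorem SLe.lintegral {b : Bool} {A : Type} [MeasurableSpace A] {ν : Measure A} {f g : A → Wt}
    (h : ∀ a, SLe b (f a) (g a)) : SLe b (∫⁻ a, f a ∂ν) (∫⁻ a, g a ∂ν) := by
  cases b
  · exact lintegral_mono fun a => h a
  · exact lintegral_mono fun a => h a

theorem SLe.mul_left {b : Bool} {x y : Wt} (c : Wt) (h : SLe b x y) : SLe b (c * x) (c * y) := by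
  cases b
  · exact mul_le_mul_right (a := c) h
  · exact mul_le_mul_right (a := c) h

/-- The lifting of a relation between elements and values to a relation between elements of the
powerdomain and sequences of measures: related weight functions have comparable expectations. -/
def Lifted (b : Bool) {X : Type} [WQbs X] {τ : Ty 0} (R : X → Val ℝ τ → Prop) (μ : T X)
    (ν : ℕ → Measure (Val ℝ τ)) : Prop :=
  ∀ (w : X ⟶ω Wt) (w' : Val ℝ τ → Wt), Measurable w' → (∀ x v, R x v → SLe b (w x) (w' v)) →
    SLe b (μ.1 w) (⨆ k, ∫⁻ v, w' v ∂ν k)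

section
variable {b : Bool} {X Y : Type} [WQbs X] [WQbs Y] {σ τ : Ty 0} {R : X → Val ℝ σ → Prop}
  {S : Y → Val ℝ τ → Prop}

theorem Lifted.pure {x : X} {v : Val ℝ σ} (h : R x v) :
    Lifted b R (T.pure x) fun _ => Measure.dirac v := fun w w' hw' hR => by
  simp only [lintegral_dirac' _ hw', ciSup_const]
  exact hR x v h

theorem Lifted.zero : Lifted b R T.zero fun _ => 0 := fun w w' hw' hR => by
  simp only [lintegral_zero_measure, ciSup_const]
  exact SLe.refl b 0

/-- The limit expectation of the continuation serves as the weight function on values for the first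
stage. This is legitimate in both directions because the supremum of the composite is an equality,
not just a bound. -/
theorem Lifted.bind {μ : T X} {ν : ℕ → Measure (Val ℝ σ)} (h : Lifted b R μ ν) (hν : Monotone ν)
    {f : X ⟶ω T Y} {g : ℕ → Val ℝ σ → Measure (Val ℝ τ)} (hg : ∀ k, Measurable (g k))
    (hgm : Monotone g) (hfg : ∀ x v, R x v → Lifted b S (f x) fun k => g k v) :
    Lifted b S (μ.bind f) fun k => (ν k).bind (g k) := fun w w' hw' hS => by
  have hm : ∀ k, Measurable fun v => ∫⁻ y, w' y ∂g k v := fun k =>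
    (Measure.measurable_lintegral hw').comp (hg k)
  have hmono : Monotone fun k v => ∫⁻ y, w' y ∂g k v := fun i j hij v =>
    lintegral_mono' (hgm hij v) le_rfl
  -- Monotone convergence, together with the fact that the diagonal is cofinal in a double sequence
  -- increasing in both indices.
  have e : ⨆ k, ∫⁻ y, w' y ∂(ν k).bind (g k) =
      ⨆ k, ∫⁻ v, ⨆ j, ∫⁻ y, w' y ∂g j v ∂ν k := by
    simp only [Measure.lintegral_bind (hg _).aemeasurable hw'.aemeasurable,
      lintegral_iSup hm hmono]
    refine le_antisymm (iSup_mono fun k => le_iSup (fun j => ∫⁻ v, ∫⁻ y, w' y ∂g j v ∂ν k) k)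
      (iSup₂_le fun k j => le_iSup_of_le (max k j) (lintegral_mono' (hν (le_max_left k j))
        (hmono (le_max_right k j))))
  rw [e]
  exact h ⟨fun x => (f x).1 w, (isMor_incl.comp f.isMor).app (isMor_const w)⟩ _
    (Measurable.iSup hm) fun x v hx => hfg x v hx w w' hw' hS

end

/-- The relations of a logical relation between the denotational semantics and the evaluators `E`,
in one of the two directions. -/
structure LogRel (b : Bool) (E : ℕ → ∀ τ : Ty 0, Tm ℝ [] τ → Measure (Val ℝ τ))
    (R : ∀ τ : Ty 0, τ.den → Val ℝ τ → Prop) : Prop where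
  templated : ∀ k, TemplatedEval (E k)
  mono : ∀ (τ : Ty 0) (t : Tm ℝ [] τ), Monotone fun k => E k τ t
  step : ∀ (τ : Ty 0) (t : Tm ℝ [] τ) (μ : T τ.den),
    Lifted b (R τ) μ (fun k => evalStep (E k) rfl t) → Lifted b (R τ) μ fun k => E k τ t
  real : ∀ (x : Rl) (v : Val ℝ .real), R .real x v ↔ x = v.real
  unit : ∀ (x : Unit) (v : Val ℝ .unit), R .unit x v
  prod : ∀ {σ τ : Ty 0} (x : σ.den × τ.den) (v : Val ℝ (.prod σ τ)),
    R (.prod σ τ) x v ↔ R σ x.1 v.fst ∧ R τ x.2 v.snd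
  inj : ∀ {L : Finset ℕ} {τ : {l // l ∈ L} → Ty 0} (l : {l // l ∈ L}) (x : (τ l).den)
    (v : Val ℝ (τ l)), R (τ l) x v → R (.variant L τ) (⟨l, x⟩ : Σ l, (τ l).den) (.inj l v)
  variant : ∀ {L : Finset ℕ} {τ : {l // l ∈ L} → Ty 0} (x : Σ l, (τ l).den)
    (v : Val ℝ (.variant L τ)), R (.variant L τ) x v → ∃ w, v = .inj x.1 w ∧ R (τ x.1) x.2 w
  roll : ∀ {τ : Ty 1} (x : τ.unroll.den) (v : Val ℝ τ.unroll), R τ.unroll x v →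
    R (.mu τ) (τ.roll x) (.roll v)
  unroll : ∀ {τ : Ty 1} (x : (Ty.mu τ).den) (v : Val ℝ (.mu τ)), R (.mu τ) x v →
    R τ.unroll (τ.unrollHom x) v.unroll
  app : ∀ {σ τ : Ty 0} (f : σ.den ⟶ω T τ.den) (v : Val ℝ (.arrow σ τ)) (x : σ.den) (w : Val ℝ σ),
    R (.arrow σ τ) f v → R σ x w →
      Lifted b (R τ) (f x) fun k => E k τ (v.body.subst (Sub.nil.cons w.toTm))
  lam : ∀ {Γ : Ctx} {σ τ : Ty 0} (t : Tm ℝ (σ :: Γ) τ) (γ : Env Γ) (θ : Sub ℝ Γ []),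
    (∀ τ (x : Var Γ τ), ∃ v : Val ℝ τ, θ τ x = v.toTm ∧ R τ (x.den γ) v) →
    (∀ (x : σ.den) (v : Val ℝ σ), R σ x v →
      Lifted b (R τ) (t.den (Env.cons x γ)) fun k => E k τ (t.subst (θ.cons v.toTm))) →
    R (.arrow σ τ) (⟨fun a => t.den (Env.cons a γ), t.den.isMor.comp
      (isMor_id.pair (isMor_const γ))⟩ : σ.den ⟶ω T τ.den) (.lam (t.subst (θ.lift σ)))

/-! ### The fundamental property -/

namespace LogRel
variable {b : Bool} {E : ℕ → ∀ τ : Ty 0, Tm ℝ [] τ → Measure (Val ℝ τ)}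
  {R : ∀ τ : Ty 0, τ.den → Val ℝ τ → Prop}

/-- Related environments. -/
def REnv (R : ∀ τ : Ty 0, τ.den → Val ℝ τ → Prop) {Γ : Ctx} (γ : Env Γ) (θ : Sub ℝ Γ []) : Prop :=
  ∀ τ (x : Var Γ τ), ∃ v : Val ℝ τ, θ τ x = v.toTm ∧ R τ (x.den γ) v

theorem REnv.cons {Γ : Ctx} {γ : Env Γ} {θ : Sub ℝ Γ []} (h : REnv R γ θ) {σ : Ty 0} {x : σ.den}
    {v : Val ℝ σ} (hx : R σ x v) : REnv R (Env.cons x γ) (θ.cons v.toTm) := fun τ y => by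
  cases y with
  | zero => exact ⟨v, rfl, hx⟩
  | succ y => exact h _ y

theorem evalStep_mono (H : LogRel b E R) {τ : Ty 0} (t : Tm ℝ [] τ) :
    Monotone fun k => evalStep (E k) rfl t := fun i j hij =>
  SFPC.evalStep_mono (H.templated i) (H.templated j) (fun τ t => H.mono τ t hij) rfl t

/-- The continuation K is part of the statement so that the induction can push each evaluated
argument into it; related reals are equal, so both sides continue with the same number. -/
theorem args {X : Type} [WQbs X] {G : Type} [WQbs G] {τ : Ty 0} {S : X → Val ℝ τ → Prop} {n : ℕ}
    (H : LogRel b E R) {f : Fin n → (G ⟶ω T Rl)} {γ : G} {t : Fin n → Tm ℝ [] .real}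
    (h : ∀ i, Lifted b (R .real) (f i γ) fun k => evalStep (E k) rfl (t i))
    {K : (Fin n → Rl) ⟶ω T X} {κ : (Fin n → ℝ) → Measure (Val ℝ τ)} (hκ : TemplatedArgs κ)
    (hK : ∀ r, Lifted b S (K r) fun _ => κ r) :
    Lifted b S ((argsH f γ).bind K) fun k => evalArgs (fun i => evalStep (E k) rfl (t i)) κ := by
  induction n with
  | zero => exact hK fun i => i.elim0
  | succ n ih =>
    have hc : ∀ v : ℝ, IsMor fun r : Fin n → Rl => K (Fin.cons (α := fun _ => Rl) v r) := fun v =>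
      K.isMor.comp (IsMor.pi fun i => by
        cases i using Fin.cases with
        | zero => exact isMor_const _
        | succ i => exact isMor_iff.2 ⟨fun _ _ h => isSup_pi.1 h i, fun _ h => h i⟩)
    have hm : IsMor fun v : Rl => (argsH (fun i => f i.succ) γ).bind ⟨_, hc v⟩ := by
      refine (isMor_const _).bind (IsMor.lam (K.isMor.comp (IsMor.pi fun i => ?_)))
      cases i using Fin.cases with
      | zero => exact isMor_fst
      | succ i =>
        exact (isMor_iff.2 ⟨fun _ _ h => isSup_pi.1 h i, fun _ h => h i⟩ :
          IsMor fun a : Fin n → Rl => a i).comp isMor_snd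
    exact (h 0).bind (f := ⟨_, hm⟩) (H.evalStep_mono (t 0))
      (fun k => hκ.measurable fun i => templated_const (H.templated k) (t i.succ))
      (fun i j hij v => evalArgs_mono (fun l => H.evalStep_mono (t l.succ) hij)
        (fun l => templated_const (H.templated i) _) (fun l => templated_const (H.templated j) _)
        (hκ.cons v.real))
      fun x v hx => ih (fun i => h i.succ) (hκ.cons v.real) fun r => by
        obtain rfl := (H.real x v).1 hx
        exact hK _

/-- Constructors keep the index, so one level suffices however deeply the value is nested. -/
theorem evalStep_toTm {ev : ∀ τ : Ty 0, Tm ℝ [] τ → Measure (Val ℝ τ)} (hev : TemplatedEval ev)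
    {τ : Ty 0} (v : Val ℝ τ) : evalStep ev rfl v.toTm = Measure.dirac v := by
  induction v with
  | lit r => rfl
  | unit => rfl
  | pair v w ihv ihw =>
    simp only [Val.toTm, evalStep]
    rw [ihv, Measure.dirac_bind (hev.measurable_pair w.toTm), ihw,
      Measure.dirac_bind (measurable_dirac_pair v)]
  | inj l v ih =>
    simp only [Val.toTm, evalStep, ih]
    exact Measure.dirac_bind (measurable_dirac_inj l) v
  | roll v ih =>
    simp only [Val.toTm, evalStep, ih]
    exact Measure.dirac_bind measurable_dirac_roll v
  | lam t => rfl

/-- The fundamental property of logical relations. -/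
theorem fundamental (H : LogRel b E R) {Γ : Ctx} {τ : Ty 0} (t : Tm ℝ Γ τ) : ∀ {γ : Env Γ}
    {θ : Sub ℝ Γ []}, REnv R γ θ →
    Lifted b (R τ) (t.den γ) fun k => evalStep (E k) rfl (t.subst θ) := by
  induction t with intro γ θ h
  | var x =>
    obtain ⟨v, hv, hx⟩ := h _ x
    simp only [Tm.subst, hv, evalStep_toTm (H.templated _)]
    exact Lifted.pure hx
  | lit r => exact Lifted.pure ((H.real _ _).2 rfl)
  | prim f t ih =>
    refine H.args (X := Rl) (fun i => ih i h) (templatedArgs_prim f) fun r => ?_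
    change Lifted b _ (T.ofLift (liftOf (f.toFun r))) _
    cases f.toFun r with
    | none => exact Lifted.zero
    | some y => exact Lifted.pure ((H.real _ _).2 rfl)
  | ifz t s u iht ihs ihu =>
    refine (iht h).bind (X := Rl) (H.evalStep_mono _)
      (fun k => (H.templated k).measurable_ifz _ _) (fun i j hij v => ?_) fun x v hx => ?_
    · dsimp only
      split_ifs
      · exact H.evalStep_mono _ hij
      · exact H.evalStep_mono _ hij
    · obtain rfl := (H.real x v).1 hx
      classical
      -- Related reals are equal, so both semantics take the same branch.
      change Lifted b _ (if v.real = 0 then s.den γ else u.den γ) _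
      split_ifs
      · exact ihs h
      · exact ihu h
  | sample =>
    intro w w' hw' hR
    have e : ∀ k : ℕ, ∫⁻ v, w' v ∂evalStep (E k) rfl Tm.sample =
        ∫⁻ r in Set.Icc (0 : ℝ) 1, w' (.lit r) := fun k => by
      refine (Measure.lintegral_bind (Measure.measurable_dirac.comp
        Val.measurable_lit).aemeasurable hw'.aemeasurable).trans ?_
      exact lintegral_congr fun r => lintegral_dirac' _ hw'
    change SLe b _ (⨆ k, ∫⁻ v, w' v ∂evalStep (E k) rfl Tm.sample)
    simp only [e, ciSup_const]
    exact SLe.lintegral fun r => hR _ _ ((H.real _ _).2 rfl)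
  | score t ih =>
    refine (ih h).bind (X := Rl) (Y := Unit) (H.evalStep_mono _) (fun _ => measurable_smul_unit)
      (fun _ _ _ _ => le_rfl) fun x v hx w w' hw' hR => ?_
    obtain rfl := (H.real x v).1 hx
    simp only [lintegral_smul_measure, lintegral_dirac' _ hw', ciSup_const, smul_eq_mul]
    exact SLe.mul_left _ (hR _ _ (H.unit _ _))
  | unit => exact Lifted.pure (H.unit _ _)
  | pair t s iht ihs =>
    refine (iht h).bind (H.evalStep_mono _) (fun k => (H.templated k).measurable_pair _)
      (fun i j hij v => bind_mono (H.evalStep_mono _ hij) (fun _ => le_rfl)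
        (measurable_dirac_pair v) (measurable_dirac_pair v)) fun x v hx => ?_
    refine (ihs h).bind (H.evalStep_mono _) (fun k => measurable_dirac_pair v)
      (fun i j hij _ => le_rfl) fun y v' hy => ?_
    exact Lifted.pure ((H.prod _ _).2 ⟨hx, hy⟩)
  | inj l t ih =>
    exact (ih h).bind (H.evalStep_mono _) (fun k => measurable_dirac_inj l)
      (fun i j hij _ => le_rfl) fun x v hx => Lifted.pure (H.inj l x v hx)
  | roll t ih =>
    exact (ih h).bind (H.evalStep_mono _) (fun k => measurable_dirac_roll)
      (fun i j hij _ => le_rfl) fun x v hx => Lifted.pure (H.roll x v hx)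
  | lam t ih =>
    -- The induction hypothesis concerns one level built on the evaluator, while application runs
    -- the evaluator itself on the body; `step` accounts for this difference of one index.
    exact Lifted.pure (H.lam t γ θ h fun x v hx => H.step _ _ _ (ih (h.cons hx)))
  | app t s iht ihs =>
    refine (iht h).bind (H.evalStep_mono _) (fun k => (H.templated k).measurable_app _)
      (fun i j hij v => bind_mono (H.evalStep_mono _ hij) (fun _ => H.mono _ _ hij)
        ((H.templated i).measurable_cons _) ((H.templated j).measurable_cons _)) fun x v hx => ?_
    exact (ihs h).bind (H.evalStep_mono _) (fun k => (H.templated k).measurable_cons _)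
      (fun i j hij _ => H.mono _ _ hij) fun y v' hy => H.app x v y v' hx hy
  | umatch t s iht ihs =>
    exact (iht h).bind (X := Unit) (H.evalStep_mono _) (fun k => measurable_const)
      (fun i j hij _ => H.evalStep_mono _ hij) fun _ _ _ => ihs h
  | pmatch t s iht ihs =>
    refine (iht h).bind (H.evalStep_mono _) (fun k => (H.templated k).measurable_pmatch _)
      (fun i j hij _ => H.mono _ _ hij) fun x v hx => ?_
    obtain ⟨h1, h2⟩ := (H.prod x v).1 hx
    -- A match likewise hands its body to the evaluator at the lower index. Substituting under the
    -- binders first and the components afterwards is then one extended substitution.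
    refine H.step _ _ _ ?_
    rw [Tm.subst_lift_lift_cons]
    exact ihs ((h.cons h1).cons h2)
  | vmatch t s iht ihs =>
    refine (iht h).bind (H.evalStep_mono _) (fun k => (H.templated k).measurable_vmatch
      fun l => (s l).subst (θ.lift _))
      (fun i j hij _ => H.mono _ _ hij) fun x v hx => ?_
    -- Related elements of a variant type carry the same label, hence select the same branch.
    obtain ⟨v, rfl, hv⟩ := H.variant x v hx
    refine H.step _ _ _ ?_
    change Lifted b _ _ fun k => evalStep (E k) rfl (((s x.1).subst (θ.lift _)).subst
      (Sub.nil.cons v.toTm))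
    rw [Tm.subst_lift_cons]
    exact ihs x.1 (h.cons hv)
  | rmatch t s iht ihs =>
    refine (iht h).bind (H.evalStep_mono _) (fun k => (H.templated k).measurable_rmatch _)
      (fun i j hij _ => H.mono _ _ hij) fun x v hx => ?_
    refine H.step _ _ _ ?_
    rw [Tm.subst_lift_cons]
    exact ihs (h.cons (H.unroll x v hx))

end LogRel

/-! ## Soundness -/

theorem PHom.coe_total {A B : Sp} (f : PHom A B) (h : ∀ x, f x ≠ ⊥) (x : A) :
    ((f.total h x : B) : Lift B) = f x := WithBot.coe_unbot _ _

theorem PHom.total_total {A B : Sp} {f : PHom A B} {g : PHom B A} (hf : ∀ x, f x ≠ ⊥)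
    (hg : ∀ x, g x ≠ ⊥) (h : f ≫ₚ g = PHom.id A) (x : A) : g.total hg (f.total hf x) = x := by
  apply WithBot.coe_injective
  rw [PHom.coe_total]
  have : (f ≫ₚ g) x = x := by rw [h]; rfl
  change Lift.elim ⊥ g (f x) = x at this
  rwa [← PHom.coe_total f hf] at this

theorem Hom.cast_symm {A B : Sp} (h : A = B) (x : A) : Hom.cast h.symm (Hom.cast h x) = x := by
  subst h; rfl

theorem Ty.unrollHom_roll (τ : Ty 1) (x : τ.unroll.den) : τ.unrollHom (τ.roll x) = x :=
  (congrArg (Hom.cast τ.den_unroll.symm) (PHom.total_total (PHom.ne_bot (τ.sem.fold_unfold _))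
    (PHom.ne_bot (τ.sem.unfold_fold _)) (τ.sem.fold_unfold _) (Hom.cast τ.den_unroll x))).trans
    (Hom.cast_symm τ.den_unroll x)

theorem Ty.roll_unrollHom (τ : Ty 1) (x : (Ty.mu τ).den) : τ.roll (τ.unrollHom x) = x :=
  (congrArg (τ.sem.fold _) (Hom.cast_symm τ.den_unroll.symm (τ.sem.unfold _ x))).trans
    (PHom.total_total (PHom.ne_bot (τ.sem.unfold_fold _)) (PHom.ne_bot (τ.sem.fold_unfold _))
      (τ.sem.unfold_fold _) x)

/-- A value is related to the element that it denotes. -/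
def DenRel (τ : Ty 0) (x : τ.den) (v : Val ℝ τ) : Prop := x = v.den

theorem Sub.cons_den {σ : Ty 0} (v : Val ℝ σ) : LogRel.REnv DenRel
    (Env.cons v.den (Γ := []) ()) (Sub.nil.cons v.toTm) := fun τ x => by
  cases x with
  | zero => exact ⟨v, rfl, rfl⟩
  | succ x => cases x

/-- The evaluators form a constant sequence here, so that a bound at index n is turned by the
fundamental property into one at the next index. -/
theorem logRel_denRel {n : ℕ} (hn : ∀ {Γ : Ctx} {τ : Ty 0} (t : Tm ℝ Γ τ) {γ : Env Γ}
    {θ : Sub ℝ Γ []}, LogRel.REnv DenRel γ θ →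
      Lifted false (DenRel τ) (t.den γ) fun _ => evalN n τ (t.subst θ)) :
    LogRel false (fun _ => evalN n) DenRel where
  templated _ := templatedEval_evalN n
  mono _ _ := monotone_const
  step τ t μ h w w' hw' hR := by
    have := h w w' hw' hR
    simp only [ciSup_const] at this ⊢
    -- Evaluation is being bounded from above, so lowering the index by one only helps.
    exact (lintegral_mono' (evalN_le_succ n τ t) le_rfl).trans this
  real x v := by cases v; exact Iff.rfl
  unit x v := by cases v; rfl
  prod x v := by cases v; exact Prod.ext_iff
  inj l x v h := by cases h; rfl
  variant x v h := by cases v; cases h; exact ⟨_, rfl, rfl⟩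
  roll x v h := by cases h; rfl
  unroll x v h := by cases v; cases h; exact Ty.unrollHom_roll _ _
  app f v x w h h' := by
    cases v
    cases h
    cases h'
    exact hn _ (Sub.cons_den w)
  lam t γ θ h _ := by
    -- The relation is equality, so an abstraction must denote the given function exactly: this is
    -- the substitution lemma for an environment denoted by values.
    refine Hom.ext fun a => (t.den_subst fun τ x => ?_).symm
    cases x with
    | zero => rfl
    | succ x =>
      obtain ⟨v, hv, hx⟩ := h _ x
      refine (Tm.den_weaken (θ _ x) a (Γ := []) ()).trans ?_
      rw [hv]
      exact (Val.toTm_den v _).trans (congrArg T.pure hx.symm)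

/-- Index 0 evaluates to the zero measure; one level of evaluation over index n is by definition
index n + 1. -/
theorem lifted_evalN (n : ℕ) : ∀ {Γ : Ctx} {τ : Ty 0} (t : Tm ℝ Γ τ) {γ : Env Γ}
    {θ : Sub ℝ Γ []}, LogRel.REnv DenRel γ θ →
      Lifted false (DenRel τ) (t.den γ) fun _ => evalN n τ (t.subst θ) := by
  induction n with
  | zero =>
    intro Γ τ t γ θ _ w w' _ _
    simp [evalN, SLe]
  | succ n ih => exact fun t => (logRel_denRel ih).fundamental t

/-- The evaluation of a closed term is bounded by its denotation. -/
theorem lintegral_evalN_le (n : ℕ) {τ : Ty 0} (t : Tm ℝ [] τ) (w : τ.den ⟶ω Wt)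
    {w' : Val ℝ τ → Wt} (hw' : Measurable w') (h : ∀ v, w' v ≤ w v.den) :
    ∫⁻ v, w' v ∂evalN n τ t ≤ (t.den ()).1 w := by
  have := lifted_evalN n t (γ := ()) (θ := Sub.nil) (fun _ x => by cases x) w w' hw'
    (by rintro _ v rfl; exact h v)
  simp only [ciSup_const, Tm.subst_nil] at this
  exact this

/-! ## Finite approximations of the identity on the denotation of a closed type -/

universe u

/-- Recursion over closed types that stops at recursive types. -/
noncomputable def Ty.closedRec {motive : Ty 0 → Sort u} (real : motive .real) (unit : motive .unit)
    (prod : ∀ σ τ, motive σ → motive τ → motive (.prod σ τ))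
    (arrow : ∀ σ τ, motive σ → motive τ → motive (.arrow σ τ))
    (variant : ∀ L (τ : {l // l ∈ L} → Ty 0), (∀ l, motive (τ l)) → motive (.variant L τ))
    (mu : ∀ τ : Ty 1, motive (.mu τ)) (τ : Ty 0) : motive τ :=
  Ty.rec (motive := fun n τ => ∀ h : n = 0, motive (h ▸ τ))
    (fun i h => Fin.elim0 (h ▸ i)) (fun h => by cases h; exact real) (fun h => by cases h; exact unit)
    (fun σ τ ih ih' h => by cases h; exact prod σ τ (ih rfl) (ih' rfl))
    (fun σ τ ih ih' h => by cases h; exact arrow σ τ (ih rfl) (ih' rfl))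
    (fun L τ ih h => by cases h; exact variant L τ fun l => ih l rfl)
    (fun τ _ h => by cases h; exact mu τ) τ rfl

/-- The unrolling of a recursive type, as a partial map. -/
noncomputable def Ty.unrollP (τ : Ty 1) : PHom (Ty.mu τ).den τ.unroll.den :=
  ⟨fun x => (τ.unrollHom x : Lift _), isMor_coe.comp τ.unrollHom.isMor⟩

/-- The rolling of a recursive type, as a partial map. -/
noncomputable def Ty.rollP (τ : Ty 1) : PHom τ.unroll.den (Ty.mu τ).den :=
  ⟨fun x => (τ.roll x : Lift _), isMor_coe.comp τ.roll.isMor⟩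

/-- The action of a closed type on given partial maps on its outermost recursive types. -/
noncomputable def projStep (m : ∀ τ : Ty 1, PHom (Ty.mu τ).den (Ty.mu τ).den) :
    ∀ τ : Ty 0, PHom τ.den τ.den :=
  Ty.closedRec (motive := fun τ => PHom τ.den τ.den) (PHom.id _) (PHom.id _)
    (fun _ _ p q => PHom.prod p q) (fun _ _ p q => PHom.arrow p q) (fun _ _ p => PHom.sum p) m

/-- The action of a recursive type on a given family of partial maps on all closed types. -/
noncomputable def projMu (p : ∀ τ : Ty 0, PHom τ.den τ.den) (τ : Ty 1) :
    PHom (Ty.mu τ).den (Ty.mu τ).den := τ.unrollP ≫ₚ p τ.unroll ≫ₚ τ.rollP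

/-- The part of the identity that unrolls nested recursive types less than `n` times. -/
noncomputable def proj : ℕ → ∀ τ : Ty 0, PHom τ.den τ.den
  | 0 => projStep fun _ => ⟨fun _ => ⊥, isMor_const ⊥⟩
  | n + 1 => projStep (projMu (proj n))

theorem PHom.sum_mono {ι : Type} [Countable ι] {A B : ι → Sp} {u v : ∀ i, PHom (A i) (B i)}
    (h : ∀ i, u i ≤ v i) : PHom.sum u ≤ PHom.sum v := fun ⟨i, x⟩ =>
  (isMor_lift_inj (P := fun i => B i) i).mono (h i x)

theorem PHom.sum_comp {ι : Type} [Countable ι] {A B C : ι → Sp} (u : ∀ i, PHom (A i) (B i))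
    (v : ∀ i, PHom (B i) (C i)) : PHom.sum u ≫ₚ PHom.sum v = PHom.sum fun i => u i ≫ₚ v i := by
  ext ⟨i, x⟩
  change Lift.elim ⊥ _ (Lift.elim ⊥ _ (u i x)) = Lift.elim ⊥ _ (Lift.elim ⊥ _ (u i x))
  induction u i x using WithBot.recBotCoe <;> rfl

theorem PHom.prod_mono {A B C D : Sp} {u u' : PHom A B} {v v' : PHom C D} (h : u ≤ u')
    (h' : v ≤ v') : u.prod v ≤ u'.prod v' :=
  PHom.isMor_prod.mono (a := (u, v)) (b := (u', v')) ⟨h, h'⟩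

theorem PHom.arrow_mono {A B C D : Sp} {u u' : PHom B A} {v v' : PHom C D} (h : u ≤ u')
    (h' : v ≤ v') : u.arrow v ≤ u'.arrow v' :=
  PHom.isMor_arrow.mono (a := (u, v)) (b := (u', v')) ⟨h, h'⟩

/-- Functoriality of the binary product of projection functors, at the pair of maps u, v used in
both directions. -/
theorem PHom.prod_comp_self {A B : Sp} (u : PHom A A) (v : PHom B B) :
    u.prod v ≫ₚ u.prod v = (u ≫ₚ u).prod (v ≫ₚ v) :=
  let f := mcons (A := scons B fun i : Fin 0 => i.elim0) (B := scons B fun i : Fin 0 => i.elim0)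
    ⟨u, u⟩ (mcons ⟨v, v⟩ fun i => i.elim0)
  (((MFun.var 0).prod (MFun.var 1)).map_comp f f).symm

theorem PHom.arrow_comp_self {A B : Sp} (u : PHom A A) (v : PHom B B) :
    u.arrow v ≫ₚ u.arrow v = (u ≫ₚ u).arrow (v ≫ₚ v) :=
  let f := mcons (A := scons B fun i : Fin 0 => i.elim0) (B := scons B fun i : Fin 0 => i.elim0)
    ⟨u, u⟩ (mcons ⟨v, v⟩ fun i => i.elim0)
  (((MFun.var 0).arrow (MFun.var 1)).map_comp f f).symm

theorem PHom.arrow_id (A B : Sp) : (PHom.id A).arrow (PHom.id B) = PHom.id _ :=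
  ((MFun.var 0).arrow (MFun.var 1)).map_id (scons A (scons B fun i : Fin 0 => i.elim0))

theorem projStep_mono {m m' : ∀ τ : Ty 1, PHom (Ty.mu τ).den (Ty.mu τ).den}
    (h : ∀ τ, m τ ≤ m' τ) (τ : Ty 0) : projStep m τ ≤ projStep m' τ := by
  induction τ using Ty.closedRec with
  | real => exact le_rfl
  | unit => exact le_rfl
  | prod σ τ ih ih' => exact PHom.prod_mono ih ih'
  | arrow σ τ ih ih' => exact PHom.arrow_mono ih ih'
  | variant L τ ih => exact PHom.sum_mono ih
  | mu τ => exact h τ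

theorem projStep_le_id {m : ∀ τ : Ty 1, PHom (Ty.mu τ).den (Ty.mu τ).den}
    (h : ∀ τ, m τ ≤ PHom.id _) (τ : Ty 0) : projStep m τ ≤ PHom.id _ := by
  induction τ using Ty.closedRec with
  | real => exact le_rfl
  | unit => exact le_rfl
  | prod σ τ ih ih' => exact PHom.prod_mono ih ih'
  | arrow σ τ ih ih' => exact (PHom.arrow_mono ih ih').trans_eq (PHom.arrow_id _ _)
  | variant L τ ih => exact PHom.sum_mono ih
  | mu τ => exact h τ

theorem projStep_idem {m : ∀ τ : Ty 1, PHom (Ty.mu τ).den (Ty.mu τ).den}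
    (h : ∀ τ, m τ ≫ₚ m τ = m τ) (τ : Ty 0) : projStep m τ ≫ₚ projStep m τ = projStep m τ := by
  induction τ using Ty.closedRec with
  | real => rfl
  | unit => rfl
  | prod σ τ ih ih' => exact (PHom.prod_comp_self _ _).trans (congrArg₂ PHom.prod ih ih')
  | arrow σ τ ih ih' => exact (PHom.arrow_comp_self _ _).trans (congrArg₂ PHom.arrow ih ih')
  | variant L τ ih => exact (PHom.sum_comp _ _).trans (congrArg PHom.sum (funext ih))
  | mu τ => exact h τ

theorem Ty.rollP_unrollP (τ : Ty 1) : τ.rollP ≫ₚ τ.unrollP = PHom.id _ :=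
  Hom.ext fun x => congrArg WithBot.some (τ.unrollHom_roll x)

theorem Ty.unrollP_rollP (τ : Ty 1) : τ.unrollP ≫ₚ τ.rollP = PHom.id _ :=
  Hom.ext fun x => congrArg WithBot.some (τ.roll_unrollHom x)

/-- Consecutive approximations differ only at the recursive types, where `projStep` is monotone in
the maps inserted. -/
theorem proj_le_succ (n : ℕ) (τ : Ty 0) : proj n τ ≤ proj (n + 1) τ := by
  induction n generalizing τ with
  | zero => exact projStep_mono (fun _ _ => bot_le) τ
  | succ n ih =>
    exact projStep_mono (fun τ => PHom.comp_mono le_rfl (PHom.comp_mono (ih _) le_rfl)) τ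

theorem proj_mono (τ : Ty 0) : Monotone fun n => proj n τ :=
  monotone_nat_of_le_succ fun n => proj_le_succ n τ

theorem proj_le_id (n : ℕ) (τ : Ty 0) : proj n τ ≤ PHom.id _ := by
  induction n generalizing τ with
  | zero => exact projStep_le_id (fun _ _ => bot_le) τ
  | succ n ih =>
    exact projStep_le_id (fun τ => (PHom.comp_mono le_rfl (PHom.comp_mono (ih _) le_rfl)).trans_eq
      τ.unrollP_rollP) τ

/-- At a recursive type, rolling followed by unrolling cancels in the middle and leaves the square
of the previous approximation. -/
theorem proj_idem (n : ℕ) (τ : Ty 0) : proj n τ ≫ₚ proj n τ = proj n τ := by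
  induction n generalizing τ with
  | zero => exact projStep_idem (fun _ => rfl) τ
  | succ n ih =>
    refine projStep_idem (fun τ => ?_) τ
    simp only [projMu, PHom.assoc]
    rw [← PHom.assoc τ.rollP, τ.rollP_unrollP, PHom.id_comp, ← PHom.assoc (proj n _), ih]

/-- The smaller map absorbs the larger: it equals its own square, and the larger map lies between it
and the identity. -/
theorem proj_comp_of_le {m n : ℕ} (h : m ≤ n) (τ : Ty 0) : proj n τ ≫ₚ proj m τ = proj m τ := by
  apply le_antisymm
  · exact PHom.comp_mono (proj_le_id n τ) le_rfl
  · conv_lhs => rw [← proj_idem m τ]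
    exact PHom.comp_mono (proj_mono τ h) le_rfl

theorem comp_proj_of_le {m n : ℕ} (h : m ≤ n) (τ : Ty 0) : proj m τ ≫ₚ proj n τ = proj m τ := by
  apply le_antisymm
  · exact (PHom.comp_mono le_rfl (proj_le_id n τ)).trans_eq (PHom.comp_id _)
  · conv_lhs => rw [← proj_idem m τ]
    exact PHom.comp_mono le_rfl (proj_mono τ h)

/-! ### Substitution of types -/

namespace Ty

theorem rename_subst {l m n : ℕ} (τ : Ty l) (ρ : Fin l → Fin m) (s : Fin m → Ty n) :
    (τ.rename ρ).subst s = τ.subst fun i => s (ρ i) := by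
  induction τ generalizing m n with
  | var | real | unit => rfl
  | prod _ _ ih ih' | arrow _ _ ih ih' => simp only [rename, subst, ih, ih']
  | variant _ _ ih => simp only [rename, subst, ih]
  | mu τ ih =>
    simp only [rename, subst, ih]
    congr 2
    funext i
    cases i using Fin.cases <;> rfl

theorem rename_rename {l m n : ℕ} (τ : Ty l) (ρ : Fin l → Fin m) (ρ' : Fin m → Fin n) :
    (τ.rename ρ).rename ρ' = τ.rename fun i => ρ' (ρ i) := by
  induction τ generalizing m n with
  | var | real | unit => rfl
  | prod _ _ ih ih' | arrow _ _ ih ih' => simp only [rename, ih, ih']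
  | variant _ _ ih => simp only [rename, ih]
  | mu τ ih =>
    simp only [rename, ih]
    congr 2
    funext i
    cases i using Fin.cases <;> rfl

theorem subst_rename {l m n : ℕ} (τ : Ty l) (s : Fin l → Ty m) (ρ : Fin m → Fin n) :
    (τ.subst s).rename ρ = τ.subst fun i => (s i).rename ρ := by
  induction τ generalizing m n with
  | var | real | unit => rfl
  | prod _ _ ih ih' | arrow _ _ ih ih' => simp only [rename, subst, ih, ih']
  | variant _ _ ih => simp only [rename, subst, ih]
  | mu τ ih =>
    simp only [rename, subst, ih]
    congr 2
    funext i
    cases i using Fin.cases with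
    | zero => rfl
    | succ i => exact (rename_rename (s i) _ _).trans (rename_rename (s i) ρ Fin.succ).symm

theorem subst_subst {l m n : ℕ} (τ : Ty l) (s : Fin l → Ty m) (s' : Fin m → Ty n) :
    (τ.subst s).subst s' = τ.subst fun i => (s i).subst s' := by
  induction τ generalizing m n with
  | var | real | unit => rfl
  | prod _ _ ih ih' | arrow _ _ ih ih' => simp only [subst, ih, ih']
  | variant _ _ ih => simp only [subst, ih]
  | mu τ ih =>
    simp only [subst, ih]
    congr 2
    funext i
    cases i using Fin.cases with
    | zero => rfl
    | succ i => exact (rename_subst _ _ _).trans (subst_rename _ _ _).symm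

theorem subst_var {m : ℕ} (τ : Ty m) : τ.subst var = τ := by
  induction τ with
  | var | real | unit => rfl
  | prod _ _ ih ih' | arrow _ _ ih ih' => simp only [subst, ih, ih']
  | variant _ _ ih => simp only [subst, ih]
  | mu τ ih =>
    rw [subst]
    conv_rhs => rw [← ih]
    congr 2
    funext i
    cases i using Fin.cases <;> rfl

theorem subst_closed (τ : Ty 0) (s : Fin 0 → Ty 0) : τ.subst s = τ := by
  rw [Subsingleton.elim s var, subst_var]

/-- This lets an unrolled recursive type be seen as an instance of its open body, which is
structurally smaller; the convergence proof recurses through it. -/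
theorem unroll_subst {m : ℕ} (τ : Ty (m + 1)) (s : Fin m → Ty 0) :
    (τ.subst (liftSub s)).unroll =
      τ.subst (Fin.cons (.mu (τ.subst (liftSub s))) s : Fin (m + 1) → Ty 0) := by
  rw [unroll, subst_subst]
  congr 1
  funext i
  cases i using Fin.cases with
  | zero => rfl
  | succ i => exact (rename_subst _ _ _).trans (subst_closed _ _)

end Ty

/-! ### The approximations converge to the identity -/

theorem proj_prod (n : ℕ) (σ τ : Ty 0) : proj n (.prod σ τ) = (proj n σ).prod (proj n τ) := by
  cases n <;> rfl

theorem proj_arrow (n : ℕ) (σ τ : Ty 0) : proj n (.arrow σ τ) = (proj n σ).arrow (proj n τ) := by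
  cases n <;> rfl

theorem proj_variant (n : ℕ) (L : Finset ℕ) (τ : {l // l ∈ L} → Ty 0) :
    proj n (.variant L τ) = PHom.sum fun l => proj n (τ l) := by
  cases n <;> rfl

/-- The supremum of the approximations. -/
noncomputable def projSup (τ : Ty 0) : PHom τ.den τ.den := ωSup ⟨⟨_, proj_mono τ⟩⟩

theorem isSup_projSup (τ : Ty 0) : IsSup (fun n => proj n τ) (projSup τ) :=
  isSup_ωSup ⟨⟨_, proj_mono τ⟩⟩

/-- `p` is a partial map on the denotation of `τ`, up to equality of spaces, that lies below the
supremum of the approximations. -/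
def Below (τ : Ty 0) (X : Sp) (p : PHom X X) : Prop := ∃ h : τ.den = X, p ≤ h ▸ projSup τ

namespace Below

theorem mono {τ : Ty 0} {X : Sp} {p q : PHom X X} (h : Below τ X q) (hp : p ≤ q) : Below τ X p :=
  h.imp fun _ h => hp.trans h

theorem sup {τ : Ty 0} {X : Sp} {c : ℕ → PHom X X} {p : PHom X X} (hc : IsSup c p)
    (h : ∀ n, Below τ X (c n)) : Below τ X p := by
  obtain ⟨rfl, -⟩ := h 0
  exact ⟨rfl, hc.lub fun n => (h n).2⟩

theorem real : Below .real ⟨Rl⟩ (PHom.id _) := ⟨rfl, (isSup_projSup .real).le 0⟩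

theorem unit : Below .unit ⟨Unit⟩ (PHom.id _) := ⟨rfl, (isSup_projSup .unit).le 0⟩

theorem prod {σ τ : Ty 0} {X Y : Sp} {p : PHom X X} {q : PHom Y Y} (hp : Below σ X p)
    (hq : Below τ Y q) : Below (.prod σ τ) ⟨X × Y⟩ (p.prod q) := by
  obtain ⟨rfl, hp⟩ := hp
  obtain ⟨rfl, hq⟩ := hq
  refine ⟨rfl, (PHom.prod_mono hp hq).trans ?_⟩
  refine (PHom.isMor_prod.isSup (c := fun n => (proj n σ, proj n τ))
    (x := (projSup σ, projSup τ)) (isSup_prod.2 ⟨isSup_projSup σ, isSup_projSup τ⟩)).lub fun n => ?_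
  exact (proj_prod n σ τ).symm.le.trans ((isSup_projSup (.prod σ τ)).le n)

theorem arrow {σ τ : Ty 0} {X Y : Sp} {p : PHom X X} {q : PHom Y Y} (hp : Below σ X p)
    (hq : Below τ Y q) : Below (.arrow σ τ) ⟨X ⟶ω T Y⟩ (p.arrow q) := by
  obtain ⟨rfl, hp⟩ := hp
  obtain ⟨rfl, hq⟩ := hq
  refine ⟨rfl, (PHom.arrow_mono hp hq).trans ?_⟩
  refine (PHom.isMor_arrow.isSup (c := fun n => (proj n σ, proj n τ))
    (x := (projSup σ, projSup τ)) (isSup_prod.2 ⟨isSup_projSup σ, isSup_projSup τ⟩)).lub fun n => ?_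
  exact (proj_arrow n σ τ).symm.le.trans ((isSup_projSup (.arrow σ τ)).le n)

theorem variant {L : Finset ℕ} {τ : {l // l ∈ L} → Ty 0} {X : {l // l ∈ L} → Sp}
    {p : ∀ l, PHom (X l) (X l)} (hp : ∀ l, Below (τ l) (X l) (p l)) :
    Below (.variant L τ) ⟨Σ l, X l⟩ (PHom.sum p) := by
  choose hX hp using hp
  obtain rfl : (fun l => (τ l).den) = X := funext hX
  refine ⟨rfl, (PHom.sum_mono hp).trans fun ⟨l, x⟩ => ?_⟩
  refine ((isMor_lift_inj (P := fun l => (τ l).den) l).isSup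
    (Hom.isSup_iff.1 (isSup_projSup (τ l)) x)).lub fun n => ?_
  exact (proj_variant n L τ).symm.le ⟨l, x⟩ |>.trans ((isSup_projSup (.variant L τ)).le n ⟨l, x⟩)

end Below

/-! ### Recursive domain equations and substitution -/

/-- A solution of a recursive domain equation. -/
structure RecSol where
  op : Sp → Sp
  space : Sp
  fold : PHom (op space) space
  unfold : PHom space (op space)

/-- The solution given by the bilimit. -/
noncomputable def MFun.recSol {n : ℕ} (F : MFun (n + 1)) (A : Fin n → Sp) : RecSol :=
  ⟨fun X => F.obj (scons X A), F.muObj A, F.foldP A, F.unfoldP A⟩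

theorem MFun.foldP_isSup {n : ℕ} (F : MFun (n + 1)) (A : Fin n → Sp) :
    IsSup (fun k => (F.foldCone A k).bwd ≫ₚ (F.muCone A (k + 1)).fwd) (F.foldP A) :=
  (F.exists_fold A).choose_spec

theorem MFun.unfoldP_isSup {n : ℕ} (F : MFun (n + 1)) (A : Fin n → Sp) :
    IsSup (fun k => (F.muCone A (k + 1)).bwd ≫ₚ (F.foldCone A k).fwd) (F.unfoldP A) :=
  (F.exists_unfold A).choose_spec

/-- The connecting pairs on the two sides are equal but not definitionally so, and the bilimits are
built from them. Abstracting over the pairs allows the equality to be substituted, after which the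
folding and unfolding maps agree as suprema of the same chains. Bundling the solution avoids
transports between the spaces. -/
theorem MFun.recSol_lift {m n : ℕ} (F : MFun (m + 1)) (G : MTup m n) (A : Fin n → Sp) :
    (F.comp G.lift).recSol A = F.recSol (G.obj A) := by
  have key : ∀ (L L' : ∀ k, Sym (F.apx (G.obj A) k) (F.apx (G.obj A) (k + 1)))
      (hL : ∀ k, (L k).IsEP) (hL' : ∀ k, (L' k).IsEP) f u f' u',
      IsSup (fun k => (F.smap (mcons (cone hL k) fun j => Sym.id (G.obj A j))).bwd ≫ₚ
        (cone hL (k + 1)).fwd) f →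
      IsSup (fun k => (cone hL (k + 1)).bwd ≫ₚ
        (F.smap (mcons (cone hL k) fun j => Sym.id (G.obj A j))).fwd) u →
      IsSup (fun k => (F.smap (mcons (cone hL' k) fun j => Sym.id (G.obj A j))).bwd ≫ₚ
        (cone hL' (k + 1)).fwd) f' →
      IsSup (fun k => (cone hL' (k + 1)).bwd ≫ₚ
        (F.smap (mcons (cone hL' k) fun j => Sym.id (G.obj A j))).fwd) u' →
      L = L' → (⟨fun X => F.obj (scons X (G.obj A)), bilim _ L, f, u⟩ : RecSol) =
        ⟨fun X => F.obj (scons X (G.obj A)), bilim _ L', f', u'⟩ := by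
    rintro L _ hL hL' f u f' u' hf hu hf' hu' rfl
    rw [hf.unique hf', hu.unique hu']
  have hc : ∀ k, (F.comp G.lift).foldCone A k =
      F.smap (mcons ((F.comp G.lift).muCone A k) fun j => Sym.id (G.obj A j)) := fun k =>
    (F.smap_lift G _ _).trans (by rw [G.map_id])
  refine key (fun k => (F.comp G.lift).link A k) (fun k => F.link (G.obj A) k)
    ((F.comp G.lift).link_isEP A) (F.link_isEP (G.obj A)) _ _ _ _ ?_ ?_
    (F.foldP_isSup _) (F.unfoldP_isSup _) (funext fun k => F.link_lift G A k)
  · have := (F.comp G.lift).foldP_isSup A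
    simp only [hc] at this
    exact this
  · have := (F.comp G.lift).unfoldP_isSup A
    simp only [hc] at this
    exact this

theorem PHom.comp_cast_comp {A B C : Sp} (h : A = B) (u : PHom C B) (p : PHom A A) (v : PHom B C) :
    u ≫ₚ (h ▸ p : PHom B B) ≫ₚ v = (u ≫ₚ ⟨fun x => (Hom.cast h.symm x : Lift A),
      isMor_coe.comp (Hom.cast h.symm).isMor⟩) ≫ₚ p ≫ₚ
      ⟨fun x => Lift.elim ⊥ v (Hom.cast h x : Lift B), v.isMor.comp (Hom.cast h).isMor⟩ := by
  subst h
  refine Eq.trans ?_ (PHom.assoc _ _ _).symm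
  rfl

theorem Ty.unrollP_comp_rollP (τ : Ty 1) (p : PHom τ.unroll.den τ.unroll.den) :
    τ.sem.unfoldP _ ≫ₚ (τ.den_unroll ▸ p : PHom _ _) ≫ₚ τ.sem.foldP _ =
      τ.unrollP ≫ₚ p ≫ₚ τ.rollP := by
  refine (PHom.comp_cast_comp τ.den_unroll _ _ _).trans (congrArg₂ PHom.comp (Hom.ext fun x => ?_)
    (congrArg (PHom.comp p) (Hom.ext fun x => ?_)))
  · change Lift.elim ⊥ _ (τ.sem.unfoldP _ x) = _
    rw [← PHom.coe_total _ (PHom.ne_bot (τ.sem.unfold_fold _))]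
    rfl
  · exact (PHom.coe_total _ (PHom.ne_bot (τ.sem.fold_unfold _)) _).symm

/-- Conjugation by rolling and unrolling is continuous, and it carries the nth approximation of the
unrolling to approximation n + 1 of the recursive type. -/
theorem Below.mu {τ : Ty 1} {S : RecSol} (hS : τ.sem.recSol (fun i => i.elim0) = S)
    {q : PHom (S.op S.space) (S.op S.space)} (hq : Below τ.unroll (S.op S.space) q) :
    Below (.mu τ) S.space (S.unfold ≫ₚ q ≫ₚ S.fold) := by
  subst hS
  obtain ⟨h, hq⟩ := hq
  refine ⟨rfl, (PHom.comp_mono le_rfl (PHom.comp_mono hq le_rfl)).trans ?_⟩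
  refine (τ.unrollP_comp_rollP (projSup τ.unroll)).le.trans ?_
  refine (PHom.isSup_comp (isSup_const τ.unrollP) (PHom.isSup_comp (isSup_projSup τ.unroll)
    (isSup_const τ.rollP))).lub fun n => ?_
  exact (isSup_projSup (.mu τ)).le (n + 1)

theorem Below.mu_bot {τ : Ty 1} {S : RecSol} (hS : τ.sem.recSol (fun i => i.elim0) = S)
    {q : PHom S.space S.space} (hq : ∀ x, q x = ⊥) : Below (.mu τ) S.space q := by
  subst hS
  exact ⟨rfl, fun x => (hq x).le.trans bot_le⟩

namespace MFun
variable {n : ℕ} (F : MFun (n + 1)) {A B : Fin n → Sp}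

theorem apxMap_flip (f : ∀ i, Sym (A i) (B i)) (k : ℕ) :
    F.apxMap (fun i => (f i).flip) k = (F.apxMap f k).flip := by
  induction k with
  | zero => rfl
  | succ k ih =>
    change F.smap (mcons _ _) = (F.smap (mcons _ _)).flip
    rw [ih, mcons_flip]
    rfl

/-- Functoriality factors the middle map through stage k + 1. Unfolding and folding dominate their
own kth approximations, and the embedding-projection pairs then cancel on both sides. -/
theorem muApx_succ_le (f : ∀ i, Sym (A i) (A i)) (k : ℕ) :
    F.muApx f (k + 1) ≤ F.unfoldP A ≫ₚ
      F.map (mcons ⟨F.muApx (fun i => (f i).flip) k, F.muApx f k⟩ f) ≫ₚ F.foldP A := by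
  have hF : F.map (mcons ⟨F.muApx (fun i => (f i).flip) k, F.muApx f k⟩ f) =
      (F.foldCone A k).bwd ≫ₚ (F.apxMap f (k + 1)).fwd ≫ₚ (F.foldCone A k).fwd := by
    change _ = F.map (fun i => (mcons _ _ i).flip) ≫ₚ F.map (mcons _ _) ≫ₚ F.map (mcons _ _)
    rw [← F.map_comp (mcons (F.apxMap f k) f), ← mcons_comp, ← mcons_flip, ← F.map_comp,
      ← mcons_comp]
    congr 2
    · refine Sym.ext ?_ rfl
      simp only [muApx, apxMap_flip]
      exact (PHom.assoc _ _ _).symm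
    · funext i
      exact Sym.ext (PHom.comp_id _).symm (PHom.comp_id _).symm
  refine le_trans (le_of_eq ?_) (PHom.comp_mono ((F.unfoldP_isSup A).le k)
    (PHom.comp_mono hF.symm.le ((F.foldP_isSup A).le k)))
  simp only [muApx, PHom.assoc]
  rw [← PHom.assoc (F.foldCone A k).fwd (F.foldCone A k).bwd, (F.foldCone_isEP A k).1,
    PHom.id_comp, ← PHom.assoc (F.foldCone A k).fwd (F.foldCone A k).bwd, (F.foldCone_isEP A k).1,
    PHom.id_comp]

end MFun

/-- The tuple of the interpretations of a tuple of types. -/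
noncomputable def MTup.ofTy {m n : ℕ} (s : Fin m → Ty n) : MTup m n where
  obj A j := (s j).sem.obj A
  map f j := (s j).sem.smap f
  map_id A := funext fun j => (s j).sem.smap_id A
  map_comp f g := funext fun j => (s j).sem.smap_comp f g
  map_flip _ _ := rfl
  cont _ _ h j := (s j).sem.smap_isLub h

theorem Ty.sem_subst_liftSub {m : ℕ} (τ : Ty (m + 1)) (s : Fin m → Ty 0) :
    (τ.subst (liftSub s)).sem = τ.sem.comp (MTup.ofTy s).lift :=
  Ty.sem_subst τ _ _ fun j => by
    cases j using Fin.cases with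
    | zero => rfl
    | succ j =>
      change ((s j).rename Fin.succ).sem = _
      rw [Ty.sem_rename (s j) Fin.succ (MTup.shift _) fun _ => rfl]; rfl

/-- The statement about closed types is generalised to open ones so that structural induction can
enter the body of a recursive type. Both directions of the maps must be bounded because function
types exchange them, and they are arbitrary because the recursive variable is instantiated by
approximations of the identity rather than by the identity. -/
theorem Below.subst {m : ℕ} (τ : Ty m) (s : Fin m → Ty 0) (A : Fin m → Sp)
    (f : ∀ i, Sym (A i) (A i)) (hf : ∀ i, Below (s i) (A i) (f i).fwd)
    (hb : ∀ i, Below (s i) (A i) (f i).bwd) :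
    Below (τ.subst s) (τ.sem.obj A) (τ.sem.map f) := by
  induction τ with
  | var i => exact hf i
  | real => exact .real
  | unit => exact .unit
  | prod σ τ ih ih' => exact (ih s A f hf hb).prod (ih' s A f hf hb)
  | arrow σ τ ih ih' => exact (ih s A _ hb hf).arrow (ih' s A f hf hb)
  | variant L τ ih => exact Below.variant fun l => ih l s A f hf hb
  | mu τ ih =>
    have hS : (τ.subst (liftSub s)).sem.recSol (fun i => i.elim0) = τ.sem.recSol A := by
      -- The bounds already record that the spaces are the denotations of the substituted types.
      obtain rfl : (fun i => (s i).den) = A := funext fun i => (hf i).1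
      rw [τ.sem_subst_liftSub s]
      exact τ.sem.recSol_lift _ _
    refine Below.sup (τ.sem.muMap_isSup f) fun k => ?_
    -- The maps vary because the contravariant half of the next stage uses the flipped ones.
    induction k generalizing f with
    | zero =>
      -- Stage 0 is the empty space, so the projection onto it is nowhere defined.
      refine Below.mu_bot hS fun x => ?_
      change Lift.elim ⊥ _ ((τ.sem.muCone A 0).bwd x) = ⊥
      induction (τ.sem.muCone A 0).bwd x using WithBot.recBotCoe with
      | bot => rfl
      | coe x => exact Empty.elim x
    | succ k ihk =>
      -- One more stage costs one more unrolling: its inner map is the action of the body with the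
      -- previous stage in the recursive variable.
      refine Below.mono (Below.mu hS ?_) (τ.sem.muApx_succ_le f k)
      rw [Ty.unroll_subst]
      refine ih _ (scons (τ.sem.muObj A) A) _ (fun i => ?_) fun i => ?_
      · cases i using Fin.cases with
        | zero => exact ihk f hf hb
        | succ i => exact hf i
      · cases i using Fin.cases with
        | zero => exact ihk _ hb hf
        | succ i => exact hb i

/-- The action of a closed type on its empty family of arguments is the identity, so the identity
lies below the supremum; the converse bound is `proj_le_id`. -/
theorem isSup_proj (τ : Ty 0) : IsSup (fun n => proj n τ) (PHom.id τ.den) := by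
  have h := Below.subst τ (fun i => i.elim0) (fun i => i.elim0) (fun i => Sym.id _)
    (fun i => i.elim0) fun i => i.elim0
  rw [τ.subst_closed, τ.sem.map_id] at h
  exact isSup_of (proj_mono τ) (fun n => proj_le_id n τ)
    fun q hq => h.2.trans ((isSup_projSup τ).lub hq)

/-! ## Adequacy -/

section
variable {X Y : Type} [WQbs X] [WQbs Y] {τ : Ty 0} {R : X → Val ℝ τ → Prop}
  {S : Y → Val ℝ τ → Prop} {ν : ℕ → Measure (Val ℝ τ)}

theorem Lifted.mono_rel {b : Bool} {R' : X → Val ℝ τ → Prop} {μ : T X} (h : Lifted b R μ ν)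
    (hR : ∀ x v, R x v → R' x v) : Lifted b R' μ ν := fun w w' hw' h' =>
  h w w' hw' fun x v hx => h' x v (hR x v hx)

/-- Expectations are continuous in the operator, so upper bounds on them pass to suprema. -/
theorem Lifted.sup {c : ℕ → T X} {μ : T X} (hc : IsSup c μ) (h : ∀ n, Lifted true R (c n) ν) :
    Lifted true R μ ν := fun w w' hw' h' =>
  (Hom.isSup_iff.1 (T.isSup_iff.1 hc) w).lub fun n => h n w w' hw' h'

/-- An undefined argument contributes the zero operator, which is below every measure; only the
defined case needs proof. -/
theorem Lifted.ofLift_bind {u : Lift X} {f : X ⟶ω T Y}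
    (h : ∀ x : X, u = x → Lifted true S (f x) ν) : Lifted true S ((T.ofLift u).bind f) ν := by
  induction u using WithBot.recBotCoe with
  | bot => exact fun w w' _ _ => zero_le (a := (_ : Wt))
  | coe x => exact h x rfl

theorem Lifted.bind_ofLift {μ : T X} (h : Lifted true R μ ν) {p : X ⟶ω Lift Y}
    (hp : ∀ x v (y : Y), R x v → p x = y → S y v) :
    Lifted true S (μ.bind ⟨fun x => T.ofLift (p x), T.isMor_ofLift.comp p.isMor⟩) ν :=
  fun w w' hw' h' => h ⟨fun x => (T.ofLift (p x)).1 w,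
    (isMor_incl.comp (T.isMor_ofLift.comp p.isMor)).app (isMor_const w)⟩ w' hw' fun x v hx => by
      change (T.ofLift (p x)).1 w ≤ w' v
      have := hp x v
      generalize p x = u at this ⊢
      induction u using WithBot.recBotCoe with
      | bot => exact zero_le (a := (_ : Wt))
      | coe y => exact h' y v (this y hx rfl)

end

/-! ### Approximations of elements -/

/-- The partial map `p` is defined at `x` with value `y`. -/
def PHom.Maps {A B : Sp} (p : PHom A B) (x : A) (y : B) : Prop := p x = (y : Lift B)

theorem proj_eq_of_le {m n : ℕ} (h : m ≤ n) {τ : Ty 0} {x y : τ.den} (hy : (proj n τ).Maps x y) :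
    proj m τ y = proj m τ x := by
  have : (proj n τ ≫ₚ proj m τ) x = proj m τ x := by rw [proj_comp_of_le h]
  rw [← this]
  change _ = Lift.elim ⊥ _ (proj n τ x)
  rw [show proj _ τ x = _ from hy]
  rfl

theorem proj_eq_self {m n : ℕ} (h : m ≤ n) {τ : Ty 0} {x y : τ.den} (hy : (proj m τ).Maps x y) :
    (proj n τ).Maps y y := by
  have : (proj m τ ≫ₚ proj n τ) x = proj m τ x := by rw [comp_proj_of_le h]
  refine Eq.trans ?_ (this.trans hy)
  change _ = Lift.elim ⊥ _ (proj m τ x)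
  rw [show proj _ τ x = _ from hy]
  rfl

/-- Otherwise the supremum of the approximations, which is the identity, would be undefined at x. -/
theorem exists_proj {τ : Ty 0} (x : τ.den) : ∃ n y, (proj n τ).Maps x y := by
  by_contra! h
  refine WithBot.coe_ne_bot (a := x) ((lift_isSup_bot (Hom.isSup_iff.1 (isSup_proj τ) x)).2
    fun n => ?_)
  by_contra hn
  obtain ⟨y, hy⟩ := Lift.coe_of_ne hn
  exact h n y hy

theorem exists_proj_of_le {m n : ℕ} (h : m ≤ n) {τ : Ty 0} {x y : τ.den} (hy : (proj m τ).Maps x y) :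
    ∃ z, (proj n τ).Maps x z := by
  refine Lift.coe_of_ne fun hn => ?_
  have := proj_mono τ h x
  dsimp only at this
  rw [hn, show proj m τ x = _ from hy] at this
  exact WithBot.coe_ne_bot (le_bot_iff.1 this)

theorem proj_real_eq {n : ℕ} {x y : Rl} (h : (proj n .real).Maps x y) : y = x := by
  cases n <;> exact (WithBot.coe_injective h).symm

theorem proj_prod_eq_coe {n : ℕ} {σ τ : Ty 0} {x y : σ.den × τ.den} :
    (proj n (.prod σ τ)).Maps x y ↔ (proj n σ).Maps x.1 y.1 ∧ (proj n τ).Maps x.2 y.2 := by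
  rw [proj_prod]
  change Lift.elim ⊥ (fun b => Lift.elim ⊥ (fun d => ((b, d) : Lift (σ.den × τ.den)))
    (proj n τ x.2)) (proj n σ x.1) = ((y : σ.den × τ.den) : Lift (σ.den × τ.den)) ↔
      proj n σ x.1 = (y.1 : Lift σ.den) ∧ proj n τ x.2 = (y.2 : Lift τ.den)
  obtain ⟨y, y'⟩ := y
  induction proj n σ x.1 using WithBot.recBotCoe with
  | bot => simp
  | coe a =>
    induction proj n τ x.2 using WithBot.recBotCoe with
    | bot => simp
    | coe b => simp [WithBot.coe_inj]

theorem proj_variant_eq_coe {n : ℕ} {L : Finset ℕ} {τ : {l // l ∈ L} → Ty 0} {l : {l // l ∈ L}}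
    {x : (τ l).den} {y : Σ l, (τ l).den} :
    (proj n (.variant L τ)).Maps (⟨l, x⟩ : Σ l, (τ l).den) y ↔
      ∃ z, (proj n (τ l)).Maps x z ∧ y = ⟨l, z⟩ := by
  rw [proj_variant]
  change Lift.elim ⊥ (fun b => ((⟨l, b⟩ : Σ l, (τ l).den) : Lift (Σ l, (τ l).den)))
    (proj n (τ l) x) = ((y : Σ l, (τ l).den) : Lift (Σ l, (τ l).den)) ↔
      ∃ z : (τ l).den, proj n (τ l) x = (z : Lift (τ l).den) ∧ y = ⟨l, z⟩
  induction proj n (τ l) x using WithBot.recBotCoe with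
  | bot => simp
  | coe a =>
    simp only [Lift.elim_coe, WithBot.coe_inj]
    constructor
    · rintro rfl
      exact ⟨a, rfl, rfl⟩
    · rintro ⟨_, rfl, rfl⟩
      rfl

theorem proj_mu_eq_coe {n : ℕ} {τ : Ty 1} {x y : (Ty.mu τ).den} :
    (proj (n + 1) (.mu τ)).Maps x y ↔
      (proj n τ.unroll).Maps (τ.unrollHom x) (τ.unrollHom y) := by
  change Lift.elim ⊥ τ.rollP (proj n τ.unroll (τ.unrollHom x)) = (y : Lift (Ty.mu τ).den) ↔
    proj n τ.unroll (τ.unrollHom x) = (τ.unrollHom y : Lift τ.unroll.den)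
  induction proj n τ.unroll (τ.unrollHom x) using WithBot.recBotCoe with
  | bot => simp
  | coe a =>
    change ((τ.roll a : (Ty.mu τ).den) : Lift (Ty.mu τ).den) = y ↔ _
    rw [WithBot.coe_inj, WithBot.coe_inj]
    constructor
    · rintro rfl
      exact (τ.unrollHom_roll a).symm
    · rintro rfl
      exact τ.roll_unrollHom y

/-- At function types the partiality sits inside the arguments and results, where it becomes the
zero measure; the approximation itself is total. -/
theorem exists_proj_arrow (n : ℕ) {σ τ : Ty 0} (f : σ.den ⟶ω T τ.den) :
    ∃ g : σ.den ⟶ω T τ.den, (proj n (.arrow σ τ)).Maps f g := by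
  cases n <;> exact ⟨_, rfl⟩

/-- An approximated function projects its argument, runs the original function and projects the
result, and undefined projections only lose mass. -/
theorem Lifted.of_proj_arrow {n : ℕ} {σ τ : Ty 0} {f g : σ.den ⟶ω T τ.den}
    (hg : (proj n (.arrow σ τ)).Maps f g) {x : σ.den}
    {R S : τ.den → Val ℝ τ → Prop} {ν : ℕ → Measure (Val ℝ τ)}
    (h : ∀ y, (proj n σ).Maps x y → Lifted true R (f y) ν)
    (hRS : ∀ y v z, R y v → (proj n τ).Maps y z → S z v) : Lifted true S (g x) ν := by
  have e : proj n (.arrow σ τ) f = (proj n σ).arrow (proj n τ) f :=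
    congrArg (fun p => Hom.toFun p f) (proj_arrow n σ τ)
  have e' := WithBot.coe_injective (hg.symm.trans e)
  rw [show g x = _ from congrArg (fun p : σ.den ⟶ω T τ.den => p x) e']
  exact (Lifted.ofLift_bind h).bind_ofLift hRS

/-! ### The relation between elements and values -/

/-- The evaluation of the application of a function value. -/
noncomputable def evalApp {σ τ : Ty 0} (v : Val ℝ (.arrow σ τ)) (w : Val ℝ σ) (k : ℕ) :
    Measure (Val ℝ τ) := evalN k τ (v.body.subst (Sub.nil.cons w.toTm))

/-- One level of the relation between finite elements and values. -/
noncomputable def relStep (p : ∀ τ : Ty 0, PHom τ.den τ.den)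
    (m : ∀ τ : Ty 1, (Ty.mu τ).den → Val ℝ (.mu τ) → Prop) : ∀ τ : Ty 0, τ.den → Val ℝ τ → Prop :=
  Ty.closedRec (motive := fun τ => τ.den → Val ℝ τ → Prop) (fun x v => x = v.real)
    (fun _ _ => True)
    (fun σ τ R S (x : σ.den × τ.den) v => R x.1 v.fst ∧ S x.2 v.snd)
    (fun σ τ R S (f : σ.den ⟶ω T τ.den) v => (p (.arrow σ τ)).Maps f f ∧
      ∀ x w, R x w → Lifted true S (f x) (evalApp v w))
    (fun _ τ R (x : Σ l, (τ l).den) v => ∃ w, v = .inj x.1 w ∧ R x.1 x.2 w) m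

/-- The relation between the elements fixed by the `n`th approximation and values. -/
noncomputable def rel : ℕ → ∀ τ : Ty 0, τ.den → Val ℝ τ → Prop
  | 0 => relStep (proj 0) fun _ _ _ => False
  | n + 1 => relStep (proj (n + 1)) fun τ x v => rel n τ.unroll (τ.unrollHom x) v.unroll

theorem rel_real {n : ℕ} {x : Rl} {v : Val ℝ .real} : rel n .real x v ↔ x = v.real := by
  cases n <;> rfl

theorem rel_unit {n : ℕ} {x : Unit} {v : Val ℝ .unit} : rel n .unit x v := by
  cases n <;> trivial

theorem rel_prod {n : ℕ} {σ τ : Ty 0} {x : σ.den × τ.den} {v : Val ℝ (.prod σ τ)} :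
    rel n (.prod σ τ) x v ↔ rel n σ x.1 v.fst ∧ rel n τ x.2 v.snd := by
  cases n <;> rfl

theorem rel_arrow {n : ℕ} {σ τ : Ty 0} {f : σ.den ⟶ω T τ.den} {v : Val ℝ (.arrow σ τ)} :
    rel n (.arrow σ τ) f v ↔ (proj n (.arrow σ τ)).Maps f f ∧
      ∀ x w, rel n σ x w → Lifted true (rel n τ) (f x) (evalApp v w) := by
  cases n <;> rfl

theorem rel_variant {n : ℕ} {L : Finset ℕ} {τ : {l // l ∈ L} → Ty 0} {x : Σ l, (τ l).den}
    {v : Val ℝ (.variant L τ)} :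
    rel n (.variant L τ) x v ↔ ∃ w, v = .inj x.1 w ∧ rel n (τ x.1) x.2 w := by
  cases n <;> rfl

/-- Moving up a level and projecting down must be proved together: at a function type each needs the
other for the argument. The outer induction is on the smaller level, the inner one on the closed
type with recursive types as leaves. -/
theorem rel_le {m n : ℕ} (h : m ≤ n) (τ : Ty 0) : (∀ x v, rel m τ x v → rel n τ x v) ∧
    ∀ x v y, rel n τ x v → (proj m τ).Maps x y → rel m τ y v := by
  induction m generalizing n τ with
  | zero => ?_
  | succ m ihm => ?_
  -- Only recursive types depend on the level in an essential way; the other clauses are the same at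
  -- level zero and at successors.
  all_goals
    induction τ using Ty.closedRec with
    | real =>
      refine ⟨fun x v h => rel_real.2 (rel_real.1 h), fun x v y h hy => rel_real.2 ?_⟩
      exact (proj_real_eq hy).trans (rel_real.1 h)
    | unit => exact ⟨fun _ _ _ => rel_unit, fun _ _ _ _ _ => rel_unit⟩
    | prod σ τ ih ih' =>
      refine ⟨fun x v h => ?_, fun x v y h hy => ?_⟩
      · have h := rel_prod.1 h
        exact rel_prod.2 ⟨ih.1 _ _ h.1, ih'.1 _ _ h.2⟩
      · have h := rel_prod.1 h
        have hy := proj_prod_eq_coe.1 hy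
        exact rel_prod.2 ⟨ih.2 _ _ _ h.1 hy.1, ih'.2 _ _ _ h.2 hy.2⟩
    | arrow σ τ ih ih' =>
      refine ⟨fun f v hf => ?_, fun f v g hf hg => ?_⟩
      · have hf := rel_arrow.1 hf
        refine rel_arrow.2 ⟨proj_eq_self h hf.1, fun x w hx => ?_⟩
        -- Since f is fixed at level m, it may be run on the projected argument. A result at level m
        -- is raised to n before being projected down, because projection is only known from level
        -- n.
        exact Lifted.of_proj_arrow hf.1 (fun y hy => hf.2 y w (ih.2 _ _ _ hx hy))
          fun y v z hy hz => ih'.1 _ _ (ih'.2 _ _ _ (ih'.1 _ _ hy) hz)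
      · have hf := rel_arrow.1 hf
        refine rel_arrow.2 ⟨proj_eq_self le_rfl hg, fun x w hx => ?_⟩
        exact Lifted.of_proj_arrow hg
          -- The argument is raised to n, projected down to m and raised again, since f expects
          -- arguments related at level n.
          (fun y hy => hf.2 y w (ih.1 _ _ (ih.2 _ _ _ (ih.1 _ _ hx) hy))) ih'.2
    | variant L τ ih =>
      refine ⟨fun x v h => ?_, fun x v y h hy => ?_⟩
      · obtain ⟨w, rfl, hw⟩ := rel_variant.1 h
        exact rel_variant.2 ⟨w, rfl, (ih _).1 _ _ hw⟩
      · obtain ⟨w, rfl, hw⟩ := rel_variant.1 h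
        obtain ⟨z, hz, rfl⟩ := proj_variant_eq_coe.1 hy
        exact rel_variant.2 ⟨w, rfl, (ih _).2 _ _ _ hw hz⟩
    | mu τ => ?_
  -- At level zero nothing of a recursive type is related and nothing survives the projection.
  · exact ⟨fun _ _ h => h.elim, fun _ _ _ _ h => (WithBot.bot_ne_coe h).elim⟩
  · obtain ⟨n, rfl⟩ := Nat.exists_eq_succ_of_ne_zero (by omega : n ≠ 0)
    have ih := ihm (Nat.succ_le_succ_iff.1 h) τ.unroll
    exact ⟨fun x v h => ih.1 _ _ h, fun x v y h hy => ih.2 _ _ _ h (proj_mu_eq_coe.1 hy)⟩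

/-! ### Values approximating arbitrary elements -/

/-- A value approximates an element if it is related to all its finite approximations. -/
def Approx (τ : Ty 0) (x : τ.den) (v : Val ℝ τ) : Prop :=
  ∀ n y, (proj n τ).Maps x y → rel n τ y v

theorem rel.approx {n : ℕ} {τ : Ty 0} {x : τ.den} {v : Val ℝ τ} (h : rel n τ x v) :
    Approx τ x v := fun k y hy => by
  rcases le_total k n with hk | hk
  · exact (rel_le hk τ).2 x v y h hy
  · exact (rel_le le_rfl τ).2 x v y ((rel_le hk τ).1 x v h) hy

/-- A pair has a projection only where both components do, so information on one component is
extracted at a level where the other is defined as well. -/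
theorem approx_prod {σ τ : Ty 0} {x : σ.den × τ.den} {v : Val ℝ (.prod σ τ)} :
    Approx (.prod σ τ) x v ↔ Approx σ x.1 v.fst ∧ Approx τ x.2 v.snd := by
  constructor
  · intro h
    constructor
    · intro n y hy
      -- The second component may still be undefined at level n; the pair is tested at the maximum
      -- of the two levels and then projected back to n.
      obtain ⟨k, z, hz⟩ := exists_proj x.2
      obtain ⟨z', hz'⟩ := exists_proj_of_le (le_max_right n k) hz
      obtain ⟨y', hy'⟩ := exists_proj_of_le (le_max_left n k) hy
      have := (rel_prod (x := (y', z'))).1 (h _ _ (proj_prod_eq_coe.2 ⟨hy', hz'⟩))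
      exact (rel_le (le_max_left n k) σ).2 _ _ _ this.1
        ((proj_eq_of_le (le_max_left n k) hy').trans hy)
    · intro n y hy
      obtain ⟨k, z, hz⟩ := exists_proj x.1
      obtain ⟨z', hz'⟩ := exists_proj_of_le (le_max_right n k) hz
      obtain ⟨y', hy'⟩ := exists_proj_of_le (le_max_left n k) hy
      have := (rel_prod (x := (z', y'))).1 (h _ _ (proj_prod_eq_coe.2 ⟨hz', hy'⟩))
      exact (rel_le (le_max_left n k) τ).2 _ _ _ this.2
        ((proj_eq_of_le (le_max_left n k) hy').trans hy)
  · rintro ⟨h, h'⟩ n y hy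
    have hy := proj_prod_eq_coe.1 hy
    exact rel_prod.2 ⟨h n _ hy.1, h' n _ hy.2⟩

theorem approx_variant {L : Finset ℕ} {τ : {l // l ∈ L} → Ty 0} {x : Σ l, (τ l).den}
    {v : Val ℝ (.variant L τ)} (h : Approx (.variant L τ) x v) :
    ∃ w, v = .inj x.1 w ∧ Approx (τ x.1) x.2 w := by
  obtain ⟨l, x⟩ := x
  have h' : ∀ n y, (proj n (τ l)).Maps x y → ∃ w, v = .inj l w ∧ rel n (τ l) y w :=
    fun n y hy => rel_variant.1 (h n (⟨l, y⟩ : Σ l, (τ l).den)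
      (proj_variant_eq_coe.2 ⟨y, hy, rfl⟩))
  obtain ⟨n, y, hy⟩ := exists_proj x
  obtain ⟨w, rfl, -⟩ := h' n y hy
  refine ⟨w, rfl, fun n y hy => ?_⟩
  obtain ⟨w', e, hw'⟩ := h' n y hy
  -- Injections with the same label are injective, so the content found at the first defined level
  -- works at all of them.
  cases e
  exact hw'

/-- The result f x is the supremum of the results of the approximated functions on the approximated
arguments, with zero where the argument is undefined. Each of these is handled at its own finite
level, and the bound passes to the supremum. -/
theorem approx_app {σ τ : Ty 0} {f : σ.den ⟶ω T τ.den} {v : Val ℝ (.arrow σ τ)} {x : σ.den}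
    {w : Val ℝ σ} (hf : Approx (.arrow σ τ) f v) (hx : Approx σ x w) :
    Lifted true (Approx τ) (f x) (evalApp v w) := by
  choose g hg using fun n => exists_proj_arrow n f
  -- The approximations of f are total, so the convergence in the lifting restricts to the function
  -- space.
  have h1 : IsSup g f := by
    have : IsSup (fun n => proj n (.arrow σ τ) f) (PHom.id (Ty.arrow σ τ).den f) :=
      Hom.isSup_iff.1 (isSup_proj (.arrow σ τ)) f
    rw [show (fun n => proj n (.arrow σ τ) f) = _ from funext hg] at this
    exact isSup_of (fun i j hij => WithBot.coe_le_coe.1 (this.1 hij))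
      (fun n => WithBot.coe_le_coe.1 (this.le n))
      fun y hy => WithBot.coe_le_coe.1 (this.lub fun n => WithBot.coe_le_coe.2 (hy n))
  have h2 : IsSup (fun n => (T.ofLift (proj n σ x)).bind (g n)) (f x) :=
    ((T.isMor_ofLift.comp isMor_fst).bind isMor_snd).isSup
      (c := fun n => (proj n σ x, g n)) (x := ((x : Lift σ.den), f))
      (isSup_prod.2 ⟨Hom.isSup_iff.1 (isSup_proj σ) x, h1⟩)
  refine Lifted.sup h2 fun n => Lifted.ofLift_bind fun y hy => ?_
  exact ((rel_arrow.1 (hf n _ (hg n))).2 y w (hx n y hy)).mono_rel fun _ _ => rel.approx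

/-- An argument related at level n projects to one that is again related there and hence
approximated by the same value; the hypothesis applies to it, and the results are projected back to
level n. -/
theorem approx_lam {σ τ : Ty 0} {f : σ.den ⟶ω T τ.den} {v : Val ℝ (.arrow σ τ)}
    (h : ∀ x w, Approx σ x w → Lifted true (Approx τ) (f x) (evalApp v w)) :
    Approx (.arrow σ τ) f v := fun n g hg => by
  refine rel_arrow.2 ⟨proj_eq_self le_rfl hg, fun x w hx => ?_⟩
  exact Lifted.of_proj_arrow hg (fun y hy => h y w ((rel_le le_rfl σ).2 _ _ _ hx hy).approx)
    fun y v z hy hz => hy n z hz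

theorem logRel_approx : LogRel true evalN Approx where
  templated := templatedEval_evalN
  mono := evalN_mono
  -- One level over index k is index k + 1, which stays under the same supremum.
  step τ t μ h w w' hw' h' := (h w w' hw' h').trans (iSup_le fun k =>
    le_iSup (fun k => ∫⁻ v, w' v ∂evalN k τ t) (k + 1))
  real x v := ⟨fun h => rel_real.1 (h 0 x rfl), fun h n y hy => rel_real.2
    ((proj_real_eq hy).trans h)⟩
  unit _ _ _ _ _ := rel_unit
  prod _ _ := approx_prod
  inj l x v h n y hy := by
    obtain ⟨z, hz, rfl⟩ := proj_variant_eq_coe.1 hy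
    exact rel_variant.2 ⟨v, rfl, h n z hz⟩
  variant _ _ := approx_variant
  roll {τ} x v h n y hy := by
    cases n with
    -- The projection of level zero is undefined at every rolled element, so there is nothing to
    -- check.
    | zero => exact (WithBot.bot_ne_coe hy).elim
    | succ n =>
      have := proj_mu_eq_coe.1 hy
      rw [τ.unrollHom_roll] at this
      exact h n _ this
  unroll {τ} x v h n y hy := by
    -- Level n of the unrolling is level n + 1 of the recursive type.
    have := h (n + 1) (τ.roll y) (proj_mu_eq_coe.2 (by rw [τ.unrollHom_roll]; exact hy))
    have : rel n τ.unroll (τ.unrollHom (τ.roll y)) v.unroll := this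
    rwa [τ.unrollHom_roll] at this
  app _ _ _ _ := approx_app
  lam t γ θ _ h := approx_lam fun x w hx =>
    (funext fun k => congrArg (evalN k _) (Tm.subst_lift_cons t θ w.toTm) :
      evalApp (.lam (t.subst (θ.lift _))) w = _) ▸ h x w hx

/-! ### Comparing evaluations through denotations -/

/-- The denotation of a closed term is bounded by its evaluation. -/
theorem den_le_lintegral_evalN {τ : Ty 0} (t : Tm ℝ [] τ) (w : τ.den ⟶ω Wt) {w' : Val ℝ τ → Wt}
    (hw' : Measurable w') (h : ∀ x v, Approx τ x v → w x ≤ w' v) :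
    (t.den ()).1 w ≤ ⨆ k, ∫⁻ v, w' v ∂evalN (k + 1) τ t := by
  have := logRel_approx.fundamental t (γ := ()) (θ := Sub.nil) (fun _ x => by cases x) w w' hw' h
  simp only [Tm.subst_nil] at this
  exact this

/-- At type real both relations are equality of numbers, so the indicator of a measurable set is an
admissible weight function on both sides of both estimates. -/
theorem eval_le_eval {t s : Tm ℝ [] .real} (h : t.den ≤ s.den) : eval t ≤ eval s := by
  refine iSup_le fun n => Measure.le_iff.2 fun U hU => ?_
  have hU' : MeasurableSet {r : ℝ | Val.lit r ∈ U} := Val.measurable_lit hU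
  let w : Rl ⟶ω Wt := ⟨fun r => Set.indicator {r : ℝ | Val.lit r ∈ U} 1 r,
    isMor_of_rand (measurable_one.indicator hU')⟩
  have hw : ∀ v : Val ℝ .real, U.indicator (1 : Val ℝ .real → Wt) v = w v.real := fun v => by
    cases v; rfl
  have hw' : Measurable (U.indicator (1 : Val ℝ .real → Wt)) := measurable_one.indicator hU
  have h1 := lintegral_evalN_le n t w hw' fun v => by cases v; rfl
  have h2 := den_le_lintegral_evalN s w hw' fun x v hx => by
    rw [hw, (logRel_approx.real x v).1 hx]
  simp only [lintegral_indicator_one hU] at h1 h2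
  refine h1.trans ((h () w).trans (h2.trans (iSup_le fun k => ?_)))
  -- Only the trivial half of the supremum of measures is used: it dominates each index on every
  -- set.
  exact le_iSup (fun n => evalN n .real s) (k + 1) U

end SFPC

/-- Adequacy: for closed terms of the same type, the denotational order implies the contextual
preorder, and denotational equality implies contextual equivalence. -/
theorem mainTheorem1 (τ : SFPC.Ty 0) (t s : SFPC.Tm ℝ [] τ) :
    (t.den ≤ s.den → SFPC.CtxLe t s) ∧ (t.den = s.den → SFPC.CtxEquiv t s) := by
  have key : ∀ {t s : SFPC.Tm ℝ [] τ}, t.den ≤ s.den → SFPC.CtxLe t s :=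
    fun h C => SFPC.eval_le_eval (C.fill_den_le h)
  exact ⟨key, fun h => ⟨key h.le, key h.ge⟩⟩
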